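/- **Setting.** Let $\mathbb{C}^n_*$ be the set of points of $\mathbb{C}^n$ with pairwise distinct coordinates, let $\mathcal{D}\subseteq\mathbb{C}^n_*$ be a domain, and let $Q_1,\dots,Q_n$ be holomorphic functions on $\mathcal{D}$ with values in the $k\times k$ complex matrices such that $\sum_{j}Q_j(t)=0$ for all $t\in\mathcal{D}$. Consider the family of Fuchsian systems $$\frac{dY}{dx}=\Big(\sum_{1\le j\le n}\frac{Q_j(t)}{x-t_j}\Big)Y,\qquad t=(t_1,\dots,t_n)\in\mathcal{D}, \tag{1}$$ for which $x=\infty$ is a regular point. For $t\in\mathcal{D}$ let $Y(x,t)$ be the solution with $Y(\infty,t)=I$. It is a function on the universal covering surface of $\mathbb{CP}^1\setminus\{t_1,\dots,t_n\}$ with distinguished point $\infty$: its value $Y(x,\alpha,t)$ at $x$ is obtained by analytic continuation along a path $\alpha$ from $\infty$ to $x$ in $\mathbb{CP}^1\setminus\{t_1,\dots,t_n\}$. The derivative $\partial Y/\partial t_j$ at $(x,\alpha,t)$ is taken with $x$ and the path $\alpha$ fixed. **Isoprincipal families.** An open cylindrical neighborhood of $t^0\in\mathbb{C}^n$ is a product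 $\mathcal{W}=\mathcal{W}_1\times\dots\times\mathcal{W}_n$ of simply connected open sets $\mathcal{W}_j\ni t^0_j$ in $\mathbb{C}$ such that each $\mathbb{C}\setminus\overline{\mathcal{W}_j}$ is connected. Write $S\Subset O$ if $O$ is open, $\overline S$ is compact and $\overline S\subset O$. The family (1) is *isoprincipal with the distinguished point $\infty$* if for every $t^0\in\mathcal{D}$ there are open cylindrical neighborhoods $\mathcal{W},\mathcal{V}$ of $t^0$ with $\mathcal{V}\Subset\mathbb{C}^n_*$ and $\mathcal{W}\Subset\mathcal{V}\cap\mathcal{D}$ such that, for every $j$, every $p\in\mathcal{V}_j\setminus\overline{\mathcal{W}_j}$ and every path $\alpha$ from $\infty$ to $p$ in $\mathbb{CP}^1\setminus\bigcup_i\overline{\mathcal{W}_i}$, there exist a matrix function $E$, holomorphic and invertible on the Riemann surface of $\ln\zeta$, and a branch of $\ln(p-\tau)$ continuous in $\tau\in\mathcal{W}_j$, with the following property. For every $t\in\mathcal{W}$ there is a matrix function $H(\cdot,t)$, holomorphic and invertible on all of $\mathcal{V}_j$, such that $$Y(x,\beta\cdot\alpha,t)=H(x,t)\,E(x-t_j)$$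 for every $x\in\mathcal{V}_j\setminus\{t_j\}$ and every path $\beta$ from $p$ to $x$ in $\mathcal{V}_j\setminus\{t_j\}$. Here $\beta\cdot\alpha$ is $\alpha$ followed by $\beta$, and $E(x-t_j)$ is the value of $E$ at the point of the Riemann surface of $\ln\zeta$ over $\zeta=x-t_j$ at which $\ln\zeta$ is the result of continuing the chosen value of $\ln(p-t_j)$ along the path $\beta-t_j$. **Proposition.** Assume that the family (1) is isoprincipal with the distinguished point $\infty$. Then, for every $t\in\mathcal{D}$, the solution $Y$ satisfies on the universal covering surface of $\mathbb{CP}^1\setminus\{t_1,\dots,t_n\}$ the auxiliary system $$\frac{\partial Y}{\partial x}=\sum_{1\le j\le n}\frac{Q_j(t)}{x-t_j}\,Y,\qquad \frac{\partial Y}{\partial t_j}=-\frac{Q_j(t)}{x-t_j}\,Y,\quad 1\le j\le n,$$ where the first equation is considered at finite $x$, and at the points over $x=\infty$ the right-hand side of the second equations is $0$. -/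

import Mathlib

namespace Fuchsian

/-- Square complex matrices of order `k`. -/
abbrev Mat (k : ℕ) := Matrix (Fin k) (Fin k) ℂ

/-- `ℂⁿ_*`: the points of `ℂⁿ` with pairwise distinct coordinates. -/
def distinctPoints (n : ℕ) : Set (Fin n → ℂ) := {t | Function.Injective t}

/-- The coefficient matrix `∑ⱼ Qⱼ(t) / (x - tⱼ)` of the system. -/
noncomputable def coeff {n k : ℕ} (Q : Fin n → (Fin n → ℂ) → Mat k) (t : Fin n → ℂ) (x : ℂ) :
    Mat k :=
  ∑ j, (x - t j)⁻¹ • Q j t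

/-- A holomorphic family of Fuchsian systems parameterized by the pole loci, over a domain
`D ⊆ ℂⁿ_*`, for which `x = ∞` is a regular point (the residues sum up to zero). -/
structure IsHolomorphicFamily {n k : ℕ} (Q : Fin n → (Fin n → ℂ) → Mat k)
    (D : Set (Fin n → ℂ)) : Prop where
  isOpen : IsOpen D
  isConnected : IsConnected D
  subset_distinct : D ⊆ distinctPoints n
  holomorphic : ∀ j, DifferentiableOn ℂ (Q j) D
  sum_eq_zero : ∀ t ∈ D, ∑ j, Q j t = 0

/-! ### Solutions on the punctured Riemann sphere and their analytic continuation

The Riemann sphere is `OnePoint ℂ`, the one-point compactification of the plane. -/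

/-- The coordinate `ζ = 1 / x` at infinity, as the map `ζ ↦ 1 / ζ` from `ℂ` to the sphere. -/
noncomputable def atInfinity (ζ : ℂ) : OnePoint ℂ :=
  open Classical in if ζ = 0 then OnePoint.infty else ((ζ⁻¹ : ℂ) : OnePoint ℂ)

/-- `f` is a (single-valued) holomorphic solution of `dY/dx = (∑ⱼ Qⱼ(t) / (x - tⱼ)) Y` in the
open subset `U` of the punctured sphere `ℂP¹ ∖ {t₁, …, tₙ}`. If `U` contains `∞`, then `f` has to be
holomorphic there in the coordinate `1 / x`. -/
structure SolvesOn {n k : ℕ} (Q : Fin n → (Fin n → ℂ) → Mat k) (t : Fin n → ℂ)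
    (U : Set (OnePoint ℂ)) (f : OnePoint ℂ → Mat k) : Prop where
  isOpen : IsOpen U
  avoids : ∀ j, (t j : OnePoint ℂ) ∉ U
  hasDerivAt : ∀ x : ℂ, (x : OnePoint ℂ) ∈ U →
    HasDerivAt (fun z : ℂ => f (z : OnePoint ℂ)) (coeff Q t x * f (x : OnePoint ℂ)) x
  holomorphic_infty : OnePoint.infty ∈ U → DifferentiableAt ℂ (fun ζ : ℂ => f (atInfinity ζ)) 0

/-- The path `α` lies in the punctured sphere `ℂP¹ ∖ {t₁, …, tₙ}`. -/
def AvoidsPoles {n : ℕ} (t : Fin n → ℂ) {a b : OnePoint ℂ} (α : Path a b) : Prop :=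
  ∀ s j, α s ≠ (t j : OnePoint ℂ)

/-- `y s`, `0 ≤ s ≤ 1`, are the values at `α s` of an analytic continuation along the path `α` of a
solution of the system: locally, they are the values along `α` of a holomorphic solution. -/
def IsContinuation {n k : ℕ} (Q : Fin n → (Fin n → ℂ) → Mat k) (t : Fin n → ℂ)
    {a b : OnePoint ℂ} (α : Path a b) (y : unitInterval → Mat k) : Prop :=
  ∀ s, ∃ U f, α s ∈ U ∧ SolvesOn Q t U f ∧ ∀ᶠ r in nhds s, y r = f (α r)

/-- `v` is the value `Y(x, α)` of the solution normalized by `Y(∞) = I`: the result at the end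
point `x` of the analytic continuation of this solution along the path `α` from `∞` to `x`. -/
def IsSolutionValue {n k : ℕ} (Q : Fin n → (Fin n → ℂ) → Mat k) (t : Fin n → ℂ)
    {x : OnePoint ℂ} (α : Path OnePoint.infty x) (v : Mat k) : Prop :=
  ∃ y : unitInterval → Mat k, IsContinuation Q t α y ∧ y 0 = 1 ∧ y 1 = v

/-- `Y` is the solution of the family normalized by `Y(∞, t) = I`. For fixed `t` it is a function of
the points of the universal covering surface of `ℂP¹ ∖ {t₁, …, tₙ}` with the distinguished point
`∞`, that is, of the end point `x` and of a path `α` from `∞` to `x` in the punctured sphere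
(on other paths `Y` is not restricted). -/
def IsNormalizedSolution {n k : ℕ} (Q : Fin n → (Fin n → ℂ) → Mat k) (D : Set (Fin n → ℂ))
    (Y : (Fin n → ℂ) → (x : OnePoint ℂ) → Path OnePoint.infty x → Mat k) : Prop :=
  ∀ t ∈ D, ∀ (x : OnePoint ℂ) (α : Path OnePoint.infty x), AvoidsPoles t α →
    IsSolutionValue Q t α (Y t x α)

/-- A path in the plane, considered as a path in the sphere. -/
noncomputable def toSphere {a b : ℂ} (β : Path a b) : Path (a : OnePoint ℂ) (b : OnePoint ℂ) :=
  β.map OnePoint.continuous_coe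

/-! ### Cylindrical neighborhoods -/

/-- The cylindrical set with the bases `W j`. -/
def cyl {n : ℕ} (W : Fin n → Set ℂ) : Set (Fin n → ℂ) := Set.univ.pi W

/-- `cyl W` is an open cylindrical neighborhood of `t`. -/
structure IsCylNhd {n : ℕ} (t : Fin n → ℂ) (W : Fin n → Set ℂ) : Prop where
  isOpen : ∀ j, IsOpen (W j)
  mem : ∀ j, t j ∈ W j
  simplyConnected : ∀ j, IsSimplyConnected (W j)
  connected_compl : ∀ j, IsConnected (closure (W j))ᶜ

/-- `S` is compactly included in `O`. -/
def CompactlyIncluded {n : ℕ} (S O : Set (Fin n → ℂ)) : Prop :=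
  IsOpen O ∧ IsCompact (closure S) ∧ closure S ⊆ O

/-- `cyl W`, `cyl V` is a nested pair of open cylindrical neighborhoods of `t` in `D`. -/
structure IsNestedPair {n : ℕ} (D : Set (Fin n → ℂ)) (t : Fin n → ℂ) (W V : Fin n → Set ℂ) :
    Prop where
  inner : IsCylNhd t W
  outer : IsCylNhd t V
  outer_subset : CompactlyIncluded (cyl V) (distinctPoints n)
  inner_subset : CompactlyIncluded (cyl W) (cyl V ∩ D)

/-! ### Isoprincipal families -/

/-- `w` is a continuous branch of `ln (β s - τ)` along the path `β` in `ℂ ∖ {τ}`, with the initial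
value `w₀`. -/
structure IsLogAlong {a b : ℂ} (τ w₀ : ℂ) (β : Path a b) (w : unitInterval → ℂ) : Prop where
  continuous : Continuous w
  exp_eq : ∀ s, Complex.exp (w s) = β s - τ
  initial : w 0 = w₀

/-- The family is isoprincipal with the distinguished point `∞`.

The Riemann surface of `ln ζ` is identified with `ℂ` by means of the global coordinate `w = ln ζ`.
So a function on this surface, holomorphic and invertible, is an entire function `E` of `w` with
invertible values. A coherent family of transplants `E(x - τ)`, `τ ∈ W j`, is determined by a branch
`L τ = ln |p - τ| + i arg (p - τ)`, continuous in `τ ∈ W j`: for a path `β` in `ℂ ∖ {τ}` from `p` to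
`x`, the value of the transplant at the point `(x, β)` is the value of `E` at the logarithm of
`x - τ` obtained from `L τ` by continuation along `β`. -/
def IsIsoprincipal {n k : ℕ} (Q : Fin n → (Fin n → ℂ) → Mat k) (D : Set (Fin n → ℂ)) : Prop :=
  ∀ t₀ ∈ D, ∃ W V : Fin n → Set ℂ, IsNestedPair D t₀ W V ∧
    ∀ (j : Fin n) (p : ℂ), p ∈ V j \ closure (W j) →
    ∀ α : Path OnePoint.infty (p : OnePoint ℂ),
      (∀ s i, ∀ z ∈ closure (W i), α s ≠ (z : OnePoint ℂ)) →
    ∃ (E : ℂ → Mat k) (L : ℂ → ℂ),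
      Differentiable ℂ E ∧ (∀ w, IsUnit (E w)) ∧
      ContinuousOn L (W j) ∧ (∀ τ ∈ W j, Complex.exp (L τ) = p - τ) ∧
      ∀ t ∈ cyl W, ∃ H : ℂ → Mat k,
        DifferentiableOn ℂ H (V j) ∧ (∀ x ∈ V j, IsUnit (H x)) ∧
        ∀ (x : ℂ) (β : Path p x), (∀ s, β s ∈ V j \ {t j}) →
        ∀ w : unitInterval → ℂ, IsLogAlong (t j) (L (t j)) β w →
          IsSolutionValue Q t (α.trans (toSphere β)) (H x * E (w 1))

/-- The value at `x` of `1 / (x - τ)`, which is zero at `x = ∞`. -/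
noncomputable def poleFactor (τ : ℂ) (x : OnePoint ℂ) : ℂ := x.elim 0 fun z => (z - τ)⁻¹

end Fuchsian

namespace Fuchsian

open Set Filter Topology Metric

/-! ### Connectedness in the plane -/

/-! The `x`-equation is read off from local solutions. For the `tⱼ`-equation only the `j`-th pole is
moved, and the logarithmic derivative `G = (∂Y/∂tⱼ) Y⁻¹` is compared with `-S`, where `S(x) = Qⱼ/(x
- tⱼ)`.

Near the pole `tᵢ` isoprincipality gives `Y = H(x,t) E(x - tᵢ)` with `E` independent of `t`.
Differentiating in `tⱼ` and eliminating `E'` by the `x`-equation shows that `G` is holomorphic there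
if `i ≠ j`, and holomorphic minus the coefficient of the system if `i = j`
(`IsPrincipalForm.exists_isLogDeriv`). So `G + S` extends holomorphically over every pole. The
definition assumes no regularity of `H` in `t`. Away from the pole it comes from `H = Y E⁻¹`, and
the maximum principle on circles around the pole carries it inside
(`IsPrincipalForm.exists_hasDerivAt`).

The function `G + S` is a priori multivalued, but every branch continues through every point of the
plane, so monodromy (`exists_forall_of_local_extension`) makes the branch that starts at `∞` an
entire function. Since `Y = I` at `∞`, it tends to zero there, and by Liouville it vanishes
(`exists_isLogDeriv_nbhd_infty`). The identity theorem then carries `G = -S` along every path that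
avoids the poles (`isLogDeriv_of_nbhd_infty`).

Two tools support this. `exists_isLocalFamily` gives fundamental solutions in discs, holomorphic in
the moving pole, and replaces homotopy arguments for `Y`. Unicoherence of the plane
(`isPreconnected_inter_of_union_eq_univ`) makes the collars `V i \ closure (W i)` connected, so that
a branch leaving a neighborhood of a pole is again a branch along a path outside all the closed
sets. -/

theorem continuousOn_indicator_of_eq_zero {X : Type*} [TopologicalSpace X] {S S' P R : Set X}
    (hP : IsOpen P) (hR : IsOpen R) (hPR : Disjoint P R) (hS : S ∩ S' ⊆ P ∪ R) {φ : X → ℝ}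
    (hφ : Continuous φ) (h0 : ∀ z, z ∉ S' → φ z = 0) : ContinuousOn (P.indicator φ) S := by
  intro z hz
  apply ContinuousAt.continuousWithinAt
  by_cases hzP : z ∈ P
  · exact hφ.continuousAt.congr
      (eventually_of_mem (hP.mem_nhds hzP) fun y hy => (indicator_of_mem hy φ).symm)
  by_cases hzS : z ∈ S'
  · have hzR : z ∈ R := (hS ⟨hz, hzS⟩).resolve_left hzP
    exact (continuousAt_const (y := (0 : ℝ))).congr
      (eventually_of_mem (hR.mem_nhds hzR) fun y hy =>
        (indicator_of_notMem (fun h => hPR.le_bot ⟨h, hy⟩) φ).symm)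
  · have h1 : Tendsto (fun y => ‖φ y‖) (𝓝 z) (𝓝 0) := by
      have := hφ.continuousAt (x := z)
      rw [ContinuousAt, h0 z hzS] at this
      simpa using this.norm
    rw [ContinuousAt, indicator_of_notMem hzP]
    exact squeeze_zero_norm (fun y => norm_indicator_le_norm_self φ y) h1

/-- The difference of two logarithms of one function takes values in the discrete set `2πiℤ`. -/
theorem sub_eq_sub_of_exp_eq {X : Type*} [TopologicalSpace X] {S : Set X} (hS : IsPreconnected S)
    {f g : X → ℂ} (hf : ContinuousOn f S) (hg : ContinuousOn g S)
    (h : ∀ z ∈ S, Complex.exp (f z) = Complex.exp (g z)) {x y : X} (hx : x ∈ S) (hy : y ∈ S) :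
    f x - g x = f y - g y := by
  have hpi : (2 * (Real.pi : ℂ) * Complex.I) ≠ 0 := Complex.two_pi_I_ne_zero
  have hd : DiscreteTopology (range ((↑) : ℤ → ℝ)) :=
    Int.isClosedEmbedding_coe_real.isEmbedding.toHomeomorph.symm.isEmbedding.discreteTopology
  have hz : ∀ z ∈ S, ∃ m : ℤ, (f z - g z) / (2 * Real.pi * Complex.I) = m := by
    intro z hz
    obtain ⟨m, hm⟩ := Complex.exp_eq_exp_iff_exists_int.1 (h z hz)
    exact ⟨m, by rw [hm]; field_simp; ring⟩
  have hc : ContinuousOn (fun z => ((f z - g z) / (2 * Real.pi * Complex.I)).re) S :=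
    Complex.continuous_re.comp_continuousOn ((hf.sub hg).div_const _)
  have hm : MapsTo (fun z => ((f z - g z) / (2 * Real.pi * Complex.I)).re) S
      (range ((↑) : ℤ → ℝ)) := by
    intro z hzS
    obtain ⟨m, hm⟩ := hz z hzS
    exact ⟨m, by simp [hm]⟩
  have := hS.constant_of_mapsTo ⟨hd⟩ hc hm hx hy
  obtain ⟨m, hm⟩ := hz x hx
  obtain ⟨m', hm'⟩ := hz y hy
  simp only [hm, hm', Complex.intCast_re, Int.cast_inj] at this
  have h2 : (f x - g x) / (2 * Real.pi * Complex.I) = (f y - g y) / (2 * Real.pi * Complex.I) := by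
    rw [hm, hm', this]
  exact (div_left_inj' hpi).1 h2

/-- Unicoherence of the plane. -/
theorem isPreconnected_inter_of_union_eq_univ {A B : Set ℂ} (hA : IsOpen A) (hB : IsOpen B)
    (cA : IsPreconnected A) (cB : IsPreconnected B) (hAB : A ∪ B = univ) :
    IsPreconnected (A ∩ B) := by
  rw [isPreconnected_iff_subset_of_disjoint]
  intro u v hu hv huv hd
  by_contra! hcon
  obtain ⟨hnu, hnv⟩ := hcon
  obtain ⟨q, hq, hqu⟩ := not_subset.1 hnu
  obtain ⟨p, hp, hpv⟩ := not_subset.1 hnv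
  have hpu : p ∈ u := (huv hp).resolve_right hpv
  have hqv : q ∈ v := (huv hq).resolve_left hqu
  set P := (A ∩ B) ∩ u with hPdef
  set R := (A ∩ B) ∩ v with hRdef
  have hP : IsOpen P := (hA.inter hB).inter hu
  have hR : IsOpen R := (hA.inter hB).inter hv
  have hPR : Disjoint P R := by
    rw [Set.disjoint_iff]
    rintro z ⟨⟨hz, hz1⟩, _, hz2⟩
    exact hd.subset ⟨hz, hz1, hz2⟩
  have hcov : A ∩ B ⊆ P ∪ R := fun z hz =>
    (huv hz).imp (fun h => ⟨hz, h⟩) (fun h => ⟨hz, h⟩)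
  have hdisj : Disjoint Bᶜ Aᶜ := by
    rw [Set.disjoint_iff]
    rintro z ⟨h1, h2⟩
    rcases (hAB.symm.subset (mem_univ z)) with h | h
    exacts [h2 h, h1 h]
  -- The cut-off `g` is 0 off `B` and 1 off `A`, so `g` restricted to `P` and extended by zero is
  -- continuous on `A`, and `g - 1` treated likewise is continuous on `B`. Multiplied by `2πi` they
  -- differ by a period on `P` and agree elsewhere, so their exponentials define one nowhere zero
  -- continuous function on the plane.
  obtain ⟨g, hg0, hg1, -⟩ := exists_continuous_zero_one_of_isClosed hB.isClosed_compl
    hA.isClosed_compl hdisj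
  have ca : ContinuousOn (P.indicator g) A :=
    continuousOn_indicator_of_eq_zero hP hR hPR hcov g.continuous fun z hz => hg0 hz
  have cb : ContinuousOn (P.indicator fun z => g z - 1) B :=
    continuousOn_indicator_of_eq_zero hP hR hPR (by rwa [inter_comm]) (by fun_prop)
      fun z hz => by simp [hg1 hz]
  set a : ℂ → ℂ := fun z => 2 * Real.pi * Complex.I * (P.indicator g z : ℝ)
  set b : ℂ → ℂ := fun z => 2 * Real.pi * Complex.I * (P.indicator (fun z => g z - 1) z : ℝ)
  have ca' : ContinuousOn a A :=
    continuousOn_const.mul (Complex.continuous_ofReal.comp_continuousOn ca)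
  have cb' : ContinuousOn b B :=
    continuousOn_const.mul (Complex.continuous_ofReal.comp_continuousOn cb)
  have hab : ∀ z, Complex.exp (a z) = Complex.exp (b z) := by
    intro z
    by_cases hz : z ∈ P
    · simp only [a, b, indicator_of_mem hz]
      push_cast
      rw [mul_sub, mul_one, Complex.exp_sub, Complex.exp_two_pi_mul_I, div_one]
    · simp only [a, b, indicator_of_notMem hz]
  have ch : Continuous fun z => Complex.exp (a z) := by
    rw [← continuousOn_univ, ← hAB]
    refine ContinuousOn.union_of_isOpen ?_ ?_ hA hB
    · exact Complex.continuous_exp.comp_continuousOn ca'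
    · exact (Complex.continuous_exp.comp_continuousOn cb').congr fun z _ => hab z
  have hsc : IsSimplyConnected (univ : Set ℂ) := by
    have : ContractibleSpace (univ : Set ℂ) := (Homeomorph.Set.univ ℂ).contractibleSpace
    exact (inferInstance : SimplyConnectedSpace (univ : Set ℂ))
  obtain ⟨φ, cφ, hφ⟩ := Complex.exists_continuousOn_eqOn_exp_comp hsc isOpen_univ ch.continuousOn
    (by rintro ⟨z, -, hz⟩; exact Complex.exp_ne_zero _ hz)
  -- The global logarithm `φ` differs from `a` by a constant on `A` and from `b` by a constant on
  -- `B`. Hence `φ p - φ q` would equal both `2πi g(p)` and `2πi (g(p) - 1)`.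
  have e1 := sub_eq_sub_of_exp_eq cA (cφ.mono (subset_univ _)) ca' (fun z _ => hφ (mem_univ z))
    hp.1 hq.1
  have e2 := sub_eq_sub_of_exp_eq cB (cφ.mono (subset_univ _)) cb'
    (fun z _ => (hφ (mem_univ z)).trans (hab z)) hp.2 hq.2
  have hpP : p ∈ P := ⟨hp, hpu⟩
  have hqP : q ∉ P := fun h => hPR.le_bot ⟨h, hq, hqv⟩
  simp only [a, b, indicator_of_mem hpP, indicator_of_notMem hqP] at e1 e2
  have : (2 * (Real.pi : ℂ) * Complex.I) = 0 := by
    push_cast at e1 e2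
    linear_combination e2 - e1
  exact Complex.two_pi_I_ne_zero this

/-! ### The monodromy principle in the plane -/

section Monodromy
variable {E : Type*} [NormedAddCommGroup E] [NormedSpace ℂ E]

theorem eqOn_of_convex_of_analyticAt {N : Set ℂ} (hN : Convex ℝ N) {f g : ℂ → E}
    (hf : ∀ z ∈ N, AnalyticAt ℂ f z) (hg : ∀ z ∈ N, AnalyticAt ℂ g z) {z₀ : ℂ} (h₀ : z₀ ∈ N)
    (h : f =ᶠ[𝓝 z₀] g) : EqOn f g N :=
  AnalyticOnNhd.eqOn_of_preconnected_of_eventuallyEq hf hg hN.isPreconnected h₀ h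

/-- The radius in `hext` depends on the point and not on the germ, so a germ can be continued along
every segment from `x₀`. Convex neighborhoods of these segments take the place of homotopies: any
two of them meet in a convex set containing `x₀`, where the extensions agree. -/
theorem exists_forall_of_local_extension (P : ℂ → (ℂ → E) → Prop)
    (hcongr : ∀ x f g, f =ᶠ[𝓝 x] g → P x f → P x g)
    (han : ∀ x f, P x f → AnalyticAt ℂ f x)
    (hext : ∀ x, ∃ r > 0, ∀ y ∈ ball x r, ∀ f, P y f →
      ∃ g, g =ᶠ[𝓝 y] f ∧ ∀ z ∈ ball x r, P z g)
    {x₀ : ℂ} {f₀ : ℂ → E} (h₀ : P x₀ f₀) :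
    ∃ f, f =ᶠ[𝓝 x₀] f₀ ∧ ∀ x, P x f := by
  have claim : ∀ x, ∃ N : Set ℂ, IsOpen N ∧ Convex ℝ N ∧ x₀ ∈ N ∧ x ∈ N ∧
      ∃ g, g =ᶠ[𝓝 x₀] f₀ ∧ ∀ z ∈ N, P z g := by
    intro x
    set γ : unitInterval → ℂ := fun s => AffineMap.lineMap x₀ x (s : ℝ) with hγ
    have cγ : Continuous γ := by
      rw [hγ]; exact AffineMap.lineMap_continuous.comp continuous_subtype_val
    set S : Set unitInterval := {s | ∃ N : Set ℂ, IsOpen N ∧ Convex ℝ N ∧ x₀ ∈ N ∧ γ s ∈ N ∧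
      ∃ g, g =ᶠ[𝓝 x₀] f₀ ∧ ∀ z ∈ N, P z g} with hS
    have hSo : IsOpen S := by
      rw [isOpen_iff_mem_nhds]
      rintro s ⟨N, hN, hNc, hx₀, hs, g, hg⟩
      filter_upwards [cγ.continuousAt.preimage_mem_nhds (hN.mem_nhds hs)] with s' hs'
      exact ⟨N, hN, hNc, hx₀, hs', g, hg⟩
    have hSc : IsClosed S := by
      rw [← closure_subset_iff_isClosed]
      intro s hs
      obtain ⟨r, hr, hrext⟩ := hext (γ s)
      have hU : γ ⁻¹' ball (γ s) r ∈ 𝓝 s :=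
        cγ.continuousAt.preimage_mem_nhds (ball_mem_nhds _ hr)
      obtain ⟨s', hs'r, N, hN, hNc, hx₀, hs', g, hg, hgP⟩ := mem_closure_iff_nhds.1 hs _ hU
      obtain ⟨g₂, hg₂, hg₂P⟩ := hrext (γ s') hs'r g (hgP _ hs')
      have heq : EqOn g₂ g (N ∩ ball (γ s) r) :=
        eqOn_of_convex_of_analyticAt (hNc.inter (convex_ball _ _)) (fun z hz => han _ _ (hg₂P z hz.2))
          (fun z hz => han _ _ (hgP z hz.1)) ⟨hs', hs'r⟩ hg₂
      -- Up to `γ s'` the segment stays in the convex set `N`, and from there on in the convex ball.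
      have hseg : segment ℝ x₀ (γ s) ⊆ N ∪ ball (γ s) r := by
        rw [segment_eq_image_lineMap]
        rintro _ ⟨θ, ⟨hθ0, hθ1⟩, rfl⟩
        have e : AffineMap.lineMap x₀ (γ s) θ = AffineMap.lineMap x₀ x (θ * (s : ℝ)) := by
          simp only [hγ, AffineMap.lineMap_apply, vsub_eq_sub, vadd_eq_add, add_sub_cancel_right,
            smul_smul]
        have e0 : x₀ = AffineMap.lineMap (k := ℝ) x₀ x (0 : ℝ) := by simp
        rcases le_total (θ * (s : ℝ)) s' with h | h
        · left
          refine hNc.segment_subset hx₀ hs' ?_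
          have h0 : 0 ≤ θ * (s : ℝ) := mul_nonneg hθ0 s.2.1
          rcases eq_or_lt_of_le s'.2.1 with h1 | h1
          · have : θ * (s : ℝ) = 0 := le_antisymm (h1 ▸ h) h0
            rw [e, this, ← e0]; exact left_mem_segment _ _ _
          · rw [e, segment_eq_image_lineMap]
            refine ⟨θ * s / s', ⟨by positivity, (div_le_one h1).2 h⟩, ?_⟩
            simp only [hγ, AffineMap.lineMap_apply, vsub_eq_sub, vadd_eq_add,
              add_sub_cancel_right, smul_smul]
            rw [div_mul_cancel₀ _ h1.ne']
        · right
          refine (convex_ball _ _).segment_subset hs'r (mem_ball_self hr) ?_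
          have hθs : θ * (s : ℝ) ≤ s := mul_le_of_le_one_left s.2.1 hθ1
          rcases eq_or_lt_of_le (h.trans hθs) with h1 | h1
          · have : θ * (s : ℝ) = s := le_antisymm hθs (h1 ▸ h)
            rw [e, this]; exact right_mem_segment _ _ _
          · rw [e, segment_eq_image_lineMap]
            have h2 : (0 : ℝ) < s - s' := sub_pos.2 h1
            refine ⟨(θ * s - s') / (s - s'), ⟨div_nonneg (sub_nonneg.2 h) h2.le,
              (div_le_one h2).2 (by linarith)⟩, ?_⟩
            have h3 : (((θ * s - s') / (s - s') : ℝ) : ℂ) * (((s : ℝ) : ℂ) - ((s' : ℝ) : ℂ)) =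
                θ * (s : ℝ) - (s' : ℝ) := by
              rw [← Complex.ofReal_sub, ← Complex.ofReal_mul, div_mul_cancel₀ _ h2.ne']
              push_cast; ring
            simp only [hγ, AffineMap.lineMap_apply, vsub_eq_sub, vadd_eq_add, Complex.real_smul]
            push_cast at h3 ⊢
            linear_combination (x - x₀) * h3
      have hcs : IsCompact (segment ℝ x₀ (γ s)) := by
        rw [segment_eq_image_lineMap]
        exact isCompact_Icc.image AffineMap.lineMap_continuous
      -- The union of `N` and the ball need not be convex, but a thickening of a segment is, and a
      -- thin one fits into the union.
      obtain ⟨δ, hδ, hδN⟩ := hcs.exists_thickening_subset_open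
        (hN.union isOpen_ball) hseg
      classical
      refine ⟨thickening δ (segment ℝ x₀ (γ s)), isOpen_thickening, (convex_segment _ _).thickening _,
        self_subset_thickening hδ _ (left_mem_segment _ _ _),
        self_subset_thickening hδ _ (right_mem_segment _ _ _),
        fun z => if z ∈ N then g z else g₂ z, ?_, ?_⟩
      · filter_upwards [hg, hN.mem_nhds hx₀] with z hz hzN
        simp [hzN, hz]
      · intro z hz
        rcases hδN hz with hzN | hzb
        · refine hcongr z g _ ?_ (hgP z hzN)
          filter_upwards [hN.mem_nhds hzN] with w hw
          simp [hw]
        · refine hcongr z g₂ _ ?_ (hg₂P z hzb)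
          filter_upwards [isOpen_ball.mem_nhds hzb] with w hw
          split_ifs with hwN
          · exact heq ⟨hwN, hw⟩
          · rfl
    have hSu : S = univ := by
      refine IsClopen.eq_univ ⟨hSc, hSo⟩ ⟨0, ?_⟩
      obtain ⟨r, hr, hrext⟩ := hext x₀
      obtain ⟨g, hg, hgP⟩ := hrext x₀ (mem_ball_self hr) f₀ h₀
      exact ⟨ball x₀ r, isOpen_ball, convex_ball _ _, mem_ball_self hr,
        by simpa [hγ] using hr, g, hg, hgP⟩
    have h1 : (1 : unitInterval) ∈ S := hSu ▸ mem_univ _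
    simpa [hS, hγ] using h1
  choose N hN hNc hx₀ hx g hg hgP using claim
  have key : ∀ x, ∀ z ∈ N x, g z z = g x z := by
    intro x z hz
    refine eqOn_of_convex_of_analyticAt ((hNc z).inter (hNc x)) (fun w hw => han _ _ (hgP z w hw.1))
      (fun w hw => han _ _ (hgP x w hw.2)) ⟨hx₀ z, hx₀ x⟩ ((hg z).trans (hg x).symm) ⟨hx z, hz⟩
  refine ⟨fun z => g z z, ?_, fun x => ?_⟩
  · filter_upwards [(hN x₀).mem_nhds (hx x₀), hg x₀] with z hz hz'
    rw [key x₀ z hz, hz']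
  · refine hcongr x (g x) _ ?_ (hgP x x (hx x))
    filter_upwards [(hN x).mem_nhds (hx x)] with z hz
    rw [key x z hz]

end Monodromy

/-! ### Holomorphic dependence on a parameter -/

section Param
variable {E : Type*} [NormedAddCommGroup E] [NormedSpace ℂ E] [CompleteSpace E]

/-- The Schwarz lemma applied twice, to `f` and then to its difference quotient. The point is that
the rate depends on `f` only through the bound `M`, so it is uniform over families. -/
theorem exists_dist_slope_deriv_le {ε M : ℝ} (hε : 0 < ε) {τ₀ : ℂ} {f : ℂ → E}
    (hf : DifferentiableOn ℂ f (ball τ₀ ε)) (hM : ∀ τ ∈ ball τ₀ ε, ‖f τ‖ ≤ M) {τ : ℂ}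
    (hτ : τ ∈ ball τ₀ ε) :
    dist (dslope f τ₀ τ) (deriv f τ₀) ≤ 4 * M / ε / ε * dist τ τ₀ := by
  have h0 : τ₀ ∈ ball τ₀ ε := mem_ball_self hε
  have hb : ∀ z ∈ ball τ₀ ε, ‖dslope f τ₀ z‖ ≤ 2 * M / ε := by
    intro z hz
    refine Complex.norm_dslope_le_div_of_mapsTo_ball hf (fun w hw => ?_) hz
    rw [mem_closedBall, dist_eq_norm]
    linarith [norm_sub_le (f w) (f τ₀), hM w hw, hM τ₀ h0]
  have hd : DifferentiableOn ℂ (dslope f τ₀) (ball τ₀ ε) :=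
    (Complex.differentiableOn_dslope (isOpen_ball.mem_nhds h0)).2 hf
  have := Complex.dist_le_div_mul_dist_of_mapsTo_ball (R₂ := 4 * M / ε) hd (fun w hw => ?_) hτ
  · rwa [dslope_same] at this
  · rw [mem_closedBall, dist_eq_norm]
    have := norm_sub_le (dslope f τ₀ w) (dslope f τ₀ τ₀)
    have h1 := hb w hw
    have h2 := hb τ₀ h0
    have h3 : 4 * M / ε = 2 * M / ε + 2 * M / ε := by ring
    linarith

/-- A function holomorphic in `x` on a closed disc whose boundary values depend holomorphically on
a parameter has a derivative with respect to the parameter which is holomorphic in the disc. -/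
theorem exists_hasDerivAt_param {ε M R : ℝ} (hε : 0 < ε) {τ₀ c : ℂ}
    {F : ℂ → ℂ → E} (hF : ∀ τ ∈ ball τ₀ ε, DiffContOnCl ℂ (F τ) (ball c R))
    (hFτ : ∀ x ∈ sphere c R, DifferentiableOn ℂ (fun τ => F τ x) (ball τ₀ ε))
    (hM : ∀ τ ∈ ball τ₀ ε, ∀ x ∈ sphere c R, ‖F τ x‖ ≤ M) :
    ∃ g : ℂ → E, DifferentiableOn ℂ g (ball c R) ∧
      ∀ x ∈ ball c R, HasDerivAt (fun τ => F τ x) (g x) τ₀ := by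
  set D : ℂ → ℂ → E := fun τ x => (τ - τ₀)⁻¹ • (F τ x - F τ₀ x) with hD
  have h0 : τ₀ ∈ ball τ₀ ε := mem_ball_self hε
  have hDd : ∀ τ ∈ ball τ₀ ε, DiffContOnCl ℂ (D τ) (ball c R) := fun τ hτ =>
    ((hF τ hτ).sub (hF τ₀ h0)).const_smul _
  have hsph : ∀ τ ∈ ball τ₀ ε, τ ≠ τ₀ → ∀ x ∈ sphere c R,
      dist (D τ x) (deriv (fun τ => F τ x) τ₀) ≤ 4 * M / ε / ε * dist τ τ₀ := by
    intro τ hτ hne x hx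
    have := exists_dist_slope_deriv_le hε (hFτ x hx) (fun τ hτ => hM τ hτ x hx) hτ
    rw [dslope_of_ne _ hne, slope_def_module] at this
    exact this
  -- Inside the disc nothing is known about the dependence on `τ`; the maximum principle transfers
  -- the Cauchy estimate from the boundary circle.
  have hin : ∀ τ ∈ ball τ₀ ε, τ ≠ τ₀ → ∀ τ' ∈ ball τ₀ ε, τ' ≠ τ₀ → ∀ x ∈ ball c R,
      dist (D τ x) (D τ' x) ≤ 4 * M / ε / ε * (dist τ τ₀ + dist τ' τ₀) := by
    intro τ hτ hne τ' hτ' hne' x hx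
    have hR : R ≠ 0 := (pos_of_mem_ball hx).ne'
    rw [dist_eq_norm]
    refine Complex.norm_le_of_forall_mem_frontier_norm_le (f := fun x => D τ x - D τ' x)
      (U := ball c R) isBounded_ball ((hDd τ hτ).sub (hDd τ' hτ')) (fun z hz => ?_)
      (subset_closure hx)
    rw [frontier_ball c hR] at hz
    rw [← dist_eq_norm, mul_add]
    refine (dist_triangle_right _ _ (deriv (fun τ => F τ z) τ₀)).trans ?_
    exact add_le_add (hsph τ hτ hne z hz) (hsph τ' hτ' hne' z hz)
  have hcau : UniformCauchySeqOn D (𝓝[≠] τ₀) (ball c R) := by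
    intro u hu
    obtain ⟨δ, hδ, hδu⟩ := Metric.mem_uniformity_dist.1 hu
    have hev : ∀ᶠ τ in 𝓝[≠] τ₀, τ ≠ τ₀ ∧ τ ∈ ball τ₀ ε ∧ 4 * M / ε / ε * dist τ τ₀ < δ / 2 := by
      have hc : ContinuousAt (fun τ => 4 * M / ε / ε * dist τ τ₀) τ₀ := by fun_prop
      have h2 := hc.eventually_lt (continuousAt_const (y := δ / 2)) (by simpa using hδ)
      exact eventually_mem_nhdsWithin.and
        ((eventually_of_mem (ball_mem_nhds τ₀ hε) fun _ h => h).and h2 |>.filter_mono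
          nhdsWithin_le_nhds)
    filter_upwards [hev.prod_mk hev] with m hm x hx
    refine hδu ((hin _ hm.1.2.1 hm.1.1 _ hm.2.2.1 hm.2.1 x hx).trans_lt ?_)
    linarith [hm.1.2.2, hm.2.2.2]
  have hlim : ∀ x ∈ ball c R, ∃ l, Tendsto (fun τ => D τ x) (𝓝[≠] τ₀) (𝓝 l) := fun x hx =>
    cauchy_map_iff_exists_tendsto.1 (hcau.cauchy_map hx)
  choose! g hg using hlim
  refine ⟨g, ?_, fun x hx => ?_⟩
  · refine (hcau.tendstoUniformlyOn_of_tendsto hg).tendstoLocallyUniformlyOn.differentiableOn ?_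
      isOpen_ball
    filter_upwards [mem_nhdsWithin_of_mem_nhds (ball_mem_nhds τ₀ hε)] with τ hτ
    exact (hDd τ hτ).differentiableOn
  · rw [hasDerivAt_iff_tendsto_slope]
    exact (hg x hx).congr fun τ => by rw [slope_def_module]

end Param

/-! ### Linear differential equations with a holomorphic parameter -/

section ODE
variable {𝔸 : Type*} [NormedRing 𝔸] [NormedAlgebra ℂ 𝔸]

/-- The Taylor coefficients of the solution of `Y' = (∑ bₘ uᵐ) Y`, `Y(0) = 1`. -/
noncomputable def odeCoeff (b : ℕ → 𝔸) : ℕ → 𝔸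
  | 0 => 1
  | m + 1 => ((m : ℂ) + 1)⁻¹ • ∑ l : Fin (m + 1), b l * odeCoeff b (m - l)

theorem odeCoeff_succ (b : ℕ → 𝔸) (m : ℕ) :
    odeCoeff b (m + 1) = ((m : ℂ) + 1)⁻¹ • ∑ l ∈ Finset.range (m + 1), b l * odeCoeff b (m - l) := by
  rw [odeCoeff, Finset.sum_range]

/-- The method of majorants with the factor `1/(m+1)` discarded: the sum of `M ρ^l (ρ+M)^(m-l)` over
`l ≤ m` telescopes to `(ρ+M)^(m+1) - ρ^(m+1)`. The norm of the unit is kept because it is not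
assumed to be 1. -/
theorem norm_odeCoeff_le {b : ℕ → 𝔸} {M ρ : ℝ} (hM : 0 ≤ M) (hρ : 0 ≤ ρ)
    (hb : ∀ m, ‖b m‖ ≤ M * ρ ^ m) (m : ℕ) : ‖odeCoeff b m‖ ≤ ‖(1 : 𝔸)‖ * (ρ + M) ^ m := by
  induction m using Nat.strong_induction_on with
  | _ m ih =>
    rcases m with _ | m
    · simp [odeCoeff]
    rw [odeCoeff_succ, norm_smul]
    have h1 : ‖((m : ℂ) + 1)⁻¹‖ ≤ 1 := by
      rw [norm_inv]
      apply inv_le_one_of_one_le₀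
      have : ((m : ℂ) + 1) = ((m + 1 : ℕ) : ℂ) := by push_cast; ring
      rw [this, Complex.norm_natCast]
      push_cast; linarith [(Nat.cast_nonneg m : (0 : ℝ) ≤ m)]
    have h2 : ‖∑ l ∈ Finset.range (m + 1), b l * odeCoeff b (m - l)‖ ≤
        ‖(1 : 𝔸)‖ * (ρ + M) ^ (m + 1) := by
      calc _ ≤ ∑ l ∈ Finset.range (m + 1), (M * ρ ^ l) * (‖(1 : 𝔸)‖ * (ρ + M) ^ (m - l)) := by
            refine norm_sum_le_of_le _ fun l hl => (norm_mul_le _ _).trans ?_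
            exact mul_le_mul (hb l) (ih _ (by omega)) (norm_nonneg _) (by positivity)
        _ = ‖(1 : 𝔸)‖ * ((ρ + M) ^ (m + 1) - ρ ^ (m + 1)) := by
            have := geom_sum₂_mul ρ (ρ + M) (m + 1)
            have h3 : (∑ l ∈ Finset.range (m + 1), ρ ^ l * (ρ + M) ^ (m + 1 - 1 - l)) * M =
                (ρ + M) ^ (m + 1) - ρ ^ (m + 1) := by linarith
            rw [← h3, Finset.sum_mul, Finset.mul_sum]
            exact Finset.sum_congr rfl fun l _ => by rw [Nat.add_sub_cancel]; ring
        _ ≤ _ := by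
            gcongr
            linarith [pow_nonneg hρ (m + 1)]
    calc _ ≤ 1 * (‖(1 : 𝔸)‖ * (ρ + M) ^ (m + 1)) := by gcongr
      _ = _ := one_mul _

theorem differentiableOn_odeCoeff {b : ℕ → ℂ → 𝔸} {S : Set ℂ}
    (hb : ∀ m, DifferentiableOn ℂ (b m) S) (m : ℕ) :
    DifferentiableOn ℂ (fun τ => odeCoeff (fun i => b i τ) m) S := by
  induction m using Nat.strong_induction_on with
  | _ m ih =>
    rcases m with _ | m
    · simp only [odeCoeff]; exact differentiableOn_const _
    simp only [odeCoeff_succ]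
    refine DifferentiableOn.fun_const_smul (DifferentiableOn.fun_sum fun l _ => ?_) ((m : ℂ) + 1)⁻¹
    exact DifferentiableOn.fun_mul (hb l) (ih _ (by omega))

variable [CompleteSpace 𝔸]

/-- The condition on `r` makes the differentiated series dominated by a multiple of `m / 2^m`; the
equation is then the recursion for `odeCoeff` read through the Cauchy product. -/
theorem hasDerivAt_tsum_odeCoeff {b : ℕ → 𝔸} {M ρ r : ℝ} (hM : 0 ≤ M) (hρ : 0 < ρ)
    (hb : ∀ m, ‖b m‖ ≤ M * ρ ^ m) (hr : 0 < r) (hr2 : (ρ + M) * r ≤ 1 / 2) {u : ℂ}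
    (hu : u ∈ ball (0 : ℂ) r) :
    HasDerivAt (fun u => ∑' m, u ^ m • odeCoeff b m)
      ((∑' m, u ^ m • b m) * ∑' m, u ^ m • odeCoeff b m) u := by
  set σ := ρ + M with hσ
  have hσ0 : 0 < σ := by positivity
  set K := ‖(1 : 𝔸)‖
  have hK : 0 ≤ K := norm_nonneg _
  have ha := norm_odeCoeff_le hM hρ.le hb
  have hur : ‖u‖ < r := by simpa using hu
  have hs1 : Summable fun m => ‖u ^ m • b m‖ := by
    refine Summable.of_nonneg_of_le (fun _ => norm_nonneg _) (fun m => ?_)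
      ((summable_geometric_of_lt_one (by positivity : (0 : ℝ) ≤ ρ * r) (by nlinarith)).mul_left M)
    rw [norm_smul, norm_pow, mul_pow]
    calc _ ≤ r ^ m * (M * ρ ^ m) := by gcongr; exact hb m
      _ = _ := by ring
  have hs2 : Summable fun m => ‖u ^ m • odeCoeff b m‖ := by
    refine Summable.of_nonneg_of_le (fun _ => norm_nonneg _) (fun m => ?_)
      ((summable_geometric_of_lt_one (by positivity : (0 : ℝ) ≤ σ * r) (by linarith)).mul_left K)
    rw [norm_smul, norm_pow, mul_pow]
    calc _ ≤ r ^ m * (K * σ ^ m) := by gcongr; exact ha m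
      _ = _ := by ring
  have hsum : Summable fun m : ℕ => 2 * K * σ * ((m : ℝ) * (1 / 2) ^ m) := by
    have := summable_pow_mul_geometric_of_norm_lt_one (R := ℝ) 1 (r := 1 / 2) (by norm_num)
    simpa using this.mul_left (2 * K * σ)
  have hbd : ∀ m : ℕ, ∀ v ∈ ball (0 : ℂ) r, ‖((m : ℂ) * v ^ (m - 1)) • odeCoeff b m‖ ≤
      2 * K * σ * ((m : ℝ) * (1 / 2) ^ m) := by
    intro m v hv
    rcases m with _ | m
    · simp
    have hvr : ‖v‖ ≤ r := by simpa using (mem_ball.1 hv).le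
    rw [norm_smul, norm_mul, Complex.norm_natCast, norm_pow, Nat.add_sub_cancel]
    calc _ ≤ ((m + 1 : ℕ) : ℝ) * r ^ m * (K * σ ^ (m + 1)) := by gcongr; exact ha _
      _ = K * σ * ((m + 1 : ℕ) * (σ * r) ^ m) := by rw [mul_pow]; ring
      _ ≤ K * σ * ((m + 1 : ℕ) * (1 / 2) ^ m) := by gcongr
      _ = _ := by rw [pow_succ]; ring
  have hder := hasDerivAt_tsum_of_isPreconnected (𝕜 := ℂ) hsum isOpen_ball
    (convex_ball (0 : ℂ) r).isPreconnected
    (g := fun m v => v ^ m • odeCoeff b m) (g' := fun m v => ((m : ℂ) * v ^ (m - 1)) • odeCoeff b m)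
    (fun m v _ => (hasDerivAt_pow m v).smul_const _) hbd hu hs2.of_norm hu
  refine HasDerivAt.congr_deriv hder ?_
  have hs3 : Summable fun m : ℕ => ((m : ℂ) * u ^ (m - 1)) • odeCoeff b m :=
    Summable.of_norm_bounded hsum fun m => hbd m u hu
  rw [tsum_mul_tsum_eq_tsum_sum_range_of_summable_norm hs1 hs2, hs3.tsum_eq_zero_add]
  simp only [Nat.cast_zero, zero_mul, zero_smul, zero_add, Nat.add_sub_cancel]
  refine tsum_congr fun m => ?_
  rw [odeCoeff_succ, smul_smul]
  have h1 : (((m + 1 : ℕ) : ℂ) * u ^ m) * ((m : ℂ) + 1)⁻¹ = u ^ m := by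
    have : ((m : ℂ) + 1) ≠ 0 := Nat.cast_add_one_ne_zero m
    push_cast; field_simp
  rw [h1, Finset.smul_sum]
  refine Finset.sum_congr rfl fun l hl => ?_
  have hl' : l ≤ m := by simpa [Nat.lt_succ_iff] using hl
  rw [smul_mul_smul_comm, ← pow_add, Nat.add_sub_cancel' hl']

/-- A fundamental solution near `u = 0` of `Y' = (∑ bₘ uᵐ) Y`, where the coefficients depend
holomorphically on a parameter. -/
theorem exists_fundamental_family {S : Set ℂ} (hS : IsOpen S) {b : ℕ → ℂ → 𝔸}
    (hb : ∀ m, DifferentiableOn ℂ (b m) S) {M ρ : ℝ} (hM : 0 ≤ M) (hρ : 0 < ρ)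
    (hbM : ∀ m, ∀ τ ∈ S, ‖b m τ‖ ≤ M * ρ ^ m) :
    ∃ r > 0, r * ρ < 1 ∧ ∃ Φ : ℂ → ℂ → 𝔸,
      (∀ τ ∈ S, ∀ u ∈ ball (0 : ℂ) r, HasDerivAt (Φ τ) ((∑' m, u ^ m • b m τ) * Φ τ u) u) ∧
      (∀ τ, Φ τ 0 = 1) ∧
      (∀ u ∈ ball (0 : ℂ) r, DifferentiableOn ℂ (fun τ => Φ τ u) S) ∧
      (∀ τ ∈ S, ∀ u ∈ ball (0 : ℂ) r, IsUnit (Φ τ u)) ∧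
      ∃ K, ∀ τ ∈ S, ∀ u ∈ ball (0 : ℂ) r, ‖Φ τ u‖ ≤ K := by
  set σ := ρ + M with hσ
  have hσ0 : 0 < σ := by positivity
  set K := ‖(1 : 𝔸)‖ with hKdef
  have hK : 0 ≤ K := norm_nonneg _
  -- Besides `q ≤ 1/2`, this choice gives `K q / (1 - q) < 1`: the series without its constant term
  -- has norm below 1, so the sum is invertible by the Neumann series.
  set q : ℝ := 1 / (2 * (K + 1)) with hq
  have hq0 : 0 < q := by positivity
  have hq2 : q ≤ 1 / 2 := by
    rw [hq]; apply one_div_le_one_div_of_le <;> linarith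
  have hqK : q * (K + 1) = 1 / 2 := by rw [hq]; field_simp
  set r := q / σ with hr
  have hr0 : 0 < r := by positivity
  have hσr : σ * r = q := by rw [hr]; field_simp
  have ha : ∀ τ ∈ S, ∀ u ∈ ball (0 : ℂ) r, ∀ m,
      ‖u ^ m • odeCoeff (fun i => b i τ) m‖ ≤ K * q ^ m := by
    intro τ hτ u hu m
    have hur : ‖u‖ ≤ r := by simpa using (mem_ball.1 hu).le
    rw [norm_smul, norm_pow]
    calc _ ≤ r ^ m * (K * σ ^ m) := by
          gcongr; exact norm_odeCoeff_le hM hρ.le (fun m => hbM m τ hτ) m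
      _ = K * (σ * r) ^ m := by rw [mul_pow]; ring
      _ = _ := by rw [hσr]
  have hgeo : Summable fun m : ℕ => K * q ^ m :=
    (summable_geometric_of_lt_one hq0.le (by linarith)).mul_left K
  refine ⟨r, hr0, ?_, fun τ u => ∑' m, u ^ m • odeCoeff (fun i => b i τ) m, ?_, ?_, ?_, ?_, ?_⟩
  · have : ρ * r ≤ σ * r := by gcongr; linarith
    linarith
  · intro τ hτ u hu
    exact hasDerivAt_tsum_odeCoeff hM hρ (fun m => hbM m τ hτ) hr0 (by rw [hσr]; exact hq2) hu
  · intro τ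
    beta_reduce
    rw [tsum_eq_single 0 (fun m hm => by simp [hm])]
    simp [odeCoeff]
  · intro u hu
    exact Complex.differentiableOn_tsum_of_summable_norm hgeo
      (fun m => (differentiableOn_odeCoeff hb m).fun_const_smul (u ^ m)) hS (fun m τ hτ => ha τ hτ u hu m)
  · intro τ hτ u hu
    have hs : Summable fun m => u ^ m • odeCoeff (fun i => b i τ) m :=
      Summable.of_norm_bounded hgeo (ha τ hτ u hu)
    have hs' : HasSum (fun m : ℕ => K * q ^ (m + 1)) (K * q * (1 - q)⁻¹) := by
      have := (hasSum_geometric_of_lt_one hq0.le (by linarith : q < 1)).mul_left (K * q)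
      simpa only [pow_succ', mul_assoc] using this
    have h1 : ‖∑' m, u ^ (m + 1) • odeCoeff (fun i => b i τ) (m + 1)‖ ≤ K * q * (1 - q)⁻¹ :=
      tsum_of_norm_bounded hs' fun m => ha τ hτ u hu (m + 1)
    have h2 : K * q * (1 - q)⁻¹ < 1 := by
      rw [← div_eq_mul_inv, div_lt_one (by linarith)]
      nlinarith
    have := isUnit_one_sub_of_norm_lt_one
      (x := -∑' m, u ^ (m + 1) • odeCoeff (fun i => b i τ) (m + 1)) (by
        rw [norm_neg]; exact h1.trans_lt h2)
    beta_reduce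
    rw [hs.tsum_eq_zero_add]
    simpa [odeCoeff, sub_neg_eq_add] using this
  · exact ⟨_, fun τ hτ u hu => tsum_of_norm_bounded hgeo.hasSum (ha τ hτ u hu)⟩

/-- Variation of constants: from `(Φ⁻¹)' = -Φ⁻¹ B` the two contributions cancel. This makes every
local solution a constant multiple of the fundamental one. -/
theorem hasDerivAt_inverse_mul_eq_zero {Φ f : ℂ → 𝔸} {B : 𝔸} {u : ℂ} (hu : IsUnit (Φ u))
    (hΦ : HasDerivAt Φ (B * Φ u) u) (hf : HasDerivAt f (B * f u) u) :
    HasDerivAt (fun v => Ring.inverse (Φ v) * f v) 0 u := by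
  obtain ⟨w, hw⟩ := hu
  have h1 : HasDerivAt (fun v => Ring.inverse (Φ v)) (-(↑w⁻¹ * (B * Φ u) * ↑w⁻¹)) u := by
    have := hasFDerivAt_ringInverse (𝕜 := ℂ) w
    rw [hw] at this
    have h2 := this.comp_hasDerivAt u hΦ
    simp only [neg_apply, ContinuousLinearMap.mulLeftRight_apply] at h2
    exact h2
  have h3 := HasDerivAt.fun_mul h1 hf
  refine HasDerivAt.congr_deriv h3 ?_
  have h4 : (↑w⁻¹ * (B * (w : 𝔸)) * ↑w⁻¹ : 𝔸) = ↑w⁻¹ * B := by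
    rw [mul_assoc, mul_assoc B, Units.mul_inv, mul_one]
  rw [← hw, Ring.inverse_unit, h4]
  noncomm_ring

/-- Such an `f` is analytic at `u`, so its derivative is continuous there. Needed at `∞`, where
`SolvesOn` demands holomorphy but no equation. -/
theorem hasDerivAt_of_eventually_ne {E : Type*} [NormedAddCommGroup E] [NormedSpace ℂ E]
    [CompleteSpace E] {f g : ℂ → E} {u : ℂ} (hf : DifferentiableAt ℂ f u) (hg : ContinuousAt g u)
    (h : ∀ᶠ v in 𝓝[≠] u, HasDerivAt f (g v) v) : HasDerivAt f (g u) u := by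
  have hd : ∀ᶠ v in 𝓝 u, DifferentiableAt ℂ f v := by
    rw [eventually_nhdsWithin_iff] at h
    filter_upwards [h] with v hv
    by_cases hvu : v = u
    · exact hvu ▸ hf
    · exact (hv hvu).differentiableAt
  have ha : AnalyticAt ℂ f u := Complex.analyticAt_iff_eventually_differentiableAt.2 hd
  have h1 : Tendsto (deriv f) (𝓝[≠] u) (𝓝 (deriv f u)) :=
    ha.deriv.continuousAt.tendsto.mono_left nhdsWithin_le_nhds
  have h2 : Tendsto (deriv f) (𝓝[≠] u) (𝓝 (g u)) :=
    (hg.tendsto.mono_left nhdsWithin_le_nhds).congr' (h.mono fun v hv => hv.deriv.symm)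
  exact tendsto_nhds_unique h1 h2 ▸ hf.hasDerivAt

end ODE

-- A submultiplicative norm on matrices, so that the results for normed algebras apply to `Mat k`.
attribute [local instance] Matrix.linftyOpNormedRing Matrix.linftyOpNormedAlgebra

section

/-! ### Coordinates on the sphere -/

/-- The coordinate chart centered at `a`. -/
noncomputable def chart (a : OnePoint ℂ) : ℂ → OnePoint ℂ :=
  a.elim atInfinity fun c u => ((c + u : ℂ) : OnePoint ℂ)

/-- The coordinate centered at `a`, inverse to `chart a`. -/
noncomputable def coord (a x : OnePoint ℂ) : ℂ :=
  a.elim (x.elim 0 fun z => z⁻¹) fun c => x.elim 0 fun z => z - c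

/-- The inverse of the position of the pole `τ` in the coordinate centered at `a`. -/
noncomputable def invPole (a : OnePoint ℂ) (τ : ℂ) : ℂ :=
  a.elim τ fun c => (τ - c)⁻¹

@[simp] theorem chart_coe (c u : ℂ) : chart (c : OnePoint ℂ) u = ((c + u : ℂ) : OnePoint ℂ) := rfl
@[simp] theorem chart_infty : chart OnePoint.infty = atInfinity := rfl
@[simp] theorem coord_coe_coe (c z : ℂ) : coord (c : OnePoint ℂ) (z : OnePoint ℂ) = z - c := rfl
@[simp] theorem coord_infty_coe (z : ℂ) : coord OnePoint.infty (z : OnePoint ℂ) = z⁻¹ := rfl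
@[simp] theorem coord_infty_infty : coord OnePoint.infty OnePoint.infty = 0 := rfl
@[simp] theorem invPole_coe (c τ : ℂ) : invPole (c : OnePoint ℂ) τ = (τ - c)⁻¹ := rfl
@[simp] theorem invPole_infty (τ : ℂ) : invPole OnePoint.infty τ = τ := rfl

@[simp] theorem atInfinity_zero : atInfinity 0 = OnePoint.infty := by simp [atInfinity]

theorem atInfinity_of_ne {u : ℂ} (hu : u ≠ 0) : atInfinity u = ((u⁻¹ : ℂ) : OnePoint ℂ) := by
  simp [atInfinity, hu]

@[simp] theorem chart_zero (a : OnePoint ℂ) : chart a 0 = a := by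
  induction a using OnePoint.rec <;> simp

@[simp] theorem coord_chart (a : OnePoint ℂ) (u : ℂ) : coord a (chart a u) = u := by
  induction a using OnePoint.rec
  · by_cases hu : u = 0
    · simp [hu]
    · simp [atInfinity_of_ne hu]
  · simp

@[simp] theorem coord_self (a : OnePoint ℂ) : coord a a = 0 := by
  have := coord_chart a 0
  rwa [chart_zero] at this

/-- Equality of the filters gives continuity and openness of the charts at once. At `∞` it holds
because inversion exchanges punctured neighborhoods of 0 with complements of bounded sets. -/
theorem map_chart_nhds (a : OnePoint ℂ) (u : ℂ) : map (chart a) (𝓝 u) = 𝓝 (chart a u) := by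
  induction a using OnePoint.rec with
  | coe c =>
    have : chart (c : OnePoint ℂ) = (fun z : ℂ => (z : OnePoint ℂ)) ∘ fun v => c + v := rfl
    rw [this, ← map_map, map_add_left_nhds, ← OnePoint.nhds_coe_eq]
    rfl
  | infty =>
    rw [chart_infty]
    by_cases hu : u = 0
    · subst hu
      have h1 : atInfinity =ᶠ[𝓝[≠] 0] (fun z : ℂ => (z : OnePoint ℂ)) ∘ Inv.inv :=
        eventually_mem_nhdsWithin.mono fun v hv => atInfinity_of_ne hv
      rw [atInfinity_zero, OnePoint.nhds_infty_eq, coclosedCompact_eq_cocompact,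
        ← cobounded_eq_cocompact, ← inv_nhdsNE_zero, ← nhdsNE_sup_pure (0 : ℂ), map_sup, map_pure,
        atInfinity_zero, map_congr h1, ← map_map]
      rfl
    · have h1 : atInfinity =ᶠ[𝓝 u] (fun z : ℂ => (z : OnePoint ℂ)) ∘ Inv.inv := by
        filter_upwards [isOpen_ne.mem_nhds hu] with v hv
        exact atInfinity_of_ne hv
      have h2 : map Inv.inv (𝓝 u) = 𝓝 u⁻¹ := (nhds_inv₀ hu).symm
      rw [map_congr h1, ← map_map, h2, ← OnePoint.nhds_coe_eq, atInfinity_of_ne hu]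

theorem continuous_chart (a : OnePoint ℂ) : Continuous (chart a) :=
  continuous_iff_continuousAt.2 fun u => (map_chart_nhds a u).le

theorem isOpenMap_chart (a : OnePoint ℂ) : IsOpenMap (chart a) :=
  IsOpenMap.of_nhds_le fun u => (map_chart_nhds a u).ge

theorem eventually_nhds_chart {a : OnePoint ℂ} {u : ℂ} {p : OnePoint ℂ → Prop} :
    (∀ᶠ x in 𝓝 (chart a u), p x) ↔ ∀ᶠ v in 𝓝 u, p (chart a v) := by
  rw [← map_chart_nhds, eventually_map]

theorem chart_coord {a x : OnePoint ℂ} (h : x ∈ range (chart a)) : chart a (coord a x) = x := by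
  obtain ⟨u, rfl⟩ := h
  rw [coord_chart]

/-- The chart neighborhood of radius `r`. -/
def nbhd (a : OnePoint ℂ) (r : ℝ) : Set (OnePoint ℂ) := chart a '' ball 0 r

theorem isOpen_nbhd (a : OnePoint ℂ) (r : ℝ) : IsOpen (nbhd a r) := isOpenMap_chart a _ isOpen_ball

theorem mem_nbhd_self (a : OnePoint ℂ) {r : ℝ} (hr : 0 < r) : a ∈ nbhd a r :=
  ⟨0, mem_ball_self hr, chart_zero a⟩

theorem coord_mem_ball {a x : OnePoint ℂ} {r : ℝ} (h : x ∈ nbhd a r) : coord a x ∈ ball 0 r := by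
  obtain ⟨u, hu, rfl⟩ := h
  rwa [coord_chart]

theorem chart_coord_of_mem {a x : OnePoint ℂ} {r : ℝ} (h : x ∈ nbhd a r) :
    chart a (coord a x) = x := chart_coord (image_subset_range _ _ h)

theorem nbhd_coe (c : ℂ) (r : ℝ) : nbhd (c : OnePoint ℂ) r = (↑) '' ball c r := by
  ext x
  constructor
  · rintro ⟨u, hu, rfl⟩
    exact ⟨c + u, by simpa [dist_eq_norm] using hu, rfl⟩
  · rintro ⟨z, hz, rfl⟩
    exact ⟨z - c, by simpa [dist_eq_norm] using hz, by simp⟩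

/-! ### The system in the coordinates -/

variable {n k : ℕ}

/-- The coefficient of the system in the coordinate centered at `a`. -/
noncomputable def chartCoeff (Q : Fin n → (Fin n → ℂ) → Mat k) (t : Fin n → ℂ) (a : OnePoint ℂ)
    (u : ℂ) : Mat k :=
  -- With `s = invPole a τ` the factor `-s/(1 - us)` is `1/(u - 1/s)` for `s ≠ 0`. It stays
  -- meaningful for `s = 0`, when the pole is at infinity of the coordinate `1/x`.
  -∑ j, (invPole a (t j) * (1 - u * invPole a (t j))⁻¹) • Q j t

theorem chart_ne_of_norm_lt {a : OnePoint ℂ} {u τ : ℂ} (ha : a ≠ τ) (h : ‖u * invPole a τ‖ < 1) :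
    chart a u ≠ τ := by
  intro he
  have h1 : u * invPole a τ = 1 := by
    induction a using OnePoint.rec with
    | coe c =>
      rw [chart_coe, OnePoint.coe_eq_coe] at he
      have hc : τ - c ≠ 0 := fun h0 => ha (by rw [sub_eq_zero.1 h0])
      have : u = τ - c := by rw [← he]; ring
      rw [invPole_coe, this, mul_inv_cancel₀ hc]
    | infty =>
      by_cases hu : u = 0
      · simp [hu] at he
      · rw [chart_infty, atInfinity_of_ne hu, OnePoint.coe_eq_coe] at he
        rw [invPole_infty, ← he, mul_inv_cancel₀ hu]
  rw [h1, norm_one] at h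
  exact lt_irrefl _ h

theorem one_sub_mul_invPole_ne {a : OnePoint ℂ} {u τ : ℂ} (h : chart a u ≠ τ) :
    1 - u * invPole a τ ≠ 0 := by
  intro h0
  apply h
  have h1 : u * invPole a τ = 1 := (sub_eq_zero.1 h0).symm
  induction a using OnePoint.rec with
  | coe c =>
    have : u = τ - c := by
      have := eq_inv_of_mul_eq_one_left h1
      simpa using this
    simp [this]
  | infty =>
    have hu : u ≠ 0 := left_ne_zero_of_mul_eq_one h1
    rw [chart_infty, atInfinity_of_ne hu, eq_inv_of_mul_eq_one_left h1]
    simp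

theorem continuousAt_chartCoeff {Q : Fin n → (Fin n → ℂ) → Mat k} {t : Fin n → ℂ}
    {a : OnePoint ℂ} {u : ℂ} (h : ∀ j, chart a u ≠ t j) :
    ContinuousAt (chartCoeff Q t a) u := by
  have h1 : ∀ j ∈ Finset.univ, ContinuousAt
      (fun u => (invPole a (t j) * (1 - u * invPole a (t j))⁻¹) • Q j t) u := fun j _ => by
    have h2 : ContinuousAt (fun u => 1 - u * invPole a (t j)) u := by fun_prop
    exact (continuousAt_const.mul (h2.inv₀ (one_sub_mul_invPole_ne (h j)))).smul continuousAt_const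
  exact (tendsto_finsetSum _ h1).neg

theorem chartCoeff_coe {Q : Fin n → (Fin n → ℂ) → Mat k} {t : Fin n → ℂ} {c u : ℂ}
    (h : ∀ j, c ≠ t j) : chartCoeff Q t c u = coeff Q t (c + u) := by
  rw [chartCoeff, coeff, ← Finset.sum_neg_distrib]
  refine Finset.sum_congr rfl fun j _ => ?_
  rw [← neg_smul]
  congr 1
  have h0 : t j - c ≠ 0 := sub_ne_zero.2 (h j).symm
  rw [invPole_coe, ← mul_inv, ← inv_neg]
  congr 1
  field_simp
  ring

/-- The change of variable alone produces an additional term `-u⁻¹ ∑ⱼ Qⱼ`; its vanishing is the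
regularity of the system at `∞`. -/
theorem chartCoeff_infty {Q : Fin n → (Fin n → ℂ) → Mat k} {t : Fin n → ℂ}
    (hQ : ∑ j, Q j t = 0) {u : ℂ} (hu : u ≠ 0) (h : ∀ j, u⁻¹ ≠ t j) :
    chartCoeff Q t OnePoint.infty u = -(u ^ 2)⁻¹ • coeff Q t u⁻¹ := by
  have : chartCoeff Q t OnePoint.infty u = chartCoeff Q t OnePoint.infty u - u⁻¹ • ∑ j, Q j t := by
    rw [hQ, smul_zero, sub_zero]
  rw [this, chartCoeff, coeff, ← Finset.sum_neg_distrib, Finset.smul_sum, Finset.smul_sum,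
    ← Finset.sum_sub_distrib]
  refine Finset.sum_congr rfl fun j _ => ?_
  rw [← neg_smul, ← sub_smul, smul_smul]
  congr 1
  have h1 : 1 - u * t j ≠ 0 := fun h0 => h j (by
    exact (eq_inv_of_mul_eq_one_right (sub_eq_zero.1 h0).symm).symm)
  have h2 : u⁻¹ - t j ≠ 0 := sub_ne_zero.2 (h j)
  rw [invPole_infty]
  have h3 : (u⁻¹ - t j)⁻¹ = u * (1 - u * t j)⁻¹ := by
    rw [← div_eq_mul_inv, eq_div_iff h1, inv_mul_eq_iff_eq_mul₀ h2]
    field_simp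
  have h4 : u * (1 - u * t j)⁻¹ * t j = (1 - u * t j)⁻¹ - 1 := by
    field_simp
    ring
  have h5 : u⁻¹ * u = 1 := inv_mul_cancel₀ hu
  rw [h3]
  linear_combination (exp := 1) (-u⁻¹) * h4 + (t j * (1 - u * t j)⁻¹ + u⁻¹ * (1 - u * t j)⁻¹) * h5

/-- The chain rule everywhere except at `∞` itself, where the equation follows by continuity from
the punctured disc. -/
theorem SolvesOn.hasDerivAt_chart {Q : Fin n → (Fin n → ℂ) → Mat k} {t : Fin n → ℂ}
    (hQ : ∑ j, Q j t = 0) {U : Set (OnePoint ℂ)} {f : OnePoint ℂ → Mat k} (hf : SolvesOn Q t U f)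
    {a : OnePoint ℂ} (ha : ∀ j, a ≠ t j) {u : ℂ} (hu : chart a u ∈ U) :
    HasDerivAt (fun v => f (chart a v)) (chartCoeff Q t a u * f (chart a u)) u := by
  have key : ∀ v, chart a v ∈ U → (a = OnePoint.infty → v ≠ 0) →
      HasDerivAt (fun v => f (chart a v)) (chartCoeff Q t a v * f (chart a v)) v := by
    intro v hv h0
    induction a using OnePoint.rec with
    | coe c =>
      rw [chartCoeff_coe fun j h => ha j (by rw [h])]
      exact (hf.hasDerivAt (c + v) hv).comp_const_add c v
    | infty =>
      have hv0 := h0 rfl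
      rw [chart_infty, atInfinity_of_ne hv0] at hv
      rw [chartCoeff_infty hQ hv0 fun j h => hf.avoids j (h ▸ hv), chart_infty,
        atInfinity_of_ne hv0, smul_mul_assoc]
      have := (hf.hasDerivAt v⁻¹ hv).scomp v (hasDerivAt_inv hv0)
      refine this.congr_of_eventuallyEq ?_
      filter_upwards [isOpen_ne.mem_nhds hv0] with w hw
      simp [atInfinity_of_ne hw]
  by_cases h : a = OnePoint.infty → u ≠ 0
  · exact key u hu h
  push Not at h
  obtain ⟨rfl, rfl⟩ := h
  have hcont : ContinuousAt (chartCoeff Q t OnePoint.infty) 0 :=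
    continuousAt_chartCoeff fun j => by simp
  have hd : DifferentiableAt ℂ (fun v => f (chart OnePoint.infty v)) 0 :=
    hf.holomorphic_infty (by simpa using hu)
  refine hasDerivAt_of_eventually_ne (g := fun u => chartCoeff Q t OnePoint.infty u *
    f (chart OnePoint.infty u)) hd (hcont.mul hd.continuousAt) ?_
  have hU : ∀ᶠ v in 𝓝 0, chart OnePoint.infty v ∈ U :=
    (continuous_chart _).continuousAt.preimage_mem_nhds (hf.isOpen.mem_nhds hu)
  filter_upwards [hU.filter_mono nhdsWithin_le_nhds, eventually_mem_nhdsWithin] with v hv hv0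
  exact key v hv fun _ => hv0

end

section

variable {n k : ℕ}

/-! ### Local fundamental solutions depending on a parameter -/

/-- `Φ τ`, for `τ` near `τ₀`, is a fundamental solution in the coordinate centered at `a` of the
system with the poles `T τ`. -/
structure IsLocalFamily (Q : Fin n → (Fin n → ℂ) → Mat k) (D : Set (Fin n → ℂ))
    (T : ℂ → Fin n → ℂ) (τ₀ : ℂ) (a : OnePoint ℂ) (r ε : ℝ) (Φ : ℂ → ℂ → Mat k) : Prop where
  r_pos : 0 < r
  ε_pos : 0 < ε
  mem : ∀ τ ∈ ball τ₀ ε, T τ ∈ D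
  ne_pole : ∀ τ ∈ ball τ₀ ε, ∀ x ∈ nbhd a r, ∀ j, x ≠ T τ j
  map_zero : ∀ τ, Φ τ 0 = 1
  isUnit : ∀ τ ∈ ball τ₀ ε, ∀ u ∈ ball (0 : ℂ) r, IsUnit (Φ τ u)
  differentiableOn_param : ∀ u ∈ ball (0 : ℂ) r, DifferentiableOn ℂ (fun τ => Φ τ u) (ball τ₀ ε)
  differentiableOn : ∀ τ ∈ ball τ₀ ε, DifferentiableOn ℂ (Φ τ) (ball 0 r)
  bound : ∃ K, ∀ τ ∈ ball τ₀ ε, ∀ u ∈ ball (0 : ℂ) r, ‖Φ τ u‖ ≤ K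
  solution : ∀ τ ∈ ball τ₀ ε, ∀ U f, SolvesOn Q (T τ) U f → ∀ x ∈ nbhd a r, x ∈ U →
    ∃ C, ∀ᶠ z in 𝓝 x, f z = Φ τ (coord a z) * C

theorem IsLocalFamily.mono {Q : Fin n → (Fin n → ℂ) → Mat k} {D : Set (Fin n → ℂ)}
    {T : ℂ → Fin n → ℂ} {τ₀ : ℂ} {a : OnePoint ℂ} {r ε : ℝ} {Φ : ℂ → ℂ → Mat k}
    (h : IsLocalFamily Q D T τ₀ a r ε Φ) {r' : ℝ} (hr' : 0 < r') (hr : r' ≤ r) :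
    IsLocalFamily Q D T τ₀ a r' ε Φ := by
  have hb : ball (0 : ℂ) r' ⊆ ball 0 r := ball_subset_ball hr
  obtain ⟨K, hK⟩ := h.bound
  exact ⟨hr', h.ε_pos, h.mem, fun τ hτ x hx => h.ne_pole τ hτ x (image_mono hb hx), h.map_zero,
    fun τ hτ u hu => h.isUnit τ hτ u (hb hu), fun u hu => h.differentiableOn_param u (hb hu),
    fun τ hτ => (h.differentiableOn τ hτ).mono hb, ⟨K, fun τ hτ u hu => hK τ hτ u (hb hu)⟩,
    fun τ hτ U f hf x hx => h.solution τ hτ U f hf x (image_mono hb hx)⟩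

theorem differentiableAt_invPole {T : ℂ → ℂ} {τ : ℂ} (hT : DifferentiableAt ℂ T τ)
    {a : OnePoint ℂ} (ha : a ≠ T τ) : DifferentiableAt ℂ (fun τ => invPole a (T τ)) τ := by
  induction a using OnePoint.rec with
  | coe c =>
    simp only [invPole_coe]
    exact (hT.sub_const c).fun_inv (sub_ne_zero.2 fun h => ha (by rw [h]))
  | infty => exact hT

theorem tsum_eq_chartCoeff {Q : Fin n → (Fin n → ℂ) → Mat k} {t : Fin n → ℂ} {a : OnePoint ℂ}
    {u : ℂ} (h : ∀ j, ‖u * invPole a (t j)‖ < 1) :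
    ∑' m : ℕ, u ^ m • (-∑ j, invPole a (t j) ^ (m + 1) • Q j t) = chartCoeff Q t a u := by
  refine HasSum.tsum_eq ?_
  simp only [smul_neg, Finset.smul_sum, smul_smul]
  refine HasSum.neg (hasSum_sum fun j _ => HasSum.smul_const ?_ _)
  refine ((hasSum_geometric_of_norm_lt_one (h j)).mul_left (invPole a (t j))).congr_fun ?_
  intro m
  ring

/-- In the coordinate at `a` the coefficient of the system is a geometric series whose terms are
holomorphic in `τ` and bounded uniformly for `τ` near `τ₀`. Hence the power series solutions
converge on a disc independent of `τ`. -/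
theorem exists_isLocalFamily {Q : Fin n → (Fin n → ℂ) → Mat k} {D : Set (Fin n → ℂ)}
    (hQ : IsHolomorphicFamily Q D) {T : ℂ → Fin n → ℂ} (hT : Differentiable ℂ T) {τ₀ : ℂ}
    (hT₀ : T τ₀ ∈ D) {a : OnePoint ℂ} (ha : ∀ j, a ≠ T τ₀ j) :
    ∃ r ε Φ, IsLocalFamily Q D T τ₀ a r ε Φ := by
  have hTj : ∀ j, Differentiable ℂ fun τ => T τ j := fun j => differentiable_pi.1 hT j
  have hD : ∀ᶠ τ in 𝓝 τ₀, T τ ∈ D :=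
    hT.continuous.continuousAt.preimage_mem_nhds (hQ.isOpen.mem_nhds hT₀)
  have hne : ∀ᶠ τ in 𝓝 τ₀, ∀ j, a ≠ T τ j := by
    rw [eventually_all]
    intro j
    have hc : Continuous fun τ => (T τ j : OnePoint ℂ) :=
      OnePoint.continuous_coe.comp (hTj j).continuous
    exact (hc.continuousAt.eventually_ne (ha j).symm).mono fun τ h => h.symm
  have hdQ : ∀ j, ∀ τ, T τ ∈ D → DifferentiableAt ℂ (fun τ => Q j (T τ)) τ := fun j τ hτ =>
    ((hQ.holomorphic j).differentiableAt (hQ.isOpen.mem_nhds hτ)).comp τ (hT τ)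
  have hds : ∀ j τ, a ≠ T τ j → DifferentiableAt ℂ (fun τ => invPole a (T τ j)) τ := fun j τ hτ =>
    differentiableAt_invPole (hTj j τ) hτ
  -- The added 1 makes the bounds strict at `τ₀`, so that they persist nearby.
  set ρ : ℝ := ∑ j, ‖invPole a (T τ₀ j)‖ + 1 with hρ
  set q : ℝ := ∑ j, ‖Q j (T τ₀)‖ + 1 with hq
  have hρ0 : 0 < ρ := by positivity
  have hq0 : 0 < q := by positivity
  have hbs : ∀ᶠ τ in 𝓝 τ₀, ∀ j, ‖invPole a (T τ j)‖ < ρ := by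
    rw [eventually_all]
    intro j
    refine (hds j τ₀ (ha j)).continuousAt.norm.eventually_lt continuousAt_const ?_
    have := Finset.single_le_sum (f := fun j => ‖invPole a (T τ₀ j)‖) (fun _ _ => norm_nonneg _)
      (Finset.mem_univ j)
    linarith
  have hbq : ∀ᶠ τ in 𝓝 τ₀, ∀ j, ‖Q j (T τ)‖ < q := by
    rw [eventually_all]
    intro j
    refine (hdQ j τ₀ hT₀).continuousAt.norm.eventually_lt continuousAt_const ?_
    have := Finset.single_le_sum (f := fun j => ‖Q j (T τ₀)‖) (fun _ _ => norm_nonneg _)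
      (Finset.mem_univ j)
    linarith
  obtain ⟨ε, hε, hball⟩ := Metric.eventually_nhds_iff_ball.1 (hD.and (hne.and (hbs.and hbq)))
  have hdb : ∀ m : ℕ, DifferentiableOn ℂ
      (fun τ => -∑ j, invPole a (T τ j) ^ (m + 1) • Q j (T τ)) (ball τ₀ ε) := by
    intro m τ hτ
    refine DifferentiableAt.differentiableWithinAt ?_
    refine DifferentiableAt.fun_neg (DifferentiableAt.fun_sum fun j _ => ?_)
    exact ((hds j τ ((hball τ hτ).2.1 j)).fun_pow _).fun_smul (hdQ j τ (hball τ hτ).1)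
  obtain ⟨r, hr, hrρ, Φ, hΦ, hΦ0, hΦτ, hΦu, hΦK⟩ := exists_fundamental_family isOpen_ball hdb
    (M := n * q * ρ) (ρ := ρ) (by positivity) hρ0 (by
      intro m τ hτ
      rw [norm_neg]
      have h0 : ∑ _j : Fin n, ρ ^ (m + 1) * q = n * q * ρ * ρ ^ m := by
        rw [Finset.sum_const, Finset.card_univ, Fintype.card_fin, nsmul_eq_mul]
        ring
      rw [← h0]
      refine norm_sum_le_of_le _ fun j _ => ?_
      rw [norm_smul, norm_pow]
      have h1 := ((hball τ hτ).2.2.1 j).le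
      have h2 := ((hball τ hτ).2.2.2 j).le
      gcongr)
  have hlt : ∀ τ ∈ ball τ₀ ε, ∀ u ∈ ball (0 : ℂ) r, ∀ j, ‖u * invPole a (T τ j)‖ < 1 := by
    intro τ hτ u hu j
    rw [norm_mul]
    have h1 := (hball τ hτ).2.2.1 j
    have h2 : ‖u‖ < r := by simpa using hu
    calc _ ≤ r * ρ := by gcongr
      _ < 1 := hrρ
  have hne' : ∀ τ ∈ ball τ₀ ε, ∀ x ∈ nbhd a r, ∀ j, x ≠ T τ j := by
    rintro τ hτ _ ⟨u, hu, rfl⟩ j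
    exact chart_ne_of_norm_lt ((hball τ hτ).2.1 j) (hlt τ hτ u hu j)
  refine ⟨r, ε, Φ, hr, hε, fun τ hτ => (hball τ hτ).1, hne', hΦ0, hΦu, hΦτ,
    fun τ hτ u hu => (hΦ τ hτ u hu).differentiableAt.differentiableWithinAt, hΦK, ?_⟩
  rintro τ hτ U f hf _ ⟨u, hu, rfl⟩ hxU
  have hΦ' : ∀ v ∈ ball (0 : ℂ) r, HasDerivAt (Φ τ) (chartCoeff Q (T τ) a v * Φ τ v) v := by
    intro v hv
    refine HasDerivAt.congr_deriv (hΦ τ hτ v hv) ?_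
    exact congrArg (· * Φ τ v) (tsum_eq_chartCoeff (Q := Q) (hlt τ hτ v hv))
  have hV : chart a ⁻¹' U ∩ ball 0 r ∈ 𝓝 u :=
    inter_mem ((continuous_chart a).continuousAt.preimage_mem_nhds (hf.isOpen.mem_nhds hxU))
      (isOpen_ball.mem_nhds hu)
  obtain ⟨δ, hδ, hδV⟩ := Metric.mem_nhds_iff.1 hV
  have hder : ∀ v ∈ ball u δ,
      HasDerivAt (fun v => Ring.inverse (Φ τ v) * f (chart a v)) 0 v := fun v hv =>
    hasDerivAt_inverse_mul_eq_zero (hΦu τ hτ v (hδV hv).2) (hΦ' v (hδV hv).2)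
      (hf.hasDerivAt_chart (hQ.sum_eq_zero _ (hball τ hτ).1) (hball τ hτ).2.1 (hδV hv).1)
  refine ⟨Ring.inverse (Φ τ u) * f (chart a u), eventually_nhds_chart.2 ?_⟩
  filter_upwards [ball_mem_nhds u hδ] with v hv
  have hconst : Ring.inverse (Φ τ v) * f (chart a v) = Ring.inverse (Φ τ u) * f (chart a u) :=
    isOpen_ball.is_const_of_deriv_eq_zero (convex_ball u δ).isPreconnected
      (fun w hw => (hder w hw).differentiableAt.differentiableWithinAt)
      (fun w hw => (hder w hw).deriv) hv (mem_ball_self hδ)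
  rw [coord_chart, ← hconst, Ring.mul_inverse_cancel_left _ _ (hΦu τ hτ v (hδV hv).2)]

/-! ### Uniqueness of the analytic continuation -/

section Continuation
variable {Q : Fin n → (Fin n → ℂ) → Mat k} {D : Set (Fin n → ℂ)} {t : Fin n → ℂ}

/-- Here `φ` may be neither monotone nor surjective, so this covers reparametrizations, initial
pieces and backtracking along `α`. -/
theorem IsContinuation.comp {a b a' b' : OnePoint ℂ} {α : Path a b} {y : unitInterval → Mat k}
    (h : IsContinuation Q t α y) {γ : Path a' b'} {φ : unitInterval → unitInterval}
    (hφ : Continuous φ) (hγ : ∀ s, γ s = α (φ s)) : IsContinuation Q t γ (y ∘ φ) := by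
  intro s
  obtain ⟨U, f, hU, hf, hy⟩ := h (φ s)
  exact ⟨U, f, hγ s ▸ hU, hf, (hφ.continuousAt.eventually hy).mono fun r hr => by
    rw [Function.comp_apply, hr, hγ r]⟩

theorem IsContinuation.avoidsPoles {a b : OnePoint ℂ} {α : Path a b} {y : unitInterval → Mat k}
    (h : IsContinuation Q t α y) : AvoidsPoles t α := by
  intro s j he
  obtain ⟨U, f, hU, hf, -⟩ := h s
  exact hf.avoids j (he ▸ hU)

/-- The product `Φ⁻¹ y` is locally constant while the path stays in the disc. This propagates
properties of continuations along paths in the lemmas below. -/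
theorem IsLocalFamily.eq_mul {T : ℂ → Fin n → ℂ} {τ₀ : ℂ} {a : OnePoint ℂ} {r ε : ℝ}
    {Φ : ℂ → ℂ → Mat k} (h : IsLocalFamily Q D T τ₀ a r ε Φ) {τ : ℂ} (hτ : τ ∈ ball τ₀ ε)
    {x x' : OnePoint ℂ} {α : Path x x'} {y : unitInterval → Mat k}
    (hy : IsContinuation Q (T τ) α y) {J : Set unitInterval} (hJ : IsPreconnected J)
    (hJa : ∀ s ∈ J, α s ∈ nbhd a r) {s s' : unitInterval} (hs : s ∈ J) (hs' : s' ∈ J) :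
    y s' = Φ τ (coord a (α s')) * (Ring.inverse (Φ τ (coord a (α s))) * y s) := by
  have hu : ∀ s ∈ J, IsUnit (Φ τ (coord a (α s))) := fun s hs =>
    h.isUnit τ hτ _ (coord_mem_ball (hJa s hs))
  have key : Ring.inverse (Φ τ (coord a (α s))) * y s =
      Ring.inverse (Φ τ (coord a (α s'))) * y s' := by
    refine hJ.induction₂ (fun s s' => Ring.inverse (Φ τ (coord a (α s))) * y s =
      Ring.inverse (Φ τ (coord a (α s'))) * y s') ?_ ?_ ?_ hs hs'
    · intro s hs
      obtain ⟨U, f, hU, hf, hev⟩ := hy s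
      obtain ⟨C, hC⟩ := h.solution τ hτ U f hf _ (hJa s hs) hU
      have hev' : ∀ᶠ r in 𝓝 s, y r = Φ τ (coord a (α r)) * C := by
        filter_upwards [hev, α.continuous.continuousAt.eventually hC] with r hr hr'
        rw [hr, hr']
      have h1 : ∀ r ∈ J, y r = Φ τ (coord a (α r)) * C →
          Ring.inverse (Φ τ (coord a (α r))) * y r = C := fun r hr he => by
        rw [he, Ring.inverse_mul_cancel_left _ _ (hu r hr)]
      filter_upwards [hev'.filter_mono nhdsWithin_le_nhds, self_mem_nhdsWithin] with r hr hrJ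
      rw [h1 r hrJ hr, h1 s hs hev'.self_of_nhds]
    · intro x y z _ _ _ h1 h2
      exact h1.trans h2
    · intro x y _ _ h1
      exact h1.symm
  rw [key, Ring.mul_inverse_cancel_left _ _ (hu s' hs')]

theorem exists_isLocalFamily_const (hQ : IsHolomorphicFamily Q D) (ht : t ∈ D) {a : OnePoint ℂ}
    (ha : ∀ j, a ≠ t j) : ∃ r ε Φ, IsLocalFamily Q D (fun _ => t) 0 a r ε Φ :=
  exists_isLocalFamily hQ (differentiable_const t) ht ha

theorem exists_ordConnected_nhds {a b x : OnePoint ℂ} (α : Path a b) {r : ℝ} {s : unitInterval}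
    (h : α s ∈ nbhd x r) : ∃ J ∈ 𝓝 s, J.OrdConnected ∧ ∀ r' ∈ J, α r' ∈ nbhd x r := by
  have := α.continuous.continuousAt.preimage_mem_nhds ((isOpen_nbhd x r).mem_nhds h)
  obtain ⟨δ, hδ, hball⟩ := Metric.mem_nhds_iff.1 this
  have hord : (ball s δ).OrdConnected := by
    constructor
    intro x hx y hy z hz
    have h1 : (x : ℝ) ≤ z := hz.1
    have h2 : (z : ℝ) ≤ y := hz.2
    rw [mem_ball, Subtype.dist_eq, Real.dist_eq, abs_lt] at *
    constructor <;> linarith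
  exact ⟨_, ball_mem_nhds s hδ, hord, fun r' hr' => hball hr'⟩

/-- Two analytic continuations along the same path with the same initial value agree. -/
theorem IsContinuation.unique (hQ : IsHolomorphicFamily Q D) (ht : t ∈ D) {a b : OnePoint ℂ}
    {α : Path a b} {y y' : unitInterval → Mat k} (hy : IsContinuation Q t α y)
    (hy' : IsContinuation Q t α y') (h0 : y 0 = y' 0) (s : unitInterval) : y s = y' s := by
  have key : ∀ s ∈ univ, ∀ᶠ s' in 𝓝[univ] s, (y s = y' s ↔ y s' = y' s') := by
    intro s _
    rw [nhdsWithin_univ]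
    obtain ⟨r, ε, Φ, hΦ⟩ := exists_isLocalFamily_const hQ ht fun j => hy.avoidsPoles s j
    obtain ⟨J, hJ, hJc, hJα⟩ := exists_ordConnected_nhds α (mem_nbhd_self (α s) hΦ.r_pos)
    have hτ : (0 : ℂ) ∈ ball 0 ε := mem_ball_self hΦ.ε_pos
    have hsJ := mem_of_mem_nhds hJ
    have h1 : ∀ {s s'}, s ∈ J → s' ∈ J → y s = y' s → y s' = y' s' := by
      intro s s' hs hs' he
      rw [hΦ.eq_mul hτ hy hJc.isPreconnected hJα hs hs', hΦ.eq_mul hτ hy' hJc.isPreconnected hJα hs hs', he]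
    filter_upwards [hJ] with s' hs'
    exact ⟨h1 hsJ hs', h1 hs' hsJ⟩
  exact (isPreconnected_univ.induction₂ (fun s s' => y s = y' s ↔ y s' = y' s') key
    (fun _ _ _ _ _ _ h1 h2 => h1.trans h2) (fun _ _ _ _ h1 => h1.symm) (mem_univ 0)
    (mem_univ s)).1 h0

theorem IsContinuation.isUnit (hQ : IsHolomorphicFamily Q D) (ht : t ∈ D) {a b : OnePoint ℂ}
    {α : Path a b} {y : unitInterval → Mat k} (hy : IsContinuation Q t α y)
    (h0 : IsUnit (y 0)) (s : unitInterval) : IsUnit (y s) := by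
  have key : ∀ s ∈ univ, ∀ᶠ s' in 𝓝[univ] s, (IsUnit (y s) ↔ IsUnit (y s')) := by
    intro s _
    rw [nhdsWithin_univ]
    obtain ⟨r, ε, Φ, hΦ⟩ := exists_isLocalFamily_const hQ ht fun j => hy.avoidsPoles s j
    obtain ⟨J, hJ, hJc, hJα⟩ := exists_ordConnected_nhds α (mem_nbhd_self (α s) hΦ.r_pos)
    have hτ : (0 : ℂ) ∈ ball 0 ε := mem_ball_self hΦ.ε_pos
    have hsJ := mem_of_mem_nhds hJ
    have h1 : ∀ {s s'}, s ∈ J → s' ∈ J → IsUnit (y s) → IsUnit (y s') := by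
      intro s s' hs hs' he
      rw [hΦ.eq_mul hτ hy hJc.isPreconnected hJα hs hs']
      exact (hΦ.isUnit _ hτ _ (coord_mem_ball (hJα s' hs'))).mul
        ((hΦ.isUnit _ hτ _ (coord_mem_ball (hJα s hs))).ringInverse.mul he)
    filter_upwards [hJ] with s' hs'
    exact ⟨h1 hsJ hs', h1 hs' hsJ⟩
  exact (isPreconnected_univ.induction₂ (fun s s' => IsUnit (y s) ↔ IsUnit (y s')) key
    (fun _ _ _ _ _ _ h1 h2 => h1.trans h2) (fun _ _ _ _ h1 => h1.symm) (mem_univ 0)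
    (mem_univ s)).1 h0

end Continuation

end

section

variable {n k : ℕ} {Q : Fin n → (Fin n → ℂ) → Mat k} {D : Set (Fin n → ℂ)} {t : Fin n → ℂ}
  {Y : (Fin n → ℂ) → (x : OnePoint ℂ) → Path OnePoint.infty x → Mat k}

/-! ### Values of the normalized solution -/

theorem avoidsPoles_iff {a b : OnePoint ℂ} {α : Path a b} :
    AvoidsPoles t α ↔ ∀ j, ((t j : ℂ) : OnePoint ℂ) ∉ range α := by
  simp only [AvoidsPoles, mem_range, not_exists]
  exact forall_comm

theorem avoidsPoles_trans {a b c : OnePoint ℂ} {α : Path a b} {β : Path b c} :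
    AvoidsPoles t (α.trans β) ↔ AvoidsPoles t α ∧ AvoidsPoles t β := by
  simp only [avoidsPoles_iff, Path.trans_range, mem_union, not_or, forall_and]

theorem AvoidsPoles.target {a b : OnePoint ℂ} {α : Path a b} (h : AvoidsPoles t α) (j : Fin n) :
    b ≠ t j := by
  have := h 1 j
  rwa [α.target] at this

theorem avoidsPoles_refl_infty : AvoidsPoles t (Path.refl OnePoint.infty) := by
  intro s j
  simp

theorem eventually_avoidsPoles {T : ℂ → Fin n → ℂ} {τ₀ : ℂ} (hT : Continuous T) {a b : OnePoint ℂ}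
    {α : Path a b} (h : AvoidsPoles (T τ₀) α) : ∀ᶠ τ in 𝓝 τ₀, AvoidsPoles (T τ) α := by
  have key : ∀ j, ∀ᶠ τ in 𝓝 τ₀, ∀ s ∈ (univ : Set unitInterval), α s ≠ (T τ j : OnePoint ℂ) := by
    intro j
    refine isCompact_univ.eventually_forall_of_forall_eventually fun s _ => ?_
    have c1 : Continuous fun p : ℂ × unitInterval => α p.2 := α.continuous.comp continuous_snd
    have c2 : Continuous fun p : ℂ × unitInterval => (T p.1 j : OnePoint ℂ) :=
      OnePoint.continuous_coe.comp ((continuous_apply j).comp (hT.comp continuous_fst))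
    exact (isOpen_ne_fun c1 c2).mem_nhds (h s j)
  filter_upwards [eventually_all.2 key] with τ hτ s j
  exact hτ j s (mem_univ s)

theorem IsNormalizedSolution.exists_continuation (hY : IsNormalizedSolution Q D Y) (ht : t ∈ D)
    {x : OnePoint ℂ} {α : Path OnePoint.infty x} (hα : AvoidsPoles t α) :
    ∃ y, IsContinuation Q t α y ∧ y 0 = 1 ∧ y 1 = Y t x α := hY t ht x α hα

theorem IsNormalizedSolution.eq_of_isSolutionValue (hQ : IsHolomorphicFamily Q D)
    (hY : IsNormalizedSolution Q D Y) (ht : t ∈ D) {x : OnePoint ℂ} {α : Path OnePoint.infty x}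
    {v : Mat k} (hv : IsSolutionValue Q t α v) : Y t x α = v := by
  obtain ⟨y, hy, hy0, rfl⟩ := hv
  obtain ⟨y', hy', hy0', hy1'⟩ := hY.exists_continuation ht hy.avoidsPoles
  rw [← hy1']
  exact hy'.unique hQ ht hy (hy0'.trans hy0.symm) 1

/-- All values of `Y` along reparametrized pieces of `α` are read from a single continuation `y`,
which settles the path identities below without homotopies. -/
theorem IsNormalizedSolution.eq_of_comp (hQ : IsHolomorphicFamily Q D)
    (hY : IsNormalizedSolution Q D Y) (ht : t ∈ D) {b x : OnePoint ℂ}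
    {α : Path OnePoint.infty b} {y : unitInterval → Mat k} (hy : IsContinuation Q t α y)
    (hy0 : y 0 = 1) {δ : Path OnePoint.infty x} {φ : unitInterval → unitInterval}
    (hφ : Continuous φ) (hφ0 : φ 0 = 0) (hδ : ∀ s, δ s = α (φ s)) : Y t x δ = y (φ 1) :=
  hY.eq_of_isSolutionValue hQ ht ⟨y ∘ φ, hy.comp hφ hδ, by simp [hφ0, hy0], rfl⟩

/-- `Y` is a function of paths, not of their homotopy classes, so even the regrouping of a
concatenation requires an argument. -/
theorem IsNormalizedSolution.trans_assoc (hQ : IsHolomorphicFamily Q D)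
    (hY : IsNormalizedSolution Q D Y) (ht : t ∈ D) {a b c : OnePoint ℂ}
    {α : Path OnePoint.infty a} {β : Path a b} {γ : Path b c} (hα : AvoidsPoles t α)
    (hβ : AvoidsPoles t β) (hγ : AvoidsPoles t γ) :
    Y t c ((α.trans β).trans γ) = Y t c (α.trans (β.trans γ)) := by
  obtain ⟨y, hy, hy0, hy1⟩ := hY.exists_continuation ht
    (avoidsPoles_trans.2 ⟨hα, avoidsPoles_trans.2 ⟨hβ, hγ⟩⟩)
  rw [← hy1, Path.Homotopy.trans_assoc_reparam]
  refine (hY.eq_of_comp hQ ht hy hy0 (φ := fun s => ⟨Path.Homotopy.transAssocReparamAux s,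
    Path.Homotopy.transAssocReparamAux_mem_I s⟩) (by fun_prop) ?_ fun s => rfl).trans ?_
  · exact Subtype.ext Path.Homotopy.transAssocReparamAux_zero
  · exact congrArg y (Subtype.ext Path.Homotopy.transAssocReparamAux_one)

theorem IsNormalizedSolution.isUnit (hQ : IsHolomorphicFamily Q D)
    (hY : IsNormalizedSolution Q D Y) (ht : t ∈ D) {x : OnePoint ℂ} {α : Path OnePoint.infty x}
    (hα : AvoidsPoles t α) : IsUnit (Y t x α) := by
  obtain ⟨y, hy, hy0, hy1⟩ := hY.exists_continuation ht hα
  rw [← hy1]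
  exact hy.isUnit hQ ht (hy0 ▸ isUnit_one) 1

/-- The right side depends on `γ` only through its end point: inside a disc free of poles `Y` is
single-valued. -/
theorem IsNormalizedSolution.trans_eq (hQ : IsHolomorphicFamily Q D)
    (hY : IsNormalizedSolution Q D Y) {T : ℂ → Fin n → ℂ} {τ₀ τ : ℂ} {a : OnePoint ℂ} {r ε : ℝ}
    {Φ : ℂ → ℂ → Mat k} (h : IsLocalFamily Q D T τ₀ a r ε Φ) (hτ : τ ∈ ball τ₀ ε)
    {x z : OnePoint ℂ} {α : Path OnePoint.infty x} (hα : AvoidsPoles (T τ) α) {γ : Path x z}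
    (hγ : ∀ s, γ s ∈ nbhd a r) : Y (T τ) z (α.trans γ) =
      Φ τ (coord a z) * (Ring.inverse (Φ τ (coord a x)) * Y (T τ) x α) := by
  have hTτ := h.mem τ hτ
  obtain ⟨y, hy, hy0, hy1⟩ := hY.exists_continuation hTτ
    (avoidsPoles_trans.2 ⟨hα, fun s j => h.ne_pole τ hτ _ (hγ s) j⟩)
  have hhalf : ∀ s : unitInterval, (s : ℝ) / 2 ∈ unitInterval := fun s =>
    ⟨by linarith [s.2.1], by linarith [s.2.2]⟩
  -- The parameter at which `α.trans γ` passes from `α` to `γ`.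
  set c : unitInterval := ⟨1 / 2, by norm_num, by norm_num⟩ with hc
  have h1 : Y (T τ) x α = y c := by
    refine (hY.eq_of_comp hQ hTτ hy hy0 (φ := fun s => ⟨s / 2, hhalf s⟩)
      (by fun_prop) (Subtype.ext (by simp)) fun s => ?_).trans ?_
    · rw [Path.trans_apply, dif_pos (by simp only; linarith [s.2.2])]
      congr 1
      exact Subtype.ext (by simp only; ring)
    · exact congrArg y (Subtype.ext (by simp [hc]))
  have hcx : (α.trans γ) c = x := by
    rw [Path.trans_apply, dif_pos (by simp [hc])]
    convert α.target using 2
    exact Subtype.ext (by simp [hc])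
  have := h.eq_mul hτ hy (J := Icc c 1) ordConnected_Icc.isPreconnected (fun s hs => ?_)
    (s := c) (s' := 1) ⟨le_rfl, c.2.2⟩ ⟨c.2.2, le_rfl⟩
  · rw [← hy1, this, h1, hcx, Path.target]
  · have hs1 : 1 / 2 ≤ (s : ℝ) := hs.1
    rcases eq_or_lt_of_le hs1 with he | hlt
    · have : s = c := Subtype.ext he.symm
      rw [this, hcx, ← γ.source]
      exact hγ 0
    · rw [Path.trans_apply, dif_neg (not_le.2 hlt)]
      exact hγ _

theorem IsNormalizedSolution.refl_eq_one (hQ : IsHolomorphicFamily Q D)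
    (hY : IsNormalizedSolution Q D Y) (ht : t ∈ D) :
    Y t OnePoint.infty (Path.refl OnePoint.infty) = 1 := by
  obtain ⟨y, hy, hy0, hy1⟩ := hY.exists_continuation ht (avoidsPoles_refl_infty (t := t))
  have := hY.eq_of_comp hQ ht hy hy0 (δ := Path.refl OnePoint.infty) (φ := fun _ => 0)
    continuous_const rfl (fun s => rfl)
  rw [this, hy0]

/-- Segments as paths on the sphere. -/
noncomputable abbrev seg (x z : ℂ) : Path (x : OnePoint ℂ) (z : OnePoint ℂ) :=
  toSphere (Path.segment x z)

theorem segment_mem_of_convex {S : Set ℂ} (hS : Convex ℝ S) {x z : ℂ} (hx : x ∈ S) (hz : z ∈ S)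
    (s : unitInterval) : Path.segment x z s ∈ S := by
  refine hS.segment_subset hx hz ?_
  rw [← Path.range_segment]
  exact mem_range_self s

theorem seg_mem_nbhd {c x z : ℂ} {r : ℝ} (hx : x ∈ ball c r) (hz : z ∈ ball c r)
    (s : unitInterval) : seg x z s ∈ nbhd (c : OnePoint ℂ) r := by
  rw [nbhd_coe]
  exact ⟨_, segment_mem_of_convex (convex_ball c r) hx hz s, rfl⟩

/-- The equation `∂Y/∂x = (∑ⱼ Qⱼ / (x - tⱼ)) Y` on the covering surface. -/
theorem IsNormalizedSolution.hasDerivAt (hQ : IsHolomorphicFamily Q D)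
    (hY : IsNormalizedSolution Q D Y) (ht : t ∈ D) {x : ℂ}
    {α : Path OnePoint.infty (x : OnePoint ℂ)} (hα : AvoidsPoles t α) :
    HasDerivAt (fun z : ℂ => Y t (z : OnePoint ℂ) (α.trans (seg x z)))
      (coeff Q t x * Y t (x : OnePoint ℂ) α) x := by
  obtain ⟨r, ε, Φ, hΦ⟩ := exists_isLocalFamily_const hQ ht hα.target
  have hτ : (0 : ℂ) ∈ ball 0 ε := mem_ball_self hΦ.ε_pos
  obtain ⟨y, hy, hy0, hy1⟩ := hY.exists_continuation ht hα
  obtain ⟨U, f, hU, hf, hev⟩ := hy 1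
  have h1 : y 1 = f (α 1) := hev.self_of_nhds
  rw [α.target] at hU h1
  have hxn := mem_nbhd_self (x : OnePoint ℂ) hΦ.r_pos
  obtain ⟨C, hC⟩ := hΦ.solution 0 hτ U f hf _ hxn hU
  have hCx : f x = C := by simpa [hΦ.map_zero] using hC.self_of_nhds
  have hC' : ∀ᶠ z : ℂ in 𝓝 x, f z = Φ 0 (coord x z) * C :=
    OnePoint.continuous_coe.continuousAt.eventually hC
  rw [← hy1, h1]
  refine (hf.hasDerivAt x hU).congr_of_eventuallyEq ?_
  filter_upwards [hC', ball_mem_nhds x hΦ.r_pos] with z hz hzr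
  rw [hz, hY.trans_eq hQ hΦ hτ hα fun s => seg_mem_nbhd (mem_ball_self hΦ.r_pos) hzr s, coord_self,
    hΦ.map_zero, Ring.inverse_one, one_mul, ← hy1, h1, hCx]

/-! ### Dependence of the normalized solution on the parameter -/

/-- Holomorphy in `τ` starts from the constant value `I` at `∞` and is passed along `α` by the local
families, through `eq_mul`. The radius may shrink at each step, so the induction runs over "some
radius exists". -/
theorem IsNormalizedSolution.exists_differentiableOn (hQ : IsHolomorphicFamily Q D)
    (hY : IsNormalizedSolution Q D Y) {T : ℂ → Fin n → ℂ} (hT : Differentiable ℂ T) {τ₀ : ℂ}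
    (hT₀ : T τ₀ ∈ D) {x : OnePoint ℂ} {α : Path OnePoint.infty x} (hα : AvoidsPoles (T τ₀) α) :
    ∃ ε > 0, DifferentiableOn ℂ (fun τ => Y (T τ) x α) (ball τ₀ ε) := by
  have hD : ∀ᶠ τ in 𝓝 τ₀, T τ ∈ D :=
    hT.continuous.continuousAt.preimage_mem_nhds (hQ.isOpen.mem_nhds hT₀)
  obtain ⟨ε₀, hε₀, hball⟩ := Metric.eventually_nhds_iff_ball.1
    (hD.and (eventually_avoidsPoles hT.continuous hα))
  have hex : ∀ τ, ∃ y, τ ∈ ball τ₀ ε₀ → IsContinuation Q (T τ) α y ∧ y 0 = 1 ∧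
      y 1 = Y (T τ) x α := by
    intro τ
    by_cases hτ : τ ∈ ball τ₀ ε₀
    · obtain ⟨y, hy⟩ := hY.exists_continuation (hball τ hτ).1 (hball τ hτ).2
      exact ⟨y, fun _ => hy⟩
    · exact ⟨0, fun h => absurd h hτ⟩
  choose y hy using hex
  set P : unitInterval → Prop := fun s => ∃ ε > 0, DifferentiableOn ℂ (fun τ => y τ s) (ball τ₀ ε)
  have key : ∀ s ∈ univ, ∀ᶠ s' in 𝓝[univ] s, (P s ↔ P s') := by
    intro s₀ _
    rw [nhdsWithin_univ]
    obtain ⟨r, ε₁, Φ, hΦ⟩ := exists_isLocalFamily hQ hT hT₀ (hα s₀)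
    obtain ⟨J, hJ, hJc, hJα⟩ := exists_ordConnected_nhds α (mem_nbhd_self (α s₀) hΦ.r_pos)
    have hsJ := mem_of_mem_nhds hJ
    have h1 : ∀ {s s'}, s ∈ J → s' ∈ J → P s → P s' := by
      rintro s s' hs hs' ⟨ε, hε, hd⟩
      refine ⟨min ε (min ε₀ ε₁), lt_min hε (lt_min hε₀ hΦ.ε_pos), ?_⟩
      have b1 : ball τ₀ (min ε (min ε₀ ε₁)) ⊆ ball τ₀ ε := ball_subset_ball (min_le_left _ _)
      have b2 : ball τ₀ (min ε (min ε₀ ε₁)) ⊆ ball τ₀ ε₀ :=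
        ball_subset_ball ((min_le_right _ _).trans (min_le_left _ _))
      have b3 : ball τ₀ (min ε (min ε₀ ε₁)) ⊆ ball τ₀ ε₁ :=
        ball_subset_ball ((min_le_right _ _).trans (min_le_right _ _))
      have us := coord_mem_ball (hJα s hs)
      have us' := coord_mem_ball (hJα s' hs')
      have hd1 : DifferentiableOn ℂ (fun τ => Φ τ (coord (α s₀) (α s')) *
          (Ring.inverse (Φ τ (coord (α s₀) (α s))) * y τ s)) (ball τ₀ (min ε (min ε₀ ε₁))) := by
        have d1 := (hΦ.differentiableOn_param _ us).mono b3
        have d2 := (hΦ.differentiableOn_param _ us').mono b3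
        have d3 := DifferentiableOn.inverse d1 fun τ hτ => hΦ.isUnit τ (b3 hτ) _ us
        exact DifferentiableOn.fun_mul d2 (DifferentiableOn.fun_mul d3 (hd.mono b1))
      refine hd1.congr fun τ hτ => ?_
      exact hΦ.eq_mul (b3 hτ) (hy τ (b2 hτ)).1 hJc.isPreconnected hJα hs hs'
    filter_upwards [hJ] with s' hs'
    exact ⟨h1 hsJ hs', h1 hs' hsJ⟩
  have h0 : P 0 := ⟨ε₀, hε₀, (differentiableOn_const (1 : Mat k)).congr fun τ hτ => (hy τ hτ).2.1⟩
  obtain ⟨ε, hε, hd⟩ := (isPreconnected_univ.induction₂ (fun s s' => P s ↔ P s') key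
    (fun _ _ _ _ _ _ h1 h2 => h1.trans h2) (fun _ _ _ _ h1 => h1.symm) (mem_univ 0)
    (mem_univ 1)).1 h0
  refine ⟨min ε ε₀, lt_min hε hε₀, ?_⟩
  refine (hd.mono (ball_subset_ball (min_le_left _ _))).congr fun τ hτ => ?_
  exact (hy τ (ball_subset_ball (min_le_right _ _) hτ)).2.2.symm

end

section

variable {n k : ℕ} {Q : Fin n → (Fin n → ℂ) → Mat k} {D : Set (Fin n → ℂ)}
  {Y : (Fin n → ℂ) → (x : OnePoint ℂ) → Path OnePoint.infty x → Mat k}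
  {T : ℂ → Fin n → ℂ} {τ₀ : ℂ}

/-! ### The logarithmic derivative with respect to the parameter -/

/-- `G` is the logarithmic derivative `(∂Y/∂τ) Y⁻¹` at the end of `α`, where the poles are `T τ`. -/
def IsLogDeriv (Y : (Fin n → ℂ) → (x : OnePoint ℂ) → Path OnePoint.infty x → Mat k)
    (T : ℂ → Fin n → ℂ) (τ₀ : ℂ) {x : OnePoint ℂ} (α : Path OnePoint.infty x) (G : Mat k) : Prop :=
  HasDerivAt (fun τ => Y (T τ) x α) (G * Y (T τ₀) x α) τ₀

theorem IsLogDeriv.unique (hQ : IsHolomorphicFamily Q D) (hY : IsNormalizedSolution Q D Y)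
    (hT₀ : T τ₀ ∈ D) {x : OnePoint ℂ} {α : Path OnePoint.infty x} (hα : AvoidsPoles (T τ₀) α)
    {G G' : Mat k} (h : IsLogDeriv Y T τ₀ α G) (h' : IsLogDeriv Y T τ₀ α G') : G = G' :=
  (hY.isUnit hQ hT₀ hα).mul_left_injective (HasDerivAt.unique h h')

theorem IsLogDeriv.congr {x : OnePoint ℂ} {α β : Path OnePoint.infty x}
    (h : ∀ᶠ τ in 𝓝 τ₀, Y (T τ) x α = Y (T τ) x β) {G : Mat k} (hα : IsLogDeriv Y T τ₀ α G) :
    IsLogDeriv Y T τ₀ β G := by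
  rw [IsLogDeriv, ← h.self_of_nhds]
  exact HasDerivAt.congr_of_eventuallyEq hα (h.mono fun τ hτ => hτ.symm)

theorem eventually_mem (hQ : IsHolomorphicFamily Q D) (hT : Differentiable ℂ T) (hT₀ : T τ₀ ∈ D) :
    ∀ᶠ τ in 𝓝 τ₀, T τ ∈ D :=
  hT.continuous.continuousAt.preimage_mem_nhds (hQ.isOpen.mem_nhds hT₀)

theorem eventually_trans_assoc (hQ : IsHolomorphicFamily Q D) (hY : IsNormalizedSolution Q D Y)
    (hT : Differentiable ℂ T) (hT₀ : T τ₀ ∈ D) {a b c : OnePoint ℂ}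
    {α : Path OnePoint.infty a} {β : Path a b} {γ : Path b c} (hα : AvoidsPoles (T τ₀) α)
    (hβ : AvoidsPoles (T τ₀) β) (hγ : AvoidsPoles (T τ₀) γ) :
    ∀ᶠ τ in 𝓝 τ₀, Y (T τ) c ((α.trans β).trans γ) = Y (T τ) c (α.trans (β.trans γ)) := by
  filter_upwards [eventually_mem hQ hT hT₀, eventually_avoidsPoles hT.continuous hα,
    eventually_avoidsPoles hT.continuous hβ, eventually_avoidsPoles hT.continuous hγ]
    with τ h1 h2 h3 h4
  exact hY.trans_assoc hQ h1 h2 h3 h4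

theorem IsLogDeriv.trans_assoc (hQ : IsHolomorphicFamily Q D) (hY : IsNormalizedSolution Q D Y)
    (hT : Differentiable ℂ T) (hT₀ : T τ₀ ∈ D) {a b c : OnePoint ℂ}
    {α : Path OnePoint.infty a} {β : Path a b} {γ : Path b c} (hα : AvoidsPoles (T τ₀) α)
    (hβ : AvoidsPoles (T τ₀) β) (hγ : AvoidsPoles (T τ₀) γ) {G : Mat k} :
    IsLogDeriv Y T τ₀ ((α.trans β).trans γ) G ↔ IsLogDeriv Y T τ₀ (α.trans (β.trans γ)) G := by
  have h := eventually_trans_assoc hQ hY hT hT₀ hα hβ hγ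
  exact ⟨fun h' => h'.congr h, fun h' => h'.congr (h.mono fun _ => Eq.symm)⟩

/-- On the disc `Y = Φ τ · C τ`, with `C` independent of the end point. The derivative of `Φ` in `τ`
is holomorphic in the coordinate, so one holomorphic `g` serves all paths `γ` in the disc. -/
theorem exists_isLogDeriv (hQ : IsHolomorphicFamily Q D) (hY : IsNormalizedSolution Q D Y)
    (hT : Differentiable ℂ T) (hT₀ : T τ₀ ∈ D) {a : OnePoint ℂ} (ha : ∀ j, a ≠ T τ₀ j) {R : ℝ}
    (hR : 0 < R) : ∃ r > 0, r ≤ R ∧ (∀ x ∈ nbhd a r, ∀ j, x ≠ T τ₀ j) ∧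
      ∀ {y : OnePoint ℂ} (α : Path OnePoint.infty y), AvoidsPoles (T τ₀) α → y ∈ nbhd a r →
      ∃ g : ℂ → Mat k, DifferentiableOn ℂ g (ball 0 r) ∧ ∀ {z : OnePoint ℂ} (γ : Path y z),
        (∀ s, γ s ∈ nbhd a r) → IsLogDeriv Y T τ₀ (α.trans γ) (g (coord a z)) := by
  obtain ⟨r₀, ε, Φ, hΦ₀⟩ := exists_isLocalFamily hQ hT hT₀ ha
  -- Halving keeps the closed disc inside the domain of `Φ`, as the boundary estimate requires.
  set r := min R (r₀ / 2) with hr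
  have hr0 : 0 < r := lt_min hR (half_pos hΦ₀.r_pos)
  have hrr : r < r₀ := (min_le_right _ _).trans_lt (half_lt_self hΦ₀.r_pos)
  have hΦ := hΦ₀.mono hr0 hrr.le
  have hτ₀ : τ₀ ∈ ball τ₀ ε := mem_ball_self hΦ.ε_pos
  have hcl : closedBall (0 : ℂ) r ⊆ ball 0 r₀ := closedBall_subset_ball hrr
  obtain ⟨K, hK⟩ := hΦ₀.bound
  obtain ⟨Ψ, hΨd, hΨ⟩ := exists_hasDerivAt_param (F := Φ) (c := 0) (R := r) (M := K) hΦ.ε_pos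
    (fun τ hτ => ((hΦ₀.differentiableOn τ hτ).mono
      (closure_ball_subset_closedBall.trans hcl)).diffContOnCl)
    (fun x hx => hΦ₀.differentiableOn_param x (hcl (sphere_subset_closedBall hx)))
    (fun τ hτ x hx => hK τ hτ x (hcl (sphere_subset_closedBall hx)))
  refine ⟨r, hr0, min_le_left _ _, hΦ.ne_pole τ₀ hτ₀, fun {y} α hα hy => ?_⟩
  obtain ⟨ε', hε', hYd⟩ := hY.exists_differentiableOn hQ hT hT₀ hα
  have hyb := coord_mem_ball hy
  set C : ℂ → Mat k := fun τ => Ring.inverse (Φ τ (coord a y)) * Y (T τ) y α with hC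
  have hCd : DifferentiableAt ℂ C τ₀ := by
    have h1 := (hΦ.differentiableOn_param _ hyb).differentiableAt (isOpen_ball.mem_nhds hτ₀)
    have h2 := hYd.differentiableAt (ball_mem_nhds τ₀ hε')
    exact DifferentiableAt.fun_mul (DifferentiableAt.inverse h1 (hΦ.isUnit _ hτ₀ _ hyb)) h2
  have hCu : IsUnit (C τ₀) := (hΦ.isUnit _ hτ₀ _ hyb).ringInverse.mul (hY.isUnit hQ hT₀ hα)
  refine ⟨fun u => (Ψ u * C τ₀ + Φ τ₀ u * deriv C τ₀) * Ring.inverse (Φ τ₀ u * C τ₀), ?_, ?_⟩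
  · have h1 := hΦ.differentiableOn τ₀ hτ₀
    refine DifferentiableOn.fun_mul (DifferentiableOn.fun_add (hΨd.mul_const _) (h1.mul_const _)) ?_
    exact DifferentiableOn.inverse (h1.mul_const _) fun u hu => (hΦ.isUnit _ hτ₀ u hu).mul hCu
  · intro z γ hγ
    have hz : z ∈ nbhd a r := γ.target ▸ hγ 1
    have hzb := coord_mem_ball hz
    have hev : ∀ᶠ τ in 𝓝 τ₀, Y (T τ) z (α.trans γ) = Φ τ (coord a z) * C τ := by
      filter_upwards [isOpen_ball.mem_nhds hτ₀, eventually_avoidsPoles hT.continuous hα]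
        with τ h1 h2
      exact hY.trans_eq hQ hΦ h1 h2 hγ
    have hd : HasDerivAt (fun τ => Φ τ (coord a z) * C τ)
        (Ψ (coord a z) * C τ₀ + Φ τ₀ (coord a z) * deriv C τ₀) τ₀ :=
      HasDerivAt.fun_mul (hΨ _ hzb) hCd.hasDerivAt
    rw [IsLogDeriv, hev.self_of_nhds, mul_assoc,
      Ring.inverse_mul_cancel _ ((hΦ.isUnit _ hτ₀ _ hzb).mul hCu), mul_one]
    exact hd.congr_of_eventuallyEq hev

end

/-! ### Branches of the logarithm along paths -/

theorem exists_isLogAlong {a b τ w₀ : ℂ} (β : Path a b) (hβ : ∀ s, β s ≠ τ)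
    (hw₀ : Complex.exp w₀ = a - τ) : ∃ w, IsLogAlong τ w₀ β w := by
  have hsc : IsSimplyConnected (univ : Set ℝ) := by
    have : ContractibleSpace (univ : Set ℝ) := (Homeomorph.Set.univ ℝ).contractibleSpace
    exact (inferInstance : SimplyConnectedSpace (univ : Set ℝ))
  obtain ⟨f, hf, hfe⟩ := Complex.exists_continuousOn_eqOn_exp_comp hsc isOpen_univ
    (g := fun s => β.extend s - τ) (by fun_prop) (by
      rintro ⟨s, -, hs⟩
      obtain ⟨s', hs'⟩ : β.extend s ∈ range β := by
        rw [← β.extend_range]; exact mem_range_self s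
      exact hβ s' (by rw [hs']; exact sub_eq_zero.1 hs))
  have he : ∀ s : unitInterval, Complex.exp (f s) = β s - τ := fun s => by
    have := hfe (mem_univ (s : ℝ))
    simpa using this
  refine ⟨fun s => f s + (w₀ - f (0 : unitInterval)), ?_, fun s => ?_, ?_⟩
  · have := continuousOn_univ.1 hf
    fun_prop
  · have h0 : a - τ ≠ 0 := by rw [← hw₀]; exact Complex.exp_ne_zero _
    rw [Complex.exp_add, Complex.exp_sub, he, he, hw₀, β.source, div_self h0, mul_one]
  · ring

/-- Compares `β` followed by a segment with `β` run at double speed and stopped at its end. The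
ratio of the two then stays near 1, and its logarithm is explicit. -/
theorem norm_trans_segment_sub_le {p x z : ℂ} (β : Path p x) (s : unitInterval) :
    ‖(β.trans (Path.segment x z)) s -
      β ⟨min (2 * (s : ℝ)) 1, le_min (by linarith [s.2.1]) zero_le_one, min_le_right _ _⟩‖ ≤
      ‖z - x‖ := by
  rw [Path.trans_apply]
  split_ifs with h
  · have : min (2 * (s : ℝ)) 1 = 2 * s := min_eq_left (by linarith)
    simp [this]
  · have h1 : min (2 * (s : ℝ)) 1 = 1 := min_eq_right (by linarith)
    have h2 : (⟨min (2 * (s : ℝ)) 1, le_min (by linarith [s.2.1]) zero_le_one, min_le_right _ _⟩ :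
        unitInterval) = 1 := Subtype.ext h1
    rw [h2, β.target]
    have h3 : (2 * (s : ℝ) - 1) ≤ 1 := by linarith [s.2.2]
    have h4 : 0 ≤ (2 * (s : ℝ) - 1) := by linarith
    rw [Path.segment_apply, AffineMap.lineMap_apply, vsub_eq_sub, vadd_eq_add, add_sub_cancel_right,
      norm_smul, Real.norm_of_nonneg h4]
    exact mul_le_of_le_one_left (norm_nonneg _) h3

/-- The continuation of the logarithm along `β` followed by a short segment, for the branching
points near `c`. -/
theorem exists_isLogAlong_near {p x c : ℂ} (β : Path p x) (hβ : ∀ s, β s ≠ c) {W : Set ℂ}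
    (hW : IsOpen W) (hc : c ∈ W) {L : ℂ → ℂ} (hL : ContinuousOn L W)
    (hLe : ∀ τ ∈ W, Complex.exp (L τ) = p - τ) :
    ∃ w₁ : ℂ, ∃ δ > 0, ∀ σ ∈ ball c δ, ∀ z ∈ ball x δ, (z - σ) / (x - c) ∈ Complex.slitPlane ∧
      ∃ w, IsLogAlong σ (L σ) (β.trans (Path.segment x z)) w ∧
        w 1 = w₁ + Complex.log ((z - σ) / (x - c)) := by
  obtain ⟨w₀, hw₀⟩ := exists_isLogAlong β hβ (hLe c hc)
  have hβc : Continuous fun s => ‖β s - c‖ := by fun_prop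
  obtain ⟨s₀, -, hs₀⟩ := isCompact_univ.exists_isMinOn univ_nonempty hβc.continuousOn
  set m := ‖β s₀ - c‖ with hm
  have hm0 : 0 < m := norm_pos_iff.2 (sub_ne_zero.2 (hβ s₀))
  have hmin : ∀ s, m ≤ ‖β s - c‖ := fun s => hs₀ (mem_univ s)
  obtain ⟨δ₁, hδ₁, hδW⟩ := Metric.isOpen_iff.1 hW c hc
  -- As `m` is the distance from `β` to `c`, moving the branch point and the end point by at most
  -- `m/3` each keeps the ratios within `2/3` of 1, where the principal logarithm is continuous.
  set δ := min δ₁ (m / 3) with hδ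
  have hδ0 : 0 < δ := lt_min hδ₁ (by positivity)
  have hδm : δ ≤ m / 3 := min_le_right _ _
  have hδW' : ball c δ ⊆ W := (ball_subset_ball (min_le_left _ _)).trans hδW
  have hslit : ∀ σ ∈ ball c δ, ∀ b q : ℂ, m ≤ ‖b - c‖ → ‖q - b‖ ≤ δ →
      (q - σ) / (b - c) ∈ Complex.slitPlane := by
    intro σ hσ b q hb hq
    have hb0 : b - c ≠ 0 := norm_pos_iff.1 (hm0.trans_le hb)
    have h1 : (q - σ) / (b - c) = 1 + ((q - b) - (σ - c)) / (b - c) := by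
      field_simp; ring
    rw [h1]
    apply Complex.mem_slitPlane_of_norm_lt_one
    rw [norm_div, div_lt_one (hm0.trans_le hb)]
    have h2 : ‖σ - c‖ < δ := by simpa [dist_eq_norm] using hσ
    have h3 := norm_sub_le (q - b) (σ - c)
    linarith
  -- Both sides are continuous logarithms of `p - σ` that coincide at `σ = c`. This is the use of
  -- the continuity of `L`.
  have hinit : ∀ σ ∈ ball c δ, L σ = L c + Complex.log ((p - σ) / (p - c)) := by
    intro σ hσ
    have hp : m ≤ ‖p - c‖ := by simpa using hmin 0
    have hp0 : p - c ≠ 0 := norm_pos_iff.1 (hm0.trans_le hp)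
    have hsl : ∀ σ ∈ ball c δ, (p - σ) / (p - c) ∈ Complex.slitPlane := fun σ hσ =>
      hslit σ hσ p p hp (by simpa using hδ0.le)
    have hcont : ContinuousOn (fun σ => L c + Complex.log ((p - σ) / (p - c))) (ball c δ) := by
      refine continuousOn_const.add (ContinuousOn.clog ?_ hsl)
      exact ((continuous_const.sub continuous_id).div_const _).continuousOn
    have := sub_eq_sub_of_exp_eq (convex_ball c δ).isPreconnected (hL.mono hδW') hcont
      (fun σ hσ => by
        rw [hLe σ (hδW' hσ), Complex.exp_add, hLe c hc,
          Complex.exp_log (Complex.slitPlane_ne_zero (hsl σ hσ)), mul_div_cancel₀ _ hp0])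
      hσ (mem_ball_self hδ0)
    rw [div_self hp0, Complex.log_one, add_zero, sub_self, sub_eq_zero] at this
    exact this
  refine ⟨w₀ 1, δ, hδ0, fun σ hσ z hz => ?_⟩
  have hzx : ‖z - x‖ ≤ δ := by simpa [dist_eq_norm] using (mem_ball.1 hz).le
  refine ⟨hslit σ hσ x z (by simpa using hmin 1) hzx, ?_⟩
  set φ : unitInterval → unitInterval := fun s =>
    ⟨min (2 * (s : ℝ)) 1, le_min (by linarith [s.2.1]) zero_le_one, min_le_right _ _⟩ with hφ
  have hφc : Continuous φ := by fun_prop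
  set γ := β.trans (Path.segment x z) with hγ
  have hγs : ∀ s, (γ s - σ) / (β (φ s) - c) ∈ Complex.slitPlane := fun s =>
    hslit σ hσ _ _ (hmin _) ((norm_trans_segment_sub_le β s).trans hzx)
  have hne : ∀ s, β (φ s) - c ≠ 0 := fun s => sub_ne_zero.2 (hβ _)
  have hφ0 : φ 0 = 0 := Subtype.ext (by simp [hφ])
  have hφ1 : φ 1 = 1 := Subtype.ext (by simp [hφ])
  refine ⟨fun s => w₀ (φ s) + Complex.log ((γ s - σ) / (β (φ s) - c)), ⟨?_, fun s => ?_, ?_⟩, ?_⟩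
  · refine (hw₀.continuous.comp hφc).add (Continuous.clog ?_ hγs)
    exact (γ.continuous.sub continuous_const).div
      ((β.continuous.comp hφc).sub continuous_const) hne
  · rw [Complex.exp_add, hw₀.exp_eq, Complex.exp_log (Complex.slitPlane_ne_zero (hγs s)),
      mul_div_cancel₀ _ (hne s)]
  · simp only [hφ0, hw₀.initial, Path.source]
    rw [hinit σ hσ]
  · simp only [hφ1, Path.target]

section

variable {n k : ℕ} {Q : Fin n → (Fin n → ℂ) → Mat k} {D : Set (Fin n → ℂ)}
  {Y : (Fin n → ℂ) → (x : OnePoint ℂ) → Path OnePoint.infty x → Mat k}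
  {T : ℂ → Fin n → ℂ} {τ₀ : ℂ}

/-! ### The solution near a pole -/

/-- Unicoherence again: `V` and the complement of `c` are connected and cover the plane. -/
theorem isPreconnected_diff_singleton {V : Set ℂ} (hV : IsOpen V) (hVc : IsPreconnected V) {c : ℂ}
    (hc : c ∈ V) : IsPreconnected (V \ {c}) := by
  refine isPreconnected_inter_of_union_eq_univ hV isOpen_compl_singleton hVc
    (isConnected_compl_singleton_of_one_lt_rank (by simp) c).isPreconnected ?_
  refine eq_univ_of_forall fun z => ?_
  by_cases hz : z = c
  · exact Or.inl (hz ▸ hc)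
  · exact Or.inr hz

theorem exists_path_of_isPreconnected {S : Set ℂ} (hS : IsOpen S) (hSc : IsPreconnected S)
    {x y : ℂ} (hx : x ∈ S) (hy : y ∈ S) : ∃ β : Path x y, ∀ s, β s ∈ S := by
  have h : IsPathConnected S := hS.isConnected_iff_isPathConnected.1 ⟨⟨x, hx⟩, hSc⟩
  obtain ⟨β, hβ⟩ := h.joinedIn x hx y hy
  exact ⟨β, hβ⟩

/-- The representation `Y(x, β ⬝ α, t) = H(x, t) E(x - tᵢ)` of the solution near the `i`-th pole,
for the poles `t = T τ`, where `τ` is near `τ₀`. -/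
structure IsPrincipalForm (Q : Fin n → (Fin n → ℂ) → Mat k) (T : ℂ → Fin n → ℂ) (τ₀ : ℂ)
    (i : Fin n) (V W : Set ℂ) {p : ℂ} (α : Path OnePoint.infty (p : OnePoint ℂ)) (E : ℂ → Mat k)
    (L : ℂ → ℂ) (H : ℂ → ℂ → Mat k) (N : Set ℂ) : Prop where
  isOpen_V : IsOpen V
  isPreconnected_V : IsPreconnected V
  isOpen_W : IsOpen W
  mem_W : T τ₀ i ∈ W
  mem_V : T τ₀ i ∈ V
  base_mem : p ∈ V \ {T τ₀ i}
  notMem : ∀ l, l ≠ i → T τ₀ l ∉ V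
  avoids : AvoidsPoles (T τ₀) α
  differentiable_E : Differentiable ℂ E
  isUnit_E : ∀ w, IsUnit (E w)
  continuousOn_L : ContinuousOn L W
  exp_L : ∀ σ ∈ W, Complex.exp (L σ) = p - σ
  nhds_N : N ∈ 𝓝 τ₀
  differentiableOn_H : ∀ τ ∈ N, DifferentiableOn ℂ (H τ) V
  isUnit_H : ∀ τ ∈ N, ∀ x ∈ V, IsUnit (H τ x)
  eq : ∀ τ ∈ N, ∀ (x : ℂ) (β : Path p x), (∀ s, β s ∈ V \ {T τ i}) →
    ∀ w, IsLogAlong (T τ i) (L (T τ i)) β w →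
      IsSolutionValue Q (T τ) (α.trans (toSphere β)) (H τ x * E (w 1))

namespace IsPrincipalForm

variable {i : Fin n} {V W : Set ℂ} {p : ℂ} {α : Path OnePoint.infty (p : OnePoint ℂ)}
  {E : ℂ → Mat k} {L : ℂ → ℂ} {H : ℂ → ℂ → Mat k} {N : Set ℂ}

theorem avoidsPoles (h : IsPrincipalForm Q T τ₀ i V W α E L H N) {x y : ℂ} {β : Path x y}
    (hβ : ∀ s, β s ∈ V \ {T τ₀ i}) : AvoidsPoles (T τ₀) (toSphere β) := by
  intro s l he
  have he' : β s = T τ₀ l := OnePoint.coe_injective he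
  by_cases hl : l = i
  · exact (hβ s).2 (by rw [he', hl]; rfl)
  · exact h.notMem l hl (he' ▸ (hβ s).1)

/-- Replaces the continued logarithm by an explicit one, `w₁` plus a principal logarithm, jointly
holomorphic in `τ` and `z`, so that the representation can be differentiated. -/
theorem exists_eq_near (hQ : IsHolomorphicFamily Q D) (hY : IsNormalizedSolution Q D Y)
    (hT : Differentiable ℂ T) (hT₀ : T τ₀ ∈ D)
    (h : IsPrincipalForm Q T τ₀ i V W α E L H N) {x : ℂ} {β : Path p x}
    (hβ : ∀ s, β s ∈ V \ {T τ₀ i}) :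
    ∃ w₁ : ℂ, ∃ δ > 0, ball τ₀ δ ⊆ N ∧ ball x δ ⊆ V \ {T τ₀ i} ∧ ∀ τ ∈ ball τ₀ δ, ∀ z ∈ ball x δ,
      (z - T τ i) / (x - T τ₀ i) ∈ Complex.slitPlane ∧
      Y (T τ) z ((α.trans (toSphere β)).trans (seg x z)) =
        H τ z * E (w₁ + Complex.log ((z - T τ i) / (x - T τ₀ i))) := by
  obtain ⟨w₁, δ₁, hδ₁, hw⟩ := exists_isLogAlong_near β (fun s => (hβ s).2) h.isOpen_W h.mem_W
    h.continuousOn_L h.exp_L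
  have hTi : Continuous fun τ => T τ i := (differentiable_pi.1 hT i).continuous
  have hx : x ∈ V \ {T τ₀ i} := β.target ▸ hβ 1
  have hxo : IsOpen (V \ {T τ₀ i}) := h.isOpen_V.sdiff isClosed_singleton
  have hev : ∀ᶠ τ in 𝓝 τ₀, T τ i ∈ ball (T τ₀ i) δ₁ ∧ τ ∈ N ∧ T τ ∈ D ∧
      AvoidsPoles (T τ) α ∧ AvoidsPoles (T τ) (toSphere β) := by
    filter_upwards [hTi.continuousAt.preimage_mem_nhds (ball_mem_nhds _ hδ₁), h.nhds_N,
      eventually_mem hQ hT hT₀, eventually_avoidsPoles hT.continuous h.avoids,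
      eventually_avoidsPoles hT.continuous (h.avoidsPoles hβ)] with τ h1 h2 h3 h4 h5
    exact ⟨h1, h2, h3, h4, h5⟩
  obtain ⟨r, ε, Φ, hΦ⟩ := exists_isLocalFamily hQ hT hT₀ (a := x) fun j he => by
    have := h.avoidsPoles hβ 1 j
    rw [Path.target] at this
    exact this he
  obtain ⟨δ₂, hδ₂, hb₂⟩ := Metric.eventually_nhds_iff_ball.1 hev
  obtain ⟨δ₃, hδ₃, hb₃⟩ := Metric.isOpen_iff.1 hxo x hx
  set δ := min (min δ₁ δ₂) (min δ₃ (min r ε)) with hδ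
  have l1 : δ ≤ δ₁ := (min_le_left _ _).trans (min_le_left _ _)
  have l2 : δ ≤ δ₂ := (min_le_left _ _).trans (min_le_right _ _)
  have l3 : δ ≤ δ₃ := (min_le_right _ _).trans (min_le_left _ _)
  have l4 : δ ≤ r := ((min_le_right _ _).trans (min_le_right _ _)).trans (min_le_left _ _)
  have l5 : δ ≤ ε := ((min_le_right _ _).trans (min_le_right _ _)).trans (min_le_right _ _)
  have hδ0 : 0 < δ := lt_min (lt_min hδ₁ hδ₂) (lt_min hδ₃ (lt_min hΦ.r_pos hΦ.ε_pos))
  refine ⟨w₁, δ, hδ0, fun τ hτ => (hb₂ τ (ball_subset_ball l2 hτ)).2.1,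
    (ball_subset_ball l3).trans hb₃, fun τ hτ z hz => ?_⟩
  obtain ⟨e1, e2, e3, e4, e5⟩ := hb₂ τ (ball_subset_ball l2 hτ)
  obtain ⟨hsl, w, hwl, hw1⟩ := hw (T τ i) e1 z (ball_subset_ball l1 hz)
  refine ⟨hsl, ?_⟩
  have hseg : AvoidsPoles (T τ) (seg x z) := fun s j =>
    hΦ.ne_pole τ (ball_subset_ball l5 hτ) _ (seg_mem_nbhd (mem_ball_self hΦ.r_pos)
      (ball_subset_ball l4 hz) s) j
  rw [hY.trans_assoc hQ e3 e4 e5 hseg, ← hw1]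
  have hmap : (toSphere β).trans (seg x z) = toSphere (β.trans (Path.segment x z)) :=
    (Path.map_trans _ _ _).symm
  rw [hmap]
  refine hY.eq_of_isSolutionValue hQ e3 (h.eq τ e2 z _ (fun s => ⟨?_, ?_⟩) w hwl)
  · have hr : (β.trans (Path.segment x z)) s ∈ range β ∪ range (Path.segment x z) := by
      rw [← Path.trans_range]; exact mem_range_self s
    rcases hr with ⟨s', hs'⟩ | ⟨s', hs'⟩
    · rw [← hs']; exact (hβ s').1
    · rw [← hs']
      exact (hb₃ (segment_mem_of_convex (convex_ball x δ₃) (mem_ball_self hδ₃)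
        (ball_subset_ball l3 hz) s')).1
  -- A path along which `x - tᵢ` has a logarithm cannot meet `tᵢ`.
  · intro he
    have h0 := hwl.exp_eq s
    rw [mem_singleton_iff.1 he, sub_self] at h0
    exact Complex.exp_ne_zero _ h0

/-- The matrices `H` are given for each `t` separately, with no regularity in `t`. Off the pole `H =
Y E⁻¹`, and both factors are holomorphic in `τ` and locally bounded. -/
theorem exists_bound_near (hQ : IsHolomorphicFamily Q D) (hY : IsNormalizedSolution Q D Y)
    (hT : Differentiable ℂ T) (hT₀ : T τ₀ ∈ D)
    (h : IsPrincipalForm Q T τ₀ i V W α E L H N) {x : ℂ} (hx : x ∈ V \ {T τ₀ i}) :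
    ∃ O ∈ 𝓝 x, ∃ δ > 0, ∃ M : ℝ, ball τ₀ δ ⊆ N ∧ ∀ z ∈ O,
      DifferentiableOn ℂ (fun τ => H τ z) (ball τ₀ δ) ∧ ∀ τ ∈ ball τ₀ δ, ‖H τ z‖ ≤ M := by
  obtain ⟨β, hβ⟩ := exists_path_of_isPreconnected (h.isOpen_V.sdiff isClosed_singleton)
    (isPreconnected_diff_singleton h.isOpen_V h.isPreconnected_V h.mem_V) h.base_mem hx
  obtain ⟨w₁, δ₁, hδ₁, hδN, hδV, heq⟩ := h.exists_eq_near hQ hY hT hT₀ hβ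
  have hav : AvoidsPoles (T τ₀) (α.trans (toSphere β)) :=
    avoidsPoles_trans.2 ⟨h.avoids, h.avoidsPoles hβ⟩
  obtain ⟨r, ε, Φ, hΦ⟩ := exists_isLocalFamily hQ hT hT₀ hav.target
  obtain ⟨K, hK⟩ := hΦ.bound
  obtain ⟨ε', hε', hYd⟩ := hY.exists_differentiableOn hQ hT hT₀ hav
  set F : ℂ × ℂ → Mat k := fun q =>
    Ring.inverse (E (w₁ + Complex.log ((q.2 - T q.1 i) / (x - T τ₀ i)))) with hF
  have hTi : Differentiable ℂ fun τ => T τ i := differentiable_pi.1 hT i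
  have hx0 : x - T τ₀ i ≠ 0 := sub_ne_zero.2 hx.2
  have hFd : ∀ q : ℂ × ℂ, (q.2 - T q.1 i) / (x - T τ₀ i) ∈ Complex.slitPlane →
      DifferentiableAt ℂ F q := by
    intro q hq
    have h1 : DifferentiableAt ℂ (fun q : ℂ × ℂ => (q.2 - T q.1 i) / (x - T τ₀ i)) q := by
      have : DifferentiableAt ℂ (fun q : ℂ × ℂ => T q.1 i) q :=
        (hTi q.1).comp q differentiableAt_fst
      have h0 : DifferentiableAt ℂ (fun q : ℂ × ℂ => q.2 - T q.1 i) q :=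
        differentiableAt_snd.fun_sub this
      simp only [div_eq_mul_inv]
      exact h0.mul_const _
    have h2 : DifferentiableAt ℂ (fun q : ℂ × ℂ =>
        w₁ + Complex.log ((q.2 - T q.1 i) / (x - T τ₀ i))) q :=
      (differentiableAt_const w₁).add (h1.clog hq)
    exact DifferentiableAt.inverse ((h.differentiable_E _).comp q h2) (h.isUnit_E _)
  have hF0 : ContinuousAt F (τ₀, x) := by
    refine (hFd _ ?_).continuousAt
    simp [div_self hx0]
  have hFb : ∀ᶠ q in 𝓝 (τ₀, x), ‖F q‖ < ‖F (τ₀, x)‖ + 1 :=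
    hF0.norm.eventually_lt continuousAt_const (by simp)
  have hYb : ∀ᶠ τ in 𝓝 τ₀, ‖Y (T τ) x (α.trans (toSphere β))‖ <
      ‖Y (T τ₀) x (α.trans (toSphere β))‖ + 1 :=
    (hYd.differentiableAt (ball_mem_nhds τ₀ hε')).continuousAt.norm.eventually_lt
      continuousAt_const (by simp)
  obtain ⟨δ₂, hδ₂, hb₂⟩ := Metric.eventually_nhds_iff_ball.1 hFb
  obtain ⟨δ₃, hδ₃, hb₃⟩ := Metric.eventually_nhds_iff_ball.1
    (hYb.and (eventually_avoidsPoles hT.continuous hav))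
  set δ := min (min δ₁ δ₂) (min (min δ₃ ε') (min r ε)) with hδ
  have l1 : δ ≤ δ₁ := (min_le_left _ _).trans (min_le_left _ _)
  have l2 : δ ≤ δ₂ := (min_le_left _ _).trans (min_le_right _ _)
  have l3 : δ ≤ δ₃ := ((min_le_right _ _).trans (min_le_left _ _)).trans (min_le_left _ _)
  have l4 : δ ≤ ε' := ((min_le_right _ _).trans (min_le_left _ _)).trans (min_le_right _ _)
  have l5 : δ ≤ r := ((min_le_right _ _).trans (min_le_right _ _)).trans (min_le_left _ _)
  have l6 : δ ≤ ε := ((min_le_right _ _).trans (min_le_right _ _)).trans (min_le_right _ _)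
  have hδ0 : 0 < δ :=
    lt_min (lt_min hδ₁ hδ₂) (lt_min (lt_min hδ₃ hε') (lt_min hΦ.r_pos hΦ.ε_pos))
  refine ⟨ball x δ, ball_mem_nhds x hδ0, δ, hδ0,
    K * (‖Y (T τ₀) x (α.trans (toSphere β))‖ + 1) * (‖F (τ₀, x)‖ + 1),
    (ball_subset_ball l1).trans hδN, fun z hz => ?_⟩
  have hzr : z - x ∈ ball (0 : ℂ) r := by
    have := ball_subset_ball l5 hz
    simpa [dist_eq_norm] using this
  have hHeq : ∀ τ ∈ ball τ₀ δ, H τ z =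
      Φ τ (z - x) * Y (T τ) x (α.trans (toSphere β)) * F (τ, z) := by
    intro τ hτ
    have e1 := (heq τ (ball_subset_ball l1 hτ) z (ball_subset_ball l1 hz)).2
    have e2 := hY.trans_eq hQ hΦ (ball_subset_ball l6 hτ) (hb₃ τ (ball_subset_ball l3 hτ)).2
      (γ := seg x z) fun s => seg_mem_nbhd (mem_ball_self hΦ.r_pos) (ball_subset_ball l5 hz) s
    rw [coord_self, hΦ.map_zero, Ring.inverse_one, one_mul, coord_coe_coe] at e2
    rw [← e2, e1, hF, Ring.mul_inverse_cancel_right _ _ (h.isUnit_E _)]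
  refine ⟨DifferentiableOn.congr ?_ hHeq, fun τ hτ => ?_⟩
  · refine DifferentiableOn.fun_mul (DifferentiableOn.fun_mul
      ((hΦ.differentiableOn_param _ hzr).mono (ball_subset_ball l6))
      (hYd.mono (ball_subset_ball l4))) fun τ hτ => ?_
    refine DifferentiableAt.differentiableWithinAt ?_
    have hpr : DifferentiableAt ℂ (fun τ : ℂ => (τ, z)) τ := by fun_prop
    exact DifferentiableAt.comp (g := F) τ
      (hFd (τ, z) (heq τ (ball_subset_ball l1 hτ) z (ball_subset_ball l1 hz)).1) hpr
  · rw [hHeq τ hτ]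
    have hq : (τ, z) ∈ ball (τ₀, x) δ₂ := by
      rw [← ball_prod_same]
      exact ⟨ball_subset_ball l2 hτ, ball_subset_ball l2 hz⟩
    have b1 := hK τ (ball_subset_ball l6 hτ) _ hzr
    have b2 := (hb₃ τ (ball_subset_ball l3 hτ)).1.le
    have b3 := (hb₂ _ hq).le
    have hK0 : 0 ≤ K := (norm_nonneg _).trans b1
    calc _ ≤ ‖Φ τ (z - x)‖ * ‖Y (T τ) x (α.trans (toSphere β))‖ * ‖F (τ, z)‖ :=
          (norm_mul_le _ _).trans (mul_le_mul_of_nonneg_right (norm_mul_le _ _) (norm_nonneg _))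
      _ ≤ _ := by gcongr

/-- Compactness makes the bounds of `exists_bound_near` uniform on any circle that misses the pole,
and `exists_hasDerivAt_param` carries them inside, including to the pole itself. -/
theorem exists_hasDerivAt (hQ : IsHolomorphicFamily Q D) (hY : IsNormalizedSolution Q D Y)
    (hT : Differentiable ℂ T) (hT₀ : T τ₀ ∈ D)
    (h : IsPrincipalForm Q T τ₀ i V W α E L H N) :
    ∃ g : ℂ → Mat k, DifferentiableOn ℂ g V ∧
      ∀ x ∈ V, HasDerivAt (fun τ => H τ x) (g x) τ₀ := by
  have key : ∀ c R, closedBall c R ⊆ V → T τ₀ i ∉ sphere c R → ∃ g : ℂ → Mat k,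
      DifferentiableOn ℂ g (ball c R) ∧
        ∀ x ∈ ball c R, HasDerivAt (fun τ => H τ x) (g x) τ₀ := by
    intro c R hcR hs
    have hun : ∃ δ > 0, ∃ M : ℝ, ball τ₀ δ ⊆ N ∧ ∀ z ∈ sphere c R,
        DifferentiableOn ℂ (fun τ => H τ z) (ball τ₀ δ) ∧ ∀ τ ∈ ball τ₀ δ, ‖H τ z‖ ≤ M := by
      refine (isCompact_sphere c R).induction_on (p := fun S => ∃ δ > 0, ∃ M : ℝ,
        ball τ₀ δ ⊆ N ∧ ∀ z ∈ S, DifferentiableOn ℂ (fun τ => H τ z) (ball τ₀ δ) ∧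
          ∀ τ ∈ ball τ₀ δ, ‖H τ z‖ ≤ M) ?_ ?_ ?_ ?_
      · obtain ⟨δ, hδ, hδN⟩ := Metric.mem_nhds_iff.1 h.nhds_N
        exact ⟨δ, hδ, 0, hδN, fun z hz => absurd hz (notMem_empty z)⟩
      · rintro S S' hSS ⟨δ, hδ, M, hN, hM⟩
        exact ⟨δ, hδ, M, hN, fun z hz => hM z (hSS hz)⟩
      · rintro S S' ⟨δ, hδ, M, hN, hM⟩ ⟨δ', hδ', M', hN', hM'⟩
        refine ⟨min δ δ', lt_min hδ hδ', max M M',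
          (ball_subset_ball (min_le_left _ _)).trans hN, ?_⟩
        rintro z (hz | hz)
        · obtain ⟨h1, h2⟩ := hM z hz
          have hb := ball_subset_ball (x := τ₀) (min_le_left δ δ')
          exact ⟨h1.mono hb, fun τ hτ => (h2 τ (hb hτ)).trans (le_max_left _ _)⟩
        · obtain ⟨h1, h2⟩ := hM' z hz
          have hb := ball_subset_ball (x := τ₀) (min_le_right δ δ')
          exact ⟨h1.mono hb, fun τ hτ => (h2 τ (hb hτ)).trans (le_max_right _ _)⟩
      · intro x hx
        have hxV : x ∈ V \ {T τ₀ i} :=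
          ⟨hcR (sphere_subset_closedBall hx), fun he => hs (mem_singleton_iff.1 he ▸ hx)⟩
        obtain ⟨O, hO, hrest⟩ := h.exists_bound_near hQ hY hT hT₀ hxV
        exact ⟨O, mem_nhdsWithin_of_mem_nhds hO, hrest⟩
    obtain ⟨δ, hδ, M, hN, hM⟩ := hun
    exact exists_hasDerivAt_param hδ
      (fun τ hτ => ((h.differentiableOn_H τ (hN hτ)).mono
        (closure_ball_subset_closedBall.trans hcR)).diffContOnCl)
      (fun x hx => (hM x hx).1) (fun τ hτ x hx => (hM x hx).2 τ hτ)
  have hloc : ∀ x ∈ V, ∃ R > 0, ∃ g : ℂ → Mat k, DifferentiableOn ℂ g (ball x R) ∧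
      ∀ z ∈ ball x R, HasDerivAt (fun τ => H τ z) (g z) τ₀ := by
    intro x hx
    obtain ⟨R, hR, hRV⟩ := nhds_basis_closedBall.mem_iff.1 (h.isOpen_V.mem_nhds hx)
    -- A disc centered at the pole, or one too small to reach it: in both cases the boundary circle
    -- misses the pole.
    by_cases hxc : x = T τ₀ i
    · exact ⟨R, hR, key x R hRV (by rw [← hxc]; simp [hR.ne])⟩
    · have hd : 0 < dist (T τ₀ i) x := dist_pos.2 (Ne.symm hxc)
      refine ⟨min R (dist (T τ₀ i) x / 2), lt_min hR (half_pos hd), key x _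
        ((closedBall_subset_closedBall (min_le_left _ _)).trans hRV) fun hmem => ?_⟩
      have h1 := mem_sphere.1 hmem
      have h2 := min_le_right R (dist (T τ₀ i) x / 2)
      linarith
  refine ⟨fun x => deriv (fun τ => H τ x) τ₀, fun x hx => ?_, fun x hx => ?_⟩
  · obtain ⟨R, hR, g, hg, hgd⟩ := hloc x hx
    refine DifferentiableAt.differentiableWithinAt ?_
    refine (hg.differentiableAt (ball_mem_nhds x hR)).congr_of_eventuallyEq ?_
    filter_upwards [ball_mem_nhds x hR] with z hz
    exact (hgd z hz).deriv
  · obtain ⟨R, hR, g, hg, hgd⟩ := hloc x hx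
    exact (hgd x (mem_ball_self hR)).differentiableAt.hasDerivAt

/-- Near the `i`-th pole, the logarithmic derivative of the solution with respect to the parameter
is the sum of a holomorphic function and of a multiple of the coefficient of the system. -/
theorem exists_isLogDeriv (hQ : IsHolomorphicFamily Q D) (hY : IsNormalizedSolution Q D Y)
    (hT : Differentiable ℂ T) (hT₀ : T τ₀ ∈ D)
    (h : IsPrincipalForm Q T τ₀ i V W α E L H N) :
    ∃ g : ℂ → Mat k, DifferentiableOn ℂ g V ∧
      ∀ (x : ℂ) (β : Path p x), (∀ s, β s ∈ V \ {T τ₀ i}) →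
        IsLogDeriv Y T τ₀ (α.trans (toSphere β))
          (g x - deriv (fun τ => T τ i) τ₀ • coeff Q (T τ₀) x) := by
  obtain ⟨g, hg, hgd⟩ := h.exists_hasDerivAt hQ hY hT hT₀
  have hN := mem_of_mem_nhds h.nhds_N
  have hHd := h.differentiableOn_H τ₀ hN
  set κ := deriv (fun τ => T τ i) τ₀ with hκ
  -- Since `E` sees only `x - tᵢ`, its `τ`-derivative is `-κ` times its `x`-derivative. By the
  -- `x`-equation `H ∂ₓE = A H E - (∂ₓH) E`, with `A` the coefficient, which gives `∂Y/∂τ = (∂H/∂τ +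
  -- κ ∂ₓH) E - κ A Y`.
  refine ⟨fun x => (g x + κ • deriv (H τ₀) x) * Ring.inverse (H τ₀ x), ?_, fun x β hβ => ?_⟩
  · refine DifferentiableOn.fun_mul (DifferentiableOn.fun_add hg ?_)
      (DifferentiableOn.inverse hHd (h.isUnit_H τ₀ hN))
    exact (hHd.deriv h.isOpen_V).fun_const_smul κ
  obtain ⟨w₁, δ, hδ, hδN, hδV, heq⟩ := h.exists_eq_near hQ hY hT hT₀ hβ
  have hx : x ∈ V \ {T τ₀ i} := β.target ▸ hβ 1
  have hx0 : x - T τ₀ i ≠ 0 := sub_ne_zero.2 hx.2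
  have hav : AvoidsPoles (T τ₀) (α.trans (toSphere β)) :=
    avoidsPoles_trans.2 ⟨h.avoids, h.avoidsPoles hβ⟩
  have hseg : AvoidsPoles (T τ₀) (seg x x) := by
    intro s j
    have := hav.target j
    simpa [seg, toSphere] using this
  -- The formula `heq` concerns paths with an appended segment; for `z = x` the segment is constant
  -- and does not change the value.
  have hself : ∀ τ, T τ ∈ D → AvoidsPoles (T τ) (α.trans (toSphere β)) →
      Y (T τ) x ((α.trans (toSphere β)).trans (seg x x)) = Y (T τ) x (α.trans (toSphere β)) := by
    intro τ hτ hτa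
    obtain ⟨r, ε, Φ, hΦ⟩ := exists_isLocalFamily_const hQ hτ hτa.target
    rw [hY.trans_eq hQ hΦ (mem_ball_self hΦ.ε_pos) hτa fun s =>
      seg_mem_nbhd (mem_ball_self hΦ.r_pos) (mem_ball_self hΦ.r_pos) s, coord_self, hΦ.map_zero,
      Ring.inverse_one, one_mul, one_mul]
  have hτ₀ : τ₀ ∈ ball τ₀ δ := mem_ball_self hδ
  have hxb : x ∈ ball x δ := mem_ball_self hδ
  have hE : HasDerivAt E (deriv E w₁) w₁ := (h.differentiable_E w₁).hasDerivAt
  have hTi : HasDerivAt (fun τ => T τ i) κ τ₀ := (differentiable_pi.1 hT i τ₀).hasDerivAt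
  have hlog1 : Complex.log ((x - T τ₀ i) / (x - T τ₀ i)) = 0 := by
    rw [div_self hx0, Complex.log_one]
  have hval : Y (T τ₀) x (α.trans (toSphere β)) = H τ₀ x * E w₁ := by
    rw [← hself τ₀ hT₀ hav, (heq τ₀ hτ₀ x hxb).2, hlog1, add_zero]
  have hdx : HasDerivAt (fun z => H τ₀ z * E (w₁ + Complex.log ((z - T τ₀ i) / (x - T τ₀ i))))
      (deriv (H τ₀) x * E w₁ + H τ₀ x * ((x - T τ₀ i)⁻¹ • deriv E w₁)) x := by
    have h1 : HasDerivAt (fun z => w₁ + Complex.log ((z - T τ₀ i) / (x - T τ₀ i)))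
        (x - T τ₀ i)⁻¹ x := by
      have := ((((hasDerivAt_id x).sub_const (T τ₀ i)).div_const (x - T τ₀ i)).clog
        (heq τ₀ hτ₀ x hxb).1).const_add w₁
      refine HasDerivAt.congr_deriv this ?_
      simp [div_self hx0]
    have h2 := HasDerivAt.scomp_of_eq (y := w₁) x hE h1 (by rw [hlog1, add_zero])
    have h3 := HasDerivAt.fun_mul (hHd.differentiableAt (h.isOpen_V.mem_nhds hx.1)).hasDerivAt h2
    refine HasDerivAt.congr_deriv h3 ?_
    rw [Function.comp_apply, hlog1, add_zero]
    rfl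
  have hdτ : HasDerivAt (fun τ => H τ x * E (w₁ + Complex.log ((x - T τ i) / (x - T τ₀ i))))
      (g x * E w₁ + H τ₀ x * ((-κ * (x - T τ₀ i)⁻¹) • deriv E w₁)) τ₀ := by
    have h1 : HasDerivAt (fun τ => w₁ + Complex.log ((x - T τ i) / (x - T τ₀ i)))
        (-κ * (x - T τ₀ i)⁻¹) τ₀ := by
      have := (((hTi.const_sub x).div_const (x - T τ₀ i)).clog
        (heq τ₀ hτ₀ x hxb).1).const_add w₁
      refine HasDerivAt.congr_deriv this ?_
      simp [div_self hx0, div_eq_mul_inv]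
    have h2 := HasDerivAt.scomp_of_eq (y := w₁) τ₀ hE h1 (by rw [hlog1, add_zero])
    have h3 := HasDerivAt.fun_mul (hgd x hx.1) h2
    refine HasDerivAt.congr_deriv h3 ?_
    rw [Function.comp_apply, hlog1, add_zero]
  have hode : deriv (H τ₀) x * E w₁ + H τ₀ x * ((x - T τ₀ i)⁻¹ • deriv E w₁) =
      coeff Q (T τ₀) x * (H τ₀ x * E w₁) := by
    rw [← hval]
    refine HasDerivAt.unique hdx ((hY.hasDerivAt hQ hT₀ hav).congr_of_eventuallyEq ?_)
    filter_upwards [ball_mem_nhds x hδ] with z hz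
    exact (heq τ₀ hτ₀ z hz).2.symm
  have hYd : HasDerivAt (fun τ => Y (T τ) x (α.trans (toSphere β)))
      (g x * E w₁ + H τ₀ x * ((-κ * (x - T τ₀ i)⁻¹) • deriv E w₁)) τ₀ := by
    refine hdτ.congr_of_eventuallyEq ?_
    filter_upwards [eventually_mem hQ hT hT₀, eventually_avoidsPoles hT.continuous hav,
      ball_mem_nhds τ₀ hδ] with τ h1 h2 h3
    rw [← hself τ h1 h2, (heq τ h3 x hxb).2]
  refine HasDerivAt.congr_deriv hYd ?_
  have h4 : H τ₀ x * ((-κ * (x - T τ₀ i)⁻¹) • deriv E w₁) =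
      -κ • (coeff Q (T τ₀) x * (H τ₀ x * E w₁) - deriv (H τ₀) x * E w₁) := by
    rw [← hode, add_sub_cancel_left, mul_smul, mul_smul_comm]
  rw [hval, h4, sub_mul, mul_assoc (g x + _),
    Ring.inverse_mul_cancel_left _ _ (h.isUnit_H τ₀ hN x hx.1), add_mul, smul_mul_assoc,
    smul_mul_assoc, smul_sub, neg_smul, neg_smul]
  abel

end IsPrincipalForm

end

section

variable {n k : ℕ} {Q : Fin n → (Fin n → ℂ) → Mat k} {D : Set (Fin n → ℂ)}
  {Y : (Fin n → ℂ) → (x : OnePoint ℂ) → Path OnePoint.infty x → Mat k}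

/-! ### Neighborhoods of the poles -/

/-- The sets `V i` are disjoint open neighborhoods of compact sets `K i` which contain the poles. -/
structure IsPoleNhds {n : ℕ} (t : Fin n → ℂ) (K V : Fin n → Set ℂ) : Prop where
  isOpen : ∀ i, IsOpen (V i)
  isCompact : ∀ i, IsCompact (K i)
  subset : ∀ i, K i ⊆ V i
  mem : ∀ i, t i ∈ K i
  eq_of_mem : ∀ i l z, z ∈ V i → z ∈ V l → i = l
  isPreconnected : ∀ i, IsPreconnected (V i \ K i)

/-- The path `α` does not meet the sets `K i`. -/
def AvoidsSets {n : ℕ} (K : Fin n → Set ℂ) {a b : OnePoint ℂ} (α : Path a b) : Prop :=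
  ∀ s i, ∀ z ∈ K i, α s ≠ (z : OnePoint ℂ)

theorem AvoidsSets.trans {K : Fin n → Set ℂ} {a b c : OnePoint ℂ} {α : Path a b} {β : Path b c}
    (hα : AvoidsSets K α) (hβ : AvoidsSets K β) : AvoidsSets K (α.trans β) := by
  intro s i z hz
  have hr : (α.trans β) s ∈ range α ∪ range β := by
    rw [← Path.trans_range]; exact mem_range_self s
  rcases hr with ⟨s', hs'⟩ | ⟨s', hs'⟩
  · rw [← hs']; exact hα s' i z hz
  · rw [← hs']; exact hβ s' i z hz

theorem AvoidsSets.avoidsPoles {t : Fin n → ℂ} {K : Fin n → Set ℂ} (hK : ∀ i, t i ∈ K i)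
    {a b : OnePoint ℂ} {α : Path a b} (hα : AvoidsSets K α) : AvoidsPoles t α :=
  fun s i => hα s i (t i) (hK i)

theorem avoidsSets_toSphere {K : Fin n → Set ℂ} {x y : ℂ} {β : Path x y}
    (hβ : ∀ s i, β s ∉ K i) : AvoidsSets K (toSphere β) :=
  fun s i z hz he => hβ s i ((OnePoint.coe_injective he : β s = z) ▸ hz)

theorem IsNestedPair.mem_closure_pi {t₀ t : Fin n → ℂ} {W V : Fin n → Set ℂ}
    (h : IsNestedPair D t₀ W V) (ht : ∀ i, t i ∈ closure (W i)) : ∀ i, t i ∈ V i := by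
  have h1 : t ∈ closure (cyl W) := by
    rw [cyl, closure_pi_set]
    exact fun i _ => ht i
  exact fun i => (h.inner_subset.2.2 h1).1 i (mem_univ i)

/-- If two bases `V i`, `V l` met, `cyl V` would contain a point with two equal coordinates. The
collar `V i \ closure (W i)` is connected by unicoherence, as `V i` and the complement of `closure
(W i)` are connected and cover the plane. -/
theorem IsNestedPair.isPoleNhds {t : Fin n → ℂ} {W V : Fin n → Set ℂ}
    (h : IsNestedPair D t W V) : IsPoleNhds t (fun i => closure (W i)) V where
  isOpen := h.outer.isOpen
  isCompact i := by
    have h1 := h.inner_subset.2.1.image (continuous_apply i)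
    rw [cyl, closure_pi_set] at h1
    convert h1
    refine (eval_image_univ_pi (t := fun i => closure (W i)) ⟨t, fun l _ => ?_⟩).symm
    exact subset_closure (h.inner.mem l)
  subset i z hz := by
    have := h.mem_closure_pi (t := Function.update t i z) (fun l => ?_) i
    · rwa [Function.update_self] at this
    · by_cases hl : l = i
      · subst hl; rwa [Function.update_self]
      · rw [Function.update_of_ne hl]; exact subset_closure (h.inner.mem l)
  mem i := subset_closure (h.inner.mem i)
  eq_of_mem i l z hi hl := by
    by_contra hil
    have h1 : Function.update (Function.update t i z) l z ∈ cyl V := by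
      intro m _
      by_cases hm : m = l
      · subst hm; rwa [Function.update_self]
      · rw [Function.update_of_ne hm]
        by_cases hm' : m = i
        · subst hm'; rwa [Function.update_self]
        · rw [Function.update_of_ne hm']; exact h.outer.mem m
    have h2 : Function.Injective _ := h.outer_subset.2.2 (subset_closure h1)
    refine hil (h2 ?_)
    rw [Function.update_self, Function.update_of_ne hil, Function.update_self]
  isPreconnected i := by
    refine isPreconnected_inter_of_union_eq_univ (h.outer.isOpen i) isClosed_closure.isOpen_compl
      (h.outer.simplyConnected i).isPathConnected.isConnected.isPreconnected
      (h.inner.connected_compl i).isPreconnected ?_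
    refine eq_univ_of_forall fun z => ?_
    by_cases hz : z ∈ closure (W i)
    · have := h.mem_closure_pi (t := Function.update t i z) (fun l => ?_) i
      · rw [Function.update_self] at this
        exact Or.inl this
      · by_cases hl : l = i
        · subst hl; rwa [Function.update_self]
        · rw [Function.update_of_ne hl]; exact subset_closure (h.inner.mem l)
    · exact Or.inr hz

theorem differentiable_update (t : Fin n → ℂ) (j : Fin n) :
    Differentiable ℂ fun τ => Function.update t j τ :=
  fun τ => (hasDerivAt_update t j τ).differentiableAt

theorem deriv_update_apply (t : Fin n → ℂ) (j i : Fin n) (τ : ℂ) :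
    deriv (fun τ => Function.update t j τ i) τ = if i = j then 1 else 0 := by
  split_ifs with h
  · subst h
    simp
  · simp [Function.update_of_ne h]

theorem differentiableOn_inv_smul {V : Set ℂ} {c : ℂ} (hc : c ∉ V) (q : Mat k) :
    DifferentiableOn ℂ (fun z => (z - c)⁻¹ • q) V := by
  refine DifferentiableOn.smul_const (DifferentiableOn.fun_inv (by fun_prop) fun z hz h => ?_) q
  exact hc (sub_eq_zero.1 h ▸ hz)

/-- In an isoprincipal family the logarithmic derivative of the solution with respect to `tⱼ` is,
near every pole, the sum of a holomorphic function and of `-Qⱼ(t) / (x - tⱼ)`. -/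
theorem exists_isLogDeriv_near_pole (hQ : IsHolomorphicFamily Q D)
    (hY : IsNormalizedSolution Q D Y) {t : Fin n → ℂ} (ht : t ∈ D) {W V : Fin n → Set ℂ}
    (hWV : IsNestedPair D t W V) (j i : Fin n) {p : ℂ} (hp : p ∈ V i \ closure (W i))
    {α : Path OnePoint.infty (p : OnePoint ℂ)} (hα : AvoidsSets (fun i => closure (W i)) α)
    (hiso : ∃ (E : ℂ → Mat k) (L : ℂ → ℂ),
      Differentiable ℂ E ∧ (∀ w, IsUnit (E w)) ∧
      ContinuousOn L (W i) ∧ (∀ τ ∈ W i, Complex.exp (L τ) = p - τ) ∧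
      ∀ t ∈ cyl W, ∃ H : ℂ → Mat k,
        DifferentiableOn ℂ H (V i) ∧ (∀ x ∈ V i, IsUnit (H x)) ∧
        ∀ (x : ℂ) (β : Path p x), (∀ s, β s ∈ V i \ {t i}) →
        ∀ w : unitInterval → ℂ, IsLogAlong (t i) (L (t i)) β w →
          IsSolutionValue Q t (α.trans (toSphere β)) (H x * E (w 1))) :
    ∃ g : ℂ → Mat k, DifferentiableOn ℂ g (V i) ∧
      ∀ (x : ℂ) (β : Path p x), (∀ s, β s ∈ V i \ {t i}) →
        IsLogDeriv Y (Function.update t j) (t j) (α.trans (toSphere β))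
          (g x - (x - t j)⁻¹ • Q j t) := by
  obtain ⟨E, L, hE, hEu, hLc, hL, hH⟩ := hiso
  choose! H hHd hHu hHe using hH
  have hN := hWV.isPoleNhds
  have hself : Function.update t j (t j) = t := Function.update_eq_self j t
  have hcyl : ∀ τ ∈ W j, Function.update t j τ ∈ cyl W := by
    intro τ hτ l _
    by_cases hl : l = j
    · subst hl; rwa [Function.update_self]
    · rw [Function.update_of_ne hl]; exact hWV.inner.mem l
  have hP : IsPrincipalForm Q (Function.update t j) (t j) i (V i) (W i) α E L
      (fun τ => H (Function.update t j τ)) (W j) :=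
    { isOpen_V := hWV.outer.isOpen i
      isPreconnected_V := (hWV.outer.simplyConnected i).isPathConnected.isConnected.isPreconnected
      isOpen_W := hWV.inner.isOpen i
      mem_W := hself.symm ▸ hWV.inner.mem i
      mem_V := hself.symm ▸ hWV.outer.mem i
      base_mem := ⟨hp.1, fun h => hp.2 (by
        rw [mem_singleton_iff.1 h, hself]; exact hN.mem i)⟩
      notMem := fun l hl h => hl (by
        rw [hself] at h; exact hN.eq_of_mem l i _ (hWV.outer.mem l) h)
      avoids := hself.symm ▸ hα.avoidsPoles hN.mem
      differentiable_E := hE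
      isUnit_E := hEu
      continuousOn_L := hLc
      exp_L := hL
      nhds_N := (hWV.inner.isOpen j).mem_nhds (hWV.inner.mem j)
      differentiableOn_H := fun τ hτ => hHd _ (hcyl τ hτ)
      isUnit_H := fun τ hτ => hHu _ (hcyl τ hτ)
      eq := fun τ hτ => hHe _ (hcyl τ hτ) }
  obtain ⟨g, hg, hgd⟩ := hP.exists_isLogDeriv hQ hY (differentiable_update t j) (by rwa [hself])
  rw [hself, deriv_update_apply] at hgd
  have hV : ∀ l, l ≠ i → t l ∉ V i := fun l hl h => hl (hN.eq_of_mem l i _ (hWV.outer.mem l) h)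
  -- The speed of the `i`-th pole is 1 or 0. In the first case the terms of the coefficient at the
  -- other poles are holomorphic on `V i` and are absorbed in `g`; in the second it is the term at
  -- `tⱼ` that is absorbed.
  by_cases hij : i = j
  · subst hij
    refine ⟨fun x => g x - ∑ l ∈ Finset.univ.erase i, (x - t l)⁻¹ • Q l t, ?_, fun x β hβ => ?_⟩
    · refine DifferentiableOn.fun_sub hg (DifferentiableOn.fun_sum fun l hl => ?_)
      exact differentiableOn_inv_smul (hV l (Finset.ne_of_mem_erase hl)) _
    · have := hgd x β hβ
      rw [if_pos rfl, one_smul, coeff, ← Finset.sum_erase_add _ _ (Finset.mem_univ i),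
        ← sub_sub] at this
      exact this
  · refine ⟨fun x => g x + (x - t j)⁻¹ • Q j t, ?_, fun x β hβ => ?_⟩
    · exact DifferentiableOn.fun_add hg (differentiableOn_inv_smul (hV j (Ne.symm hij)) _)
    · have := hgd x β hβ
      rw [if_neg hij, zero_smul, sub_zero] at this
      rwa [add_sub_cancel_right]

end

section

variable {n k : ℕ} {Q : Fin n → (Fin n → ℂ) → Mat k} {D : Set (Fin n → ℂ)}
  {Y : (Fin n → ℂ) → (x : OnePoint ℂ) → Path OnePoint.infty x → Mat k}
  {T : ℂ → Fin n → ℂ} {τ₀ : ℂ} {K V : Fin n → Set ℂ} {S : ℂ → Mat k}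

/-! ### The logarithmic derivative as a function on the sphere -/

theorem exists_nbhd_notMem (hK : ∀ i, IsCompact (K i)) {a : OnePoint ℂ}
    (ha : ∀ i, ∀ z ∈ K i, a ≠ (z : OnePoint ℂ)) :
    ∃ R > 0, ∀ x ∈ nbhd a R, ∀ i, ∀ z ∈ K i, x ≠ (z : OnePoint ℂ) := by
  have h1 : ∀ᶠ x in 𝓝 (chart a 0), ∀ i, ∀ z ∈ K i, x ≠ (z : OnePoint ℂ) := by
    rw [chart_zero]
    refine eventually_all.2 fun i => ?_
    have hc : IsClosed ((fun z : ℂ => (z : OnePoint ℂ)) '' K i) :=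
      ((hK i).image OnePoint.continuous_coe).isClosed
    filter_upwards [hc.isOpen_compl.mem_nhds (x := a) fun ⟨z, hz, he⟩ => ha i z hz he.symm]
      with x hx z hz he
    exact hx ⟨z, hz, he.symm⟩
  obtain ⟨R, hR, hb⟩ := Metric.eventually_nhds_iff_ball.1 (eventually_nhds_chart.1 h1)
  refine ⟨R, hR, ?_⟩
  rintro _ ⟨u, hu, rfl⟩
  exact hb u hu

theorem toSphere_trans_seg {p x : ℂ} (β : Path p x) (z : ℂ) :
    (toSphere β).trans (seg x z) = toSphere (β.trans (Path.segment x z)) :=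
  (Path.map_trans _ _ _).symm

theorem trans_mem {X : Type*} [TopologicalSpace X] {a b c : X} {β : Path a b} {γ : Path b c}
    {O : Set X} (hβ : ∀ s, β s ∈ O) (hγ : ∀ s, γ s ∈ O) (s : unitInterval) :
    β.trans γ s ∈ O := by
  have hr : (β.trans γ) s ∈ range β ∪ range γ := by
    rw [← Path.trans_range]; exact mem_range_self s
  rcases hr with ⟨s', hs'⟩ | ⟨s', hs'⟩
  · rw [← hs']; exact hβ s'
  · rw [← hs']; exact hγ s'

/-- The form needed for `G + S` at finite points, in the coordinate `z` of the plane. -/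
theorem exists_isLogDeriv_sub (hQ : IsHolomorphicFamily Q D) (hY : IsNormalizedSolution Q D Y)
    (hT : Differentiable ℂ T) (hT₀ : T τ₀ ∈ D)
    (hS : ∀ z, (∀ j, z ≠ T τ₀ j) → DifferentiableAt ℂ S z) {c : ℂ} (hc : ∀ j, c ≠ T τ₀ j) {R : ℝ}
    (hR : 0 < R) : ∃ r > 0, r ≤ R ∧ (∀ x ∈ nbhd (c : OnePoint ℂ) r, ∀ j, x ≠ T τ₀ j) ∧
      ∀ {y : ℂ} (α : Path OnePoint.infty (y : OnePoint ℂ)), AvoidsPoles (T τ₀) α → y ∈ ball c r →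
      ∃ g : ℂ → Mat k, DifferentiableOn ℂ g (ball c r) ∧
        ∀ {z : ℂ} (γ : Path (y : OnePoint ℂ) (z : OnePoint ℂ)),
        (∀ s, γ s ∈ nbhd (c : OnePoint ℂ) r) → IsLogDeriv Y T τ₀ (α.trans γ) (g z - S z) := by
  obtain ⟨r, hr, hrR, hav, h⟩ := exists_isLogDeriv hQ hY hT hT₀ (a := c)
    (fun j he => hc j (OnePoint.coe_injective he)) hR
  refine ⟨r, hr, hrR, hav, fun {y} α hα hy => ?_⟩
  obtain ⟨g, hg, hgd⟩ := h α hα (by rw [nbhd_coe]; exact ⟨y, hy, rfl⟩)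
  refine ⟨fun z => g (z - c) + S z, DifferentiableOn.fun_add ?_ fun z hz => ?_, fun {z} γ hγ => ?_⟩
  · refine DifferentiableOn.comp (t := ball 0 r) hg (by fun_prop) fun z hz => ?_
    simpa [dist_eq_norm] using hz
  · refine (hS z fun j he => hav z ?_ j (congrArg _ he)).differentiableWithinAt
    rw [nbhd_coe]; exact ⟨z, hz, rfl⟩
  · have := hgd γ hγ
    rwa [add_sub_cancel_right]

/-- Near the pole `c`, the logarithmic derivative of the solution is the sum of the holomorphic
function `g` and of `-S`. -/
def HasPoleExpansion (Y : (Fin n → ℂ) → (x : OnePoint ℂ) → Path OnePoint.infty x → Mat k)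
    (T : ℂ → Fin n → ℂ) (τ₀ : ℂ) (S : ℂ → Mat k) (V : Set ℂ) (c : ℂ) {p : ℂ}
    (α : Path OnePoint.infty (p : OnePoint ℂ)) (g : ℂ → Mat k) : Prop :=
  DifferentiableOn ℂ g V ∧ ∀ (x : ℂ) (β : Path p x), (∀ s, β s ∈ V \ {c}) →
    IsLogDeriv Y T τ₀ (α.trans (toSphere β)) (g x - S x)

/-- The germ of `f` at `x` is the sum of `S` and of a branch of the logarithmic derivative of the
solution, obtained by continuation outside of the sets `K i` or inside of a set `V i`. -/
def IsLogDerivGerm (Y : (Fin n → ℂ) → (x : OnePoint ℂ) → Path OnePoint.infty x → Mat k)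
    (T : ℂ → Fin n → ℂ) (τ₀ : ℂ) (K V : Fin n → Set ℂ) (S : ℂ → Mat k) (x : ℂ) (f : ℂ → Mat k) :
    Prop :=
  (∃ α : Path OnePoint.infty (x : OnePoint ℂ), AvoidsSets K α ∧
    ∀ᶠ z in 𝓝 x, IsLogDeriv Y T τ₀ (α.trans (seg x z)) (f z - S z)) ∨
  ∃ (i : Fin n) (p : ℂ) (α : Path OnePoint.infty (p : OnePoint ℂ)) (g : ℂ → Mat k), x ∈ V i ∧
    p ∈ V i \ K i ∧ AvoidsSets K α ∧ HasPoleExpansion Y T τ₀ S (V i) (T τ₀ i) α g ∧ f =ᶠ[𝓝 x] g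

theorem IsLogDerivGerm.congr {x : ℂ} {f g : ℂ → Mat k} (hfg : f =ᶠ[𝓝 x] g)
    (h : IsLogDerivGerm Y T τ₀ K V S x f) : IsLogDerivGerm Y T τ₀ K V S x g := by
  rcases h with ⟨α, hα, h⟩ | ⟨i, p, α, g', h1, h2, h3, h4, h5⟩
  · refine Or.inl ⟨α, hα, ?_⟩
    filter_upwards [h, hfg] with z h1 h2
    rwa [← h2]
  · exact Or.inr ⟨i, p, α, g', h1, h2, h3, h4, hfg.symm.trans h5⟩

theorem eventuallyEq_of_isLogDeriv (hQ : IsHolomorphicFamily Q D) (hY : IsNormalizedSolution Q D Y)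
    (hT₀ : T τ₀ ∈ D) {x : ℂ} {α : Path OnePoint.infty (x : OnePoint ℂ)}
    (hα : AvoidsPoles (T τ₀) α) {f g : ℂ → Mat k}
    (hav : ∀ᶠ z in 𝓝 x, AvoidsPoles (T τ₀) (seg x z))
    (hf : ∀ᶠ z in 𝓝 x, IsLogDeriv Y T τ₀ (α.trans (seg x z)) (f z - S z))
    (hg : ∀ᶠ z in 𝓝 x, IsLogDeriv Y T τ₀ (α.trans (seg x z)) (g z - S z)) : f =ᶠ[𝓝 x] g := by
  filter_upwards [hf, hg, hav] with z h1 h2 h3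
  exact sub_left_injective (h1.unique hQ hY hT₀ (avoidsPoles_trans.2 ⟨hα, h3⟩) h2)

theorem AvoidsSets.target {a : OnePoint ℂ} {x : ℂ} {α : Path a (x : OnePoint ℂ)}
    (hα : AvoidsSets K α) (i : Fin n) : x ∉ K i := fun h => by
  have := hα 1 i x h
  rw [α.target] at this
  exact this rfl

theorem eventually_avoidsPoles_seg {t : Fin n → ℂ} {x : ℂ} (hx : ∀ j, x ≠ t j) :
    ∀ᶠ z in 𝓝 x, AvoidsPoles t (seg x z) := by
  have h : ∀ᶠ z in 𝓝 x, ∀ j, z ≠ t j := eventually_all.2 fun j => isOpen_ne.mem_nhds (hx j)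
  obtain ⟨r, hr, hb⟩ := Metric.eventually_nhds_iff_ball.1 h
  filter_upwards [ball_mem_nhds x hr] with z hz s j he
  exact hb _ (segment_mem_of_convex (convex_ball x r) (mem_ball_self hr) hz s) j
    (OnePoint.coe_injective he)

/-- A germ living on `V i`, seen at a point outside `K i`, is also a branch along a path outside all
the `K l`: the base point is joined to `x` within the connected collar `V i \ K i`. -/
theorem IsLogDerivGerm.exists_path (hN : IsPoleNhds (T τ₀) K V) {x : ℂ} {f : ℂ → Mat k}
    (hQ : IsHolomorphicFamily Q D) (hY : IsNormalizedSolution Q D Y)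
    (hT : Differentiable ℂ T) (hT₀ : T τ₀ ∈ D)
    (h : IsLogDerivGerm Y T τ₀ K V S x f) (hx : ∀ i, x ∉ K i) :
    ∃ α : Path OnePoint.infty (x : OnePoint ℂ), AvoidsSets K α ∧
      ∀ᶠ z in 𝓝 x, IsLogDeriv Y T τ₀ (α.trans (seg x z)) (f z - S z) := by
  rcases h with h | ⟨i, p, α, g, h1, h2, h3, h4, h5⟩
  · exact h
  have hO : IsOpen (V i \ K i) := (hN.isOpen i).sdiff (hN.isCompact i).isClosed
  obtain ⟨β, hβ⟩ := exists_path_of_isPreconnected hO (hN.isPreconnected i) h2 ⟨h1, hx i⟩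
  have hβK : ∀ s l, β s ∉ K l := fun s l hl => (hβ s).2 <| by
    rwa [hN.eq_of_mem i l _ (hβ s).1 (hN.subset l hl)]
  have hβS := avoidsSets_toSphere hβK
  refine ⟨α.trans (toSphere β), h3.trans hβS, ?_⟩
  obtain ⟨r, hr, hrV⟩ := Metric.isOpen_iff.1 hO x ⟨h1, hx i⟩
  filter_upwards [h5, ball_mem_nhds x hr,
    eventually_avoidsPoles_seg (t := T τ₀) fun j he => hx j (he ▸ hN.mem j)] with z hz hzr hzs
  rw [IsLogDeriv.trans_assoc hQ hY hT hT₀ (h3.avoidsPoles hN.mem) (hβS.avoidsPoles hN.mem) hzs,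
    toSphere_trans_seg, hz]
  refine h4.2 z _ (trans_mem (fun s => ⟨(hβ s).1, fun he => ?_⟩) fun s => ?_)
  · exact (hβ s).2 (by rw [mem_singleton_iff.1 he]; exact hN.mem i)
  · have := hrV (segment_mem_of_convex (convex_ball x r) (mem_ball_self hr) hzr s)
    exact ⟨this.1, fun he => this.2 (by rw [mem_singleton_iff.1 he]; exact hN.mem i)⟩

theorem IsLogDerivGerm.analyticAt (hN : IsPoleNhds (T τ₀) K V)
    (hQ : IsHolomorphicFamily Q D) (hY : IsNormalizedSolution Q D Y)
    (hT : Differentiable ℂ T) (hT₀ : T τ₀ ∈ D)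
    (hS : ∀ z, (∀ j, z ≠ T τ₀ j) → DifferentiableAt ℂ S z) {x : ℂ} {f : ℂ → Mat k}
    (h : IsLogDerivGerm Y T τ₀ K V S x f) : AnalyticAt ℂ f x := by
  rcases h with ⟨α, hα, h⟩ | ⟨i, p, α, g, h1, h2, h3, h4, h5⟩
  · have hx : ∀ j, x ≠ T τ₀ j := fun j he => hα.target j (he ▸ hN.mem j)
    obtain ⟨r, hr, -, hav, hex⟩ := exists_isLogDeriv_sub hQ hY hT hT₀ hS hx one_pos
    have hα' := hα.avoidsPoles hN.mem
    obtain ⟨g, hg, hgd⟩ := hex α hα' (mem_ball_self hr)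
    refine (hg.analyticAt (ball_mem_nhds x hr)).congr ?_
    refine eventuallyEq_of_isLogDeriv hQ hY hT₀ hα' (eventually_avoidsPoles_seg hx) ?_ h
    filter_upwards [ball_mem_nhds x hr] with z hz
    exact hgd _ fun s => seg_mem_nbhd (mem_ball_self hr) hz s
  · exact (h4.1.analyticAt ((hN.isOpen i).mem_nhds h1)).congr h5.symm

/-- Away from the `K i` a germ is first rewritten as a branch along a path and then continued in a
disc that misses them. Around a point of `K i` the disc lies in `V i`: a branch arriving at `y`
along `α` is extended by `hpole` with base point `y`, and a germ already living on some `V l` has `l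
= i` by disjointness. All paths `α` are needed in `hpole`, since any branch may arrive. -/
theorem IsLogDerivGerm.exists_extension (hN : IsPoleNhds (T τ₀) K V)
    (hQ : IsHolomorphicFamily Q D) (hY : IsNormalizedSolution Q D Y)
    (hT : Differentiable ℂ T) (hT₀ : T τ₀ ∈ D)
    (hS : ∀ z, (∀ j, z ≠ T τ₀ j) → DifferentiableAt ℂ S z)
    (hpole : ∀ i, ∀ p ∈ V i \ K i, ∀ α : Path OnePoint.infty (p : OnePoint ℂ), AvoidsSets K α →
      ∃ g, HasPoleExpansion Y T τ₀ S (V i) (T τ₀ i) α g) (x : ℂ) :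
    ∃ r > 0, ∀ y ∈ ball x r, ∀ f, IsLogDerivGerm Y T τ₀ K V S y f →
      ∃ g, g =ᶠ[𝓝 y] f ∧ ∀ z ∈ ball x r, IsLogDerivGerm Y T τ₀ K V S z g := by
  by_cases hx : ∀ i, x ∉ K i
  · obtain ⟨R, hR, hRK⟩ := exists_nbhd_notMem hN.isCompact (a := x)
      fun i z hz he => hx i ((OnePoint.coe_injective he : x = z) ▸ hz)
    have hxp : ∀ j, x ≠ T τ₀ j := fun j he => hx j (he ▸ hN.mem j)
    obtain ⟨r, hr, hrR, hav, hex⟩ := exists_isLogDeriv_sub hQ hY hT hT₀ hS hxp hR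
    have hsub : nbhd (x : OnePoint ℂ) r ⊆ nbhd (x : OnePoint ℂ) R :=
      image_mono (ball_subset_ball hrR)
    have hmem : ∀ z ∈ ball x r, (z : OnePoint ℂ) ∈ nbhd (x : OnePoint ℂ) r := fun z hz => by
      rw [nbhd_coe]; exact ⟨z, hz, rfl⟩
    have hbK : ∀ z ∈ ball x r, ∀ i, z ∉ K i := fun z hz i hi => hRK z (hsub (hmem z hz)) i z hi rfl
    refine ⟨r, hr, fun y hy f hf => ?_⟩
    obtain ⟨α, hα, h⟩ := hf.exists_path hN hQ hY hT hT₀ (hbK y hy)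
    have hα' := hα.avoidsPoles hN.mem
    obtain ⟨g, hg, hgd⟩ := hex α hα' hy
    refine ⟨g, ?_, fun z hz => Or.inl ⟨α.trans (seg y z), ?_, ?_⟩⟩
    · refine eventuallyEq_of_isLogDeriv hQ hY hT₀ hα' (eventually_avoidsPoles_seg
        fun j he => hbK y hy j (he ▸ hN.mem j)) ?_ h
      filter_upwards [isOpen_ball.mem_nhds hy] with z hz
      exact hgd _ fun s => seg_mem_nbhd hy hz s
    · exact hα.trans fun s i w hw => hRK _ (hsub (seg_mem_nbhd hy hz s)) i w hw
    · filter_upwards [isOpen_ball.mem_nhds hz] with w hw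
      rw [IsLogDeriv.trans_assoc hQ hY hT hT₀ hα' (fun s j => hav _ (seg_mem_nbhd hy hz s) j)
        (fun s j => hav _ (seg_mem_nbhd hz hw s) j)]
      exact hgd _ (trans_mem (seg_mem_nbhd hy hz) (seg_mem_nbhd hz hw))
  · push Not at hx
    obtain ⟨i, hi⟩ := hx
    obtain ⟨r, hr, hrV⟩ := Metric.isOpen_iff.1 (hN.isOpen i) x (hN.subset i hi)
    refine ⟨r, hr, fun y hy f hf => ?_⟩
    rcases hf with ⟨α, hα, h⟩ | ⟨l, p, α, g, h1, h2, h3, h4, h5⟩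
    · have hyV : y ∈ V i \ K i := ⟨hrV hy, hα.target i⟩
      obtain ⟨g, hg⟩ := hpole i y hyV α hα
      refine ⟨g, ?_, fun z hz => Or.inr ⟨i, y, α, g, hrV hz, hyV, hα, hg, EventuallyEq.rfl⟩⟩
      refine eventuallyEq_of_isLogDeriv hQ hY hT₀ (hα.avoidsPoles hN.mem)
        (eventually_avoidsPoles_seg fun j he => hα.target j (he ▸ hN.mem j)) ?_ h
      have hO : IsOpen (V i \ {T τ₀ i}) := (hN.isOpen i).sdiff isClosed_singleton
      have hyO : y ∈ V i \ {T τ₀ i} :=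
        ⟨hyV.1, fun he => hyV.2 (by rw [mem_singleton_iff.1 he]; exact hN.mem i)⟩
      obtain ⟨ρ, hρ, hρO⟩ := Metric.isOpen_iff.1 hO y hyO
      filter_upwards [ball_mem_nhds y hρ] with z hz
      exact hg.2 z _ fun s =>
        hρO (segment_mem_of_convex (convex_ball y ρ) (mem_ball_self hρ) hz s)
    · obtain rfl := hN.eq_of_mem i l y (hrV hy) h1
      exact ⟨g, h5.symm, fun z hz => Or.inr ⟨i, p, α, g, hrV hz, h2, h3, h4, EventuallyEq.rfl⟩⟩

/-- The paths in a neighborhood of the center of a chart. -/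
theorem exists_path_nbhd {a x : OnePoint ℂ} {r : ℝ} (hx : x ∈ nbhd a r) :
    ∃ γ : Path a x, ∀ s, γ s ∈ nbhd a r := by
  obtain ⟨u, hu, rfl⟩ := hx
  have h0 : (0 : ℂ) ∈ ball 0 r := mem_ball_self (dist_nonneg.trans_lt (mem_ball.1 hu))
  refine ⟨((Path.segment 0 u).map (continuous_chart a)).cast (chart_zero a).symm rfl, fun s => ?_⟩
  exact ⟨_, segment_mem_of_convex (convex_ball _ _) h0 hu s, rfl⟩

theorem isLogDeriv_refl (hQ : IsHolomorphicFamily Q D) (hY : IsNormalizedSolution Q D Y)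
    (hT : Differentiable ℂ T) (hT₀ : T τ₀ ∈ D) :
    IsLogDeriv Y T τ₀ (Path.refl OnePoint.infty) 0 := by
  rw [IsLogDeriv, zero_mul]
  refine (hasDerivAt_const τ₀ (1 : Mat k)).congr_of_eventuallyEq ?_
  filter_upwards [eventually_mem hQ hT hT₀] with τ hτ
  exact hY.refl_eq_one hQ hτ

theorem isLogDeriv_refl_trans (hQ : IsHolomorphicFamily Q D) (hY : IsNormalizedSolution Q D Y)
    (hT : Differentiable ℂ T) (hT₀ : T τ₀ ∈ D) {x : OnePoint ℂ} {γ : Path OnePoint.infty x}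
    (hγ : AvoidsPoles (T τ₀) γ) {G : Mat k}
    (h : IsLogDeriv Y T τ₀ ((Path.refl OnePoint.infty).trans γ) G) : IsLogDeriv Y T τ₀ γ G := by
  refine h.congr ?_
  filter_upwards [eventually_mem hQ hT hT₀, eventually_avoidsPoles hT.continuous hγ] with τ h1 h2
  obtain ⟨y, hy, hy0, hy1⟩ := hY.exists_continuation h1 h2
  have hmem : ∀ s : unitInterval, max (2 * (s : ℝ) - 1) 0 ∈ unitInterval := fun s =>
    ⟨le_max_right _ _, max_le (by linarith [s.2.2]) zero_le_one⟩
  rw [← hy1]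
  refine (hY.eq_of_comp hQ h1 hy hy0 (φ := fun s => ⟨max (2 * (s : ℝ) - 1) 0, hmem s⟩)
    (by fun_prop) (Subtype.ext (by simp)) fun s => ?_).trans
    (congrArg y (Subtype.ext (by norm_num)))
  rw [Path.trans_apply]
  split_ifs with hs
  · have : (⟨max (2 * (s : ℝ) - 1) 0, hmem s⟩ : unitInterval) = 0 :=
      Subtype.ext (max_eq_right (by linarith))
    rw [this, γ.source]
    rfl
  · congr 1
    exact Subtype.ext (max_eq_left (by linarith)).symm

end

/-! ### Liouville's theorem for the logarithmic derivative -/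

section

variable {n k : ℕ} {Q : Fin n → (Fin n → ℂ) → Mat k} {D : Set (Fin n → ℂ)}
  {Y : (Fin n → ℂ) → (x : OnePoint ℂ) → Path OnePoint.infty x → Mat k}
  {T : ℂ → Fin n → ℂ} {τ₀ : ℂ} {K V : Fin n → Set ℂ} {S : ℂ → Mat k}

/-- By Liouville's theorem, the logarithmic derivative is equal to `-S` near infinity. -/
theorem exists_isLogDeriv_nbhd_infty (hN : IsPoleNhds (T τ₀) K V)
    (hQ : IsHolomorphicFamily Q D) (hY : IsNormalizedSolution Q D Y)
    (hT : Differentiable ℂ T) (hT₀ : T τ₀ ∈ D)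
    (hS : ∀ z, (∀ j, z ≠ T τ₀ j) → DifferentiableAt ℂ S z)
    (hS0 : Tendsto S (cocompact ℂ) (𝓝 0))
    (hpole : ∀ i, ∀ p ∈ V i \ K i, ∀ α : Path OnePoint.infty (p : OnePoint ℂ), AvoidsSets K α →
      ∃ g, HasPoleExpansion Y T τ₀ S (V i) (T τ₀ i) α g) :
    ∃ r > 0, ∀ {x : OnePoint ℂ} (γ : Path OnePoint.infty x),
      (∀ s, γ s ∈ nbhd OnePoint.infty r) → IsLogDeriv Y T τ₀ γ (x.elim 0 fun z => -S z) := by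
  obtain ⟨R, hR, hRK⟩ := exists_nbhd_notMem hN.isCompact (a := OnePoint.infty)
    fun i z _ => OnePoint.infty_ne_coe z
  obtain ⟨r, hr, hrR, hav, hex⟩ := exists_isLogDeriv hQ hY hT hT₀ (a := OnePoint.infty)
    (fun j => OnePoint.infty_ne_coe _) hR
  have hsub : nbhd OnePoint.infty r ⊆ nbhd OnePoint.infty R := image_mono (ball_subset_ball hrR)
  have hrefl : AvoidsPoles (T τ₀) (Path.refl OnePoint.infty) := avoidsPoles_refl_infty
  obtain ⟨g, hg, hgd⟩ := hex (Path.refl OnePoint.infty) hrefl (mem_nbhd_self _ hr)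
  -- The normalization `Y(∞, t) = I` for all `t` makes the derivative zero at `∞`.
  have hg0 : g 0 = 0 := by
    have h1 := hgd (Path.refl OnePoint.infty) fun s => mem_nbhd_self _ hr
    rw [Path.refl_trans_refl, coord_self] at h1
    exact h1.unique hQ hY hT₀ hrefl (isLogDeriv_refl hQ hY hT hT₀)
  have hmem : ∀ u ∈ ball (0 : ℂ) r \ {0}, ((u⁻¹ : ℂ) : OnePoint ℂ) ∈ nbhd OnePoint.infty r :=
    fun u hu => ⟨u, hu.1, by rw [chart_infty, atInfinity_of_ne hu.2]⟩
  -- An arbitrary point of the punctured disc around `∞`, at which the monodromy argument starts.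
  set u₀ : ℂ := ((r / 2 : ℝ) : ℂ) with hu₀
  have hu₀m : u₀ ∈ ball (0 : ℂ) r \ {0} := by
    refine ⟨?_, ?_⟩
    · rw [mem_ball_zero_iff, hu₀, Complex.norm_real, Real.norm_of_nonneg (half_pos hr).le]
      exact half_lt_self hr
    · simp [hu₀, hr.ne']
  obtain ⟨γ₀, hγ₀⟩ := exists_path_nbhd (hmem u₀ hu₀m)
  have hnK : ∀ {a b : OnePoint ℂ} {γ : Path a b}, (∀ s, γ s ∈ nbhd OnePoint.infty r) →
      AvoidsSets K γ := fun hγ s i z hz => hRK _ (hsub (hγ s)) i z hz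
  have hinfK : AvoidsSets K (Path.refl OnePoint.infty) := fun s i z _ => OnePoint.infty_ne_coe z
  have hgerm : IsLogDerivGerm Y T τ₀ K V S u₀⁻¹ (fun z => g z⁻¹ + S z) := by
    refine Or.inl ⟨(Path.refl OnePoint.infty).trans γ₀, hinfK.trans (hnK hγ₀), ?_⟩
    have hO : (fun z : ℂ => (z : OnePoint ℂ)) ⁻¹' nbhd OnePoint.infty r ∈ 𝓝 u₀⁻¹ :=
      OnePoint.continuous_coe.continuousAt.preimage_mem_nhds
        ((isOpen_nbhd _ _).mem_nhds (hmem u₀ hu₀m))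
    obtain ⟨ρ, hρ, hρO⟩ := Metric.mem_nhds_iff.1 hO
    filter_upwards [ball_mem_nhds _ hρ] with z hz
    have hseg : ∀ s, seg u₀⁻¹ z s ∈ nbhd OnePoint.infty r := fun s =>
      hρO (segment_mem_of_convex (convex_ball _ ρ) (mem_ball_self hρ) hz s)
    rw [IsLogDeriv.trans_assoc hQ hY hT hT₀ hrefl (fun s j => hav _ (hγ₀ s) j)
      (fun s j => hav _ (hseg s) j), add_sub_cancel_right]
    exact hgd (γ₀.trans (seg u₀⁻¹ z)) (trans_mem hγ₀ hseg)
  obtain ⟨f, hf0, hf⟩ := exists_forall_of_local_extension (IsLogDerivGerm Y T τ₀ K V S)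
    (fun x f g hfg h => h.congr hfg)
    (fun x f h => h.analyticAt hN hQ hY hT hT₀ hS)
    (IsLogDerivGerm.exists_extension hN hQ hY hT hT₀ hS hpole) hgerm
  have hfd : Differentiable ℂ f := fun z =>
    ((hf z).analyticAt hN hQ hY hT hT₀ hS).differentiableAt
  have hU : IsOpen (ball (0 : ℂ) r \ {0}) := isOpen_ball.sdiff isClosed_singleton
  -- The entire function agrees with the original branch only near `u₀⁻¹`; the identity theorem on
  -- the connected punctured disc extends this to a neighborhood of `∞`.
  have heq : EqOn (fun u => f u⁻¹) (fun u => g u + S u⁻¹) (ball (0 : ℂ) r \ {0}) := by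
    have d1 : DifferentiableOn ℂ (fun u => f u⁻¹) (ball (0 : ℂ) r \ {0}) := fun u hu =>
      (DifferentiableAt.comp u (hfd _) (differentiableAt_inv hu.2)).differentiableWithinAt
    have d2 : DifferentiableOn ℂ (fun u => g u + S u⁻¹) (ball (0 : ℂ) r \ {0}) := by
      refine DifferentiableOn.fun_add (hg.mono sdiff_subset) fun u hu => ?_
      have hd := hS u⁻¹ fun j he => hav _ (hmem u hu) j (congrArg _ he)
      exact (DifferentiableAt.comp u hd (differentiableAt_inv hu.2)).differentiableWithinAt
    refine AnalyticOnNhd.eqOn_of_preconnected_of_eventuallyEq (d1.analyticOnNhd hU)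
      (d2.analyticOnNhd hU) (isPreconnected_diff_singleton isOpen_ball
        (convex_ball _ _).isPreconnected (mem_ball_self hr)) hu₀m ?_
    have := (continuousAt_inv₀ hu₀m.2).eventually hf0
    filter_upwards [this] with u hu
    rw [hu, inv_inv]
  have hlim : Tendsto f (cocompact ℂ) (𝓝 0) := by
    have hinv : Tendsto (fun z : ℂ => z⁻¹) (cocompact ℂ) (𝓝[≠] 0) := by
      rw [← cobounded_eq_cocompact]
      exact tendsto_inv₀_cobounded'
    have h1 : Tendsto (fun z : ℂ => g z⁻¹ + S z) (cocompact ℂ) (𝓝 0) := by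
      have hgc : Tendsto g (𝓝 0) (𝓝 0) := by
        have := (hg.differentiableAt (ball_mem_nhds _ hr)).continuousAt
        rwa [ContinuousAt, hg0] at this
      simpa using ((hgc.mono_left nhdsWithin_le_nhds).comp hinv).add hS0
    refine h1.congr' ?_
    filter_upwards [hinv (inter_mem_nhdsWithin _ (ball_mem_nhds 0 hr))] with z hz
    have := heq (x := z⁻¹) ⟨hz.2, hz.1⟩
    simp only [inv_inv] at this
    exact this.symm
  have hzero : ∀ u ∈ ball (0 : ℂ) r \ {0}, g u = -S u⁻¹ := fun u hu => by
    have h1 := heq hu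
    -- Liouville's theorem for an entire function tending to zero at infinity.
    have h2 : f u⁻¹ = 0 := hfd.apply_eq_of_tendsto_cocompact _ hlim
    simp only [h2] at h1
    exact eq_neg_of_add_eq_zero_left h1.symm
  refine ⟨r, hr, fun {x} γ hγ => ?_⟩
  refine isLogDeriv_refl_trans hQ hY hT hT₀ (fun s j => hav _ (hγ s) j) ?_
  have h1 := hgd γ hγ
  have hx : x ∈ nbhd OnePoint.infty r := γ.target ▸ hγ 1
  obtain ⟨u, hu, rfl⟩ := hx
  rw [coord_chart] at h1
  by_cases hu0 : u = 0
  · subst hu0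
    rw [hg0] at h1
    simpa using h1
  · have hz := hzero u ⟨hu, hu0⟩
    rw [hz] at h1
    have : (chart OnePoint.infty u).elim 0 (fun z => -S z) = -S u⁻¹ := by
      rw [chart_infty, atInfinity_of_ne hu0]; rfl
    rw [this]
    exact h1

end

section

variable {n k : ℕ} {Q : Fin n → (Fin n → ℂ) → Mat k} {D : Set (Fin n → ℂ)}
  {Y : (Fin n → ℂ) → (x : OnePoint ℂ) → Path OnePoint.infty x → Mat k}
  {T : ℂ → Fin n → ℂ} {τ₀ : ℂ}

/-! ### Continuation of the logarithmic derivative along paths -/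

/-- The part of the path `α` up to the parameter value `s`. -/
def initialPath {X : Type*} [TopologicalSpace X] {a b : X} (α : Path a b) (s : unitInterval) :
    Path a (α s) :=
  (α.subpath 0 s).cast α.source.symm rfl

/-- The identity path of the unit interval. -/
def idPath : Path (0 : unitInterval) 1 where
  toFun := id
  source' := rfl
  target' := rfl

/-- The path in the unit interval from `0` to `s` and then to `s'`. -/
noncomputable def pairPath (s s' : unitInterval) : Path (0 : unitInterval) s' :=
  ((idPath.subpath 0 s).cast rfl rfl).trans ((idPath.subpath s s').cast rfl rfl)

theorem initialPath_trans_subpath {X : Type*} [TopologicalSpace X] {a b : X} (α : Path a b)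
    (s s' r : unitInterval) :
    ((initialPath α s).trans (α.subpath s s')) r = α (pairPath s s' r) := by
  refine (Path.trans_apply _ _ r).trans (Eq.trans ?_ (congrArg α (Path.trans_apply _ _ r)).symm)
  split_ifs <;> rfl

/-- Both sides are the value at `s'` of one continuation along `α`, even when `s' < s` and the path
turns back. -/
theorem trans_initialPath_eq (hQ : IsHolomorphicFamily Q D) (hY : IsNormalizedSolution Q D Y)
    {t : Fin n → ℂ} (ht : t ∈ D) {x : OnePoint ℂ} {α : Path OnePoint.infty x}
    (hα : AvoidsPoles t α) (s s' : unitInterval) :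
    Y t (α s') ((initialPath α s).trans (α.subpath s s')) = Y t (α s') (initialPath α s') := by
  obtain ⟨y, hy, hy0, hy1⟩ := hY.exists_continuation ht hα
  have h1 := hY.eq_of_comp hQ ht hy hy0 (pairPath s s').continuous (pairPath s s').source
    (initialPath_trans_subpath α s s')
  have h2 := hY.eq_of_comp hQ ht hy hy0 (δ := initialPath α s') (idPath.subpath 0 s').continuous
    (idPath.subpath 0 s').source fun r => rfl
  rw [h1, h2, (pairPath s s').target]
  exact congrArg y (idPath.subpath 0 s').target.symm

theorem AvoidsPoles.subpath {t : Fin n → ℂ} {a b : OnePoint ℂ} {α : Path a b}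
    (h : AvoidsPoles t α) (s s' : unitInterval) : AvoidsPoles t (α.subpath s s') :=
  fun _ j => h _ j

theorem AvoidsPoles.initialPath {t : Fin n → ℂ} {x : OnePoint ℂ} {α : Path OnePoint.infty x}
    (h : AvoidsPoles t α) (s : unitInterval) : AvoidsPoles t (initialPath α s) :=
  fun _ j => h _ j

/-- A formula for the logarithmic derivative which holds near infinity holds on the covering
surface. -/
theorem isLogDeriv_of_nbhd_infty (hQ : IsHolomorphicFamily Q D) (hY : IsNormalizedSolution Q D Y)
    (hT : Differentiable ℂ T) (hT₀ : T τ₀ ∈ D) {G : OnePoint ℂ → Mat k}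
    (hG : ∀ a u, (∀ j, chart a u ≠ T τ₀ j) → DifferentiableAt ℂ (fun v => G (chart a v)) u)
    {R : ℝ} (hR : 0 < R) (h0 : ∀ {x : OnePoint ℂ} (γ : Path OnePoint.infty x),
      (∀ s, γ s ∈ nbhd OnePoint.infty R) → IsLogDeriv Y T τ₀ γ (G x))
    {x : OnePoint ℂ} {α : Path OnePoint.infty x} (hα : AvoidsPoles (T τ₀) α) :
    IsLogDeriv Y T τ₀ α (G x) := by
  -- The formula is required on an open set around `α s`, not merely at this point, so that the
  -- identity theorem can propagate it.
  set P : unitInterval → Prop := fun s => ∃ O ∈ 𝓝 (α s), ∀ {z : OnePoint ℂ} (γ : Path (α s) z),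
    (∀ r, γ r ∈ O) → IsLogDeriv Y T τ₀ ((initialPath α s).trans γ) (G z) with hP
  have hstep : ∀ s₀, ∃ J ∈ 𝓝 s₀, ∀ {s s'}, s ∈ J → s' ∈ J → P s → P s' := by
    intro s₀
    obtain ⟨r₀, ε, Φ, hΦ⟩ := exists_isLocalFamily hQ hT hT₀ (hα s₀)
    obtain ⟨r, hr, hrr, hav, hex⟩ := exists_isLogDeriv hQ hY hT hT₀ (hα s₀) hΦ.r_pos
    obtain ⟨J, hJ, hJc, hJα⟩ := exists_ordConnected_nhds α (mem_nbhd_self (α s₀) hr)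
    refine ⟨J, hJ, fun {s s'} hs hs' ⟨O, hO, hOG⟩ => ?_⟩
    obtain ⟨g, hg, hgd⟩ := hex (initialPath α s) (hα.initialPath s) (hJα s hs)
    obtain ⟨u, hu, hue⟩ := hJα s hs
    have hGd : DifferentiableOn ℂ (fun v => G (chart (α s₀) v)) (ball 0 r) := fun v hv =>
      (hG _ v (hav _ ⟨v, hv, rfl⟩)).differentiableWithinAt
    have hgG : EqOn g (fun v => G (chart (α s₀) v)) (ball 0 r) := by
      refine AnalyticOnNhd.eqOn_of_preconnected_of_eventuallyEq (hg.analyticOnNhd isOpen_ball)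
        (hGd.analyticOnNhd isOpen_ball) (convex_ball _ _).isPreconnected hu ?_
      have hOu : chart (α s₀) ⁻¹' O ∈ 𝓝 u :=
        (continuous_chart _).continuousAt.preimage_mem_nhds (hue ▸ hO)
      obtain ⟨ρ, hρ, hρO⟩ := Metric.mem_nhds_iff.1 (inter_mem hOu (isOpen_ball.mem_nhds hu))
      filter_upwards [ball_mem_nhds u hρ] with v hv
      set γ : Path (α s) (chart (α s₀) v) :=
        ((Path.segment u v).map (continuous_chart (α s₀))).cast hue.symm rfl with hγ
      have hγm : ∀ r', Path.segment u v r' ∈ chart (α s₀) ⁻¹' O ∩ ball 0 r := fun r' =>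
        hρO (segment_mem_of_convex (convex_ball u ρ) (mem_ball_self hρ) hv r')
      have hγr : ∀ r', γ r' ∈ nbhd (α s₀) r := fun r' => ⟨_, (hγm r').2, rfl⟩
      have h1 := hgd γ hγr
      rw [coord_chart] at h1
      exact h1.unique hQ hY hT₀
        (avoidsPoles_trans.2 ⟨hα.initialPath s, fun r' j => hav _ (hγr r') j⟩)
        (hOG γ fun r' => (hγm r').1)
    refine ⟨nbhd (α s₀) r, (isOpen_nbhd _ _).mem_nhds (hJα s' hs'), fun {z} γ hγ => ?_⟩
    have hsub : ∀ r', α.subpath s s' r' ∈ nbhd (α s₀) r := fun r' => by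
      have : α.subpath s s' r' ∈ α '' uIcc s s' := by
        rw [← Path.range_subpath]; exact mem_range_self r'
      obtain ⟨q, hq, hqe⟩ := this
      rw [← hqe]
      exact hJα q (hJc.uIcc_subset hs hs' hq)
    have hz : z ∈ nbhd (α s₀) r := γ.target ▸ hγ 1
    have h1 := hgd ((α.subpath s s').trans γ) (trans_mem hsub hγ)
    rw [hgG (coord_mem_ball hz)] at h1
    simp only [chart_coord_of_mem hz] at h1
    have hγa : AvoidsPoles (T τ₀) γ := fun r' j => hav _ (hγ r') j
    rw [← IsLogDeriv.trans_assoc hQ hY hT hT₀ (hα.initialPath s) (hα.subpath s s') hγa] at h1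
    -- The paths to `α s'` through `α s` and directly along `α` give the same value of `Y`, and
    -- hence so do their prolongations by `γ`.
    refine h1.congr ?_
    have hnb : ∀ r', γ r' ∈ nbhd (α s₀) r₀ := fun r' => image_mono (ball_subset_ball hrr) (hγ r')
    filter_upwards [isOpen_ball.mem_nhds (mem_ball_self (x := τ₀) hΦ.ε_pos),
      eventually_mem hQ hT hT₀, eventually_avoidsPoles hT.continuous hα] with τ h2 h3 h4
    rw [hY.trans_eq hQ hΦ h2 (avoidsPoles_trans.2 ⟨h4.initialPath s, h4.subpath s s'⟩) hnb,
      hY.trans_eq hQ hΦ h2 (h4.initialPath s') hnb, trans_initialPath_eq hQ hY h3 h4]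
  have hP0 : P 0 := by
    refine ⟨nbhd OnePoint.infty R, ?_, fun {z} γ hγ => h0 _ (trans_mem (fun r => ?_) hγ)⟩
    · rw [α.source]
      exact (isOpen_nbhd _ _).mem_nhds (mem_nbhd_self _ hR)
    · have : initialPath α 0 r = α 0 := congrArg α (by simp)
      rw [this, α.source]
      exact mem_nbhd_self _ hR
  have hP1 : P 1 := (isPreconnected_univ.induction₂ (fun s s' => P s ↔ P s') (fun s _ => by
      rw [nhdsWithin_univ]
      obtain ⟨J, hJ, hJP⟩ := hstep s
      filter_upwards [hJ] with s' hs'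
      exact ⟨hJP (mem_of_mem_nhds hJ) hs', hJP hs' (mem_of_mem_nhds hJ)⟩)
    (fun _ _ _ _ _ _ h1 h2 => h1.trans h2) (fun _ _ _ _ h1 => h1.symm) (mem_univ 0)
    (mem_univ 1)).1 hP0
  obtain ⟨O, hO, hOG⟩ := hP1
  -- The constant path at the end point, appended to the whole of `α`, is removed by a
  -- reparametrization.
  have h1 := hOG ((Path.refl x).cast α.target rfl) fun r => by
    have := mem_of_mem_nhds hO
    rwa [α.target] at this
  refine h1.congr ?_
  filter_upwards [eventually_mem hQ hT hT₀, eventually_avoidsPoles hT.continuous hα] with τ h2 h3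
  obtain ⟨y, hy, hy0, hy1⟩ := hY.exists_continuation h2 h3
  rw [← hy1]
  refine (hY.eq_of_comp hQ h2 hy hy0 (pairPath 1 1).continuous (pairPath 1 1).source
    fun r => ?_).trans (congrArg y (pairPath 1 1).target)
  rw [← initialPath_trans_subpath, Path.trans_apply, Path.trans_apply]
  split_ifs
  · rfl
  · rw [Path.subpath_self]
    exact α.target.symm

/-- In the coordinate `u = 1/x` the function `1/(x - τ)` is `u/(1 - uτ)`, which is holomorphic and
zero at `u = 0`. -/
theorem differentiableAt_elim_chart {τ : ℂ} {a : OnePoint ℂ} {u : ℂ} (h : chart a u ≠ τ)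
    (q : Mat k) : DifferentiableAt ℂ (fun v => (chart a v).elim 0 fun z => -((z - τ)⁻¹ • q)) u := by
  have h1 := one_sub_mul_invPole_ne h
  induction a using OnePoint.rec with
  | coe c =>
    have h2 : c + u - τ ≠ 0 := fun h0 => h (by rw [chart_coe, sub_eq_zero.1 h0])
    have h3 : DifferentiableAt ℂ (fun v => c + v - τ) u := by fun_prop
    exact ((h3.fun_inv h2).smul_const q).fun_neg
  | infty =>
    have h2 : DifferentiableAt ℂ (fun v => 1 - v * τ) u := by fun_prop
    have h3 : DifferentiableAt ℂ (fun v => -((v * (1 - v * τ)⁻¹) • q)) u :=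
      ((differentiableAt_id.fun_mul (h2.fun_inv h1)).smul_const q).fun_neg
    have h4 : ∀ᶠ v in 𝓝 u, 1 - v * τ ≠ 0 := by
      have : Continuous fun v : ℂ => 1 - v * τ := by fun_prop
      exact this.continuousAt.eventually_ne h1
    refine h3.congr_of_eventuallyEq ?_
    filter_upwards [h4] with v hv
    by_cases hv0 : v = 0
    · simp [hv0]
    · rw [chart_infty, atInfinity_of_ne hv0]
      change -((v⁻¹ - τ)⁻¹ • q) = _
      have : v⁻¹ - τ = v⁻¹ * (1 - v * τ) := by field_simp
      rw [this, mul_inv, inv_inv]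

/-- The equation `∂Y/∂tⱼ = -(Qⱼ / (x - tⱼ)) Y` on the covering surface. -/
theorem IsNormalizedSolution.hasDerivAt_update (hQ : IsHolomorphicFamily Q D)
    (hiso : IsIsoprincipal Q D) (hY : IsNormalizedSolution Q D Y) {t : Fin n → ℂ} (ht : t ∈ D)
    (j : Fin n) {x : OnePoint ℂ} {α : Path OnePoint.infty x} (hα : AvoidsPoles t α) :
    HasDerivAt (fun τ : ℂ => Y (Function.update t j τ) x α)
      (-(poleFactor (t j) x • Q j t) * Y t x α) (t j) := by
  obtain ⟨W, V, hWV, hex⟩ := hiso t ht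
  have hself : Function.update t j (t j) = t := Function.update_eq_self j t
  have hN : IsPoleNhds (Function.update t j (t j)) (fun i => closure (W i)) V :=
    hself.symm ▸ hWV.isPoleNhds
  have hD : Function.update t j (t j) ∈ D := hself.symm ▸ ht
  -- Only the `j`-th pole moves; isoprincipality is used with `t` itself as the center of the
  -- neighborhoods.
  have hT := differentiable_update t j
  have hS : ∀ z, (∀ i, z ≠ Function.update t j (t j) i) →
      DifferentiableAt ℂ (fun z => (z - t j)⁻¹ • Q j t) z := fun z hz => by
    rw [hself] at hz
    have h1 : DifferentiableAt ℂ (fun z => z - t j) z := by fun_prop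
    exact (h1.fun_inv (sub_ne_zero.2 (hz j))).smul_const _
  have hS0 : Tendsto (fun z => (z - t j)⁻¹ • Q j t) (cocompact ℂ) (𝓝 0) := by
    have h1 : Tendsto (fun z : ℂ => (z - t j)⁻¹) (cocompact ℂ) (𝓝 0) := by
      rw [← cobounded_eq_cocompact]
      exact tendsto_inv₀_cobounded.comp (tendsto_sub_const_cobounded (t j))
    simpa using h1.smul_const (Q j t)
  obtain ⟨r, hr, h⟩ := exists_isLogDeriv_nbhd_infty hN hQ hY hT hD hS hS0 fun i p hp α hα => by
    obtain ⟨g, hg⟩ := exists_isLogDeriv_near_pole hQ hY ht hWV j i hp hα (hex i p hp α hα)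
    exact ⟨g, by rw [hself]; exact hg⟩
  have key := isLogDeriv_of_nbhd_infty hQ hY hT hD
    (G := fun x => x.elim 0 fun z => -((z - t j)⁻¹ • Q j t))
    (fun a u hu => differentiableAt_elim_chart (by simpa [hself] using hu j) _) hr h
    (α := α) (hself.symm ▸ hα)
  rw [IsLogDeriv, hself] at key
  refine HasDerivAt.congr_deriv key ?_
  congr 1
  induction x using OnePoint.rec with
  | coe z => rfl
  | infty => simp [poleFactor]

end

end Fuchsian

/-! ### The auxiliary system -/

theorem proposition3p2 {n k : ℕ} (Q : Fin n → (Fin n → ℂ) → Fuchsian.Mat k)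
    (D : Set (Fin n → ℂ)) (hQ : Fuchsian.IsHolomorphicFamily Q D)
    (hiso : Fuchsian.IsIsoprincipal Q D)
    (Y : (Fin n → ℂ) → (x : OnePoint ℂ) → Path OnePoint.infty x → Fuchsian.Mat k)
    (hY : Fuchsian.IsNormalizedSolution Q D Y) (t : Fin n → ℂ) (ht : t ∈ D) :
    -- `∂Y/∂x = (∑ⱼ Qⱼ(t) / (x - tⱼ)) Y` at every finite point `(x, α)` of the covering surface
    (∀ (x : ℂ) (α : Path OnePoint.infty (x : OnePoint ℂ)), Fuchsian.AvoidsPoles t α →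
      HasDerivAt
        (fun z : ℂ => Y t (z : OnePoint ℂ) (α.trans (Fuchsian.toSphere (Path.segment x z))))
        ((∑ j, (x - t j)⁻¹ • Q j t) * Y t (x : OnePoint ℂ) α) x) ∧
    -- `∂Y/∂tⱼ = -(Qⱼ(t) / (x - tⱼ)) Y` at every point `(x, α)` of the covering surface
    (∀ (j : Fin n) (x : OnePoint ℂ) (α : Path OnePoint.infty x), Fuchsian.AvoidsPoles t α →
      HasDerivAt (fun τ : ℂ => Y (Function.update t j τ) x α)
        (-(Fuchsian.poleFactor (t j) x • Q j t) * Y t x α) (t j)) := by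
  exact ⟨fun x α hα => hY.hasDerivAt hQ ht hα,
    fun j x α hα => hY.hasDerivAt_update hQ hiso ht j hα⟩
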